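/- Let $\kappa$ be the security parameter, let $m,n,l$ be polynomially bounded functions of $\kappa$, and let $\mathbb G=\mathbb G_\kappa$ be a family of finite cyclic groups with generator $g$ and order $q$, whose elements have unique encodings of polynomial length and whose multiplication is computable by circuits of polynomial size. Let $H:\{0,1\}^l\to\mathbb G$ be a random oracle (a uniformly random function to which all parties, simulators and distinguishers have access). There are $m$ parties $P_1,\dots,P_m$ (indices modulo $m$), and $P_i$ has an input set $X_i=\{x_i^1,\dots,x_i^n\}\subseteq\{0,1\}^l$ of $n$ elements, listed in some order. *Functionality (multi-party private-ID).* For every $x\in\bigcup_i X_i$ choose an independent uniform identifier $R(x)\in\mathbb G$. Party $P_i$ gets the set $R^*=\{R(x): x\in\bigcup_p X_p\}$ and the identifiers $R_i=(R(x_i^1),\dots,R(x_i^n))$ of its own elements. *Protocol.* 1. Each $P_i$ samples $a_i,k_i$ uniformly from $\mathbb Z_q$ and sends $(H(x_i^1)^{a_i},\dots,H(x_i^n)^{a_i})$ to $P_{i+1}$. For $j=1,\dots,m-1$, $P_{i+j}$ raises the entries of the list that it receives from $P_{i+j-1}$ to the power $k_{i+j}$ and sends the result to $P_{i+j+1}$.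 2. When its own list comes back, $P_i$ raises its entries to the power $a_i^{-1}k_i$, which gives $R_i=(r_i^1,\dots,r_i^n)$ (so $r_i^j=H(x_i^j)^{k_1\cdots k_m}$ if $a_i$ is invertible modulo $q$). 3. The parties call the ideal functionality for private set union with the sets $\{r_i^1,\dots,r_i^n\}$; it gives the union $R^*$ to $P_1$ only, and $P_1$ sends $R^*$ to the other parties. 4. $P_i$ outputs $(R^*,R_i)$. *Theorem.* If the decisional Diffie–Hellman assumption holds for $\mathbb G$, that is, if $(g^a,g^b,g^{ab})$ and $(g^a,g^b,g^c)$ with independent uniform $a,b,c\in\mathbb Z_q$ are indistinguishable by circuit families of polynomial size, then the protocol securely implements the functionality against semi-honest adversaries that corrupt any set of $t<m$ parties: there is a simulator of polynomial size, with access to $H$, that gets a set $C$ of corrupted parties, their inputs and their outputs, such that for all families of sets $C$ with $|C|<m$ and of inputs $X_1,\dots,X_m$, the joint distribution of the views of the parties in $C$ (input, random choices, received messages, answers of the union functionality) and the outputs of all parties in the protocol is indistinguishable, by circuit families of polynomial size with access to $H$, from the joint distribution of the simulated views and the outputs of all parties computed by the functionality. -/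

import Mathlib

open Finset

/-! ### Computation: non-uniform circuits over integers, with an oracle -/

/-- The binary operations that a gate may perform on natural numbers. -/
inductive GateOp
  | add
  | sub
  | mul
  | div
  | mod
  | lt

/-- The value of an operation (`x - y` is truncated at `0`, `x / 0 = 0`, `x % 0 = x`). -/
def GateOp.apply : GateOp → ℕ → ℕ → ℕ
  | .add, x, y => x + y
  | .sub, x, y => x - y
  | .mul, x, y => x * y
  | .div, x, y => x / y
  | .mod, x, y => x % y
  | .lt, x, y => if x < y then 1 else 0

/-- Circuits with input wires `α` and output wires `β`; a wire carries a natural number.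
Wires may be dropped, permuted and copied (`wire`); a circuit can be run on the outputs of another
one (`comp`), and two circuits on the same inputs (`pair`). The gates are integer constants,
binary operations whose result is truncated to `b` bits, and oracle queries. -/
inductive Circuit : Type → Type → Type 1
  | wire {α β : Type} (σ : β → α) : Circuit α β
  | const {α : Type} (c : ℕ) : Circuit α Unit
  | gate (o : GateOp) (b : ℕ) : Circuit (Fin 2) Unit
  | query : Circuit Unit Unit
  | comp {α β γ : Type} (f : Circuit α β) (g : Circuit β γ) : Circuit α γ
  | pair {α β γ : Type} (f : Circuit α β) (g : Circuit α γ) : Circuit α (β ⊕ γ)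

namespace Circuit

/-- The function computed by a circuit, relative to the oracle `O`. -/
def eval (O : ℕ → ℕ) : {α β : Type} → Circuit α β → (α → ℕ) → β → ℕ
  | _, _, wire σ, v => fun i => v (σ i)
  | _, _, const c, _ => fun _ => c
  | _, _, gate o b, v => fun _ => o.apply (v 0) (v 1) % 2 ^ b
  | _, _, query, v => fun _ => O (v ())
  | _, _, comp f g, v => g.eval O (f.eval O v)
  | _, _, pair f g, v => Sum.elim (f.eval O v) (g.eval O v)

/-- The size of a circuit: the number of gates, each counted with the bit length of its result
(oracle queries count `1`). Every operation on integers of polynomial bit length is computed by a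
Boolean circuit of polynomial size, so that circuits of polynomial size, on inputs of
polynomial bit length, have exactly the power of Boolean circuits of polynomial size. -/
def size : {α β : Type} → Circuit α β → ℕ
  | _, _, wire _ => 0
  | _, _, const c => c.size + 1
  | _, _, gate _ b => b + 1
  | _, _, query => 1
  | _, _, comp f g => f.size + g.size
  | _, _, pair f g => f.size + g.size

end Circuit

/-- The trivial oracle, for circuits that have no oracle. -/
def noOracle : ℕ → ℕ := fun _ => 0

/-- Polynomially bounded functions of the security parameter. -/
def PolyBounded (f : ℕ → ℕ) : Prop :=
  ∃ p : Polynomial ℕ, ∀ κ, f κ ≤ p.eval κ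

/-- Negligible functions of the security parameter. -/
def Negligible (f : ℕ → ℝ) : Prop :=
  Asymptotics.SuperpolynomialDecay Filter.atTop (fun κ : ℕ => (κ : ℝ)) f

/-! ### Computational indistinguishability -/

/-- An ensemble of random data on the wires `ι κ`, together with an oracle, which may depend on the
same random experiment. At security parameter `κ` the experiment is a uniform point of the
finite sample space `Ω κ`. -/
structure Ensemble (ι : ℕ → Type) where
  Ω : ℕ → Type
  [fintype : ∀ κ, Fintype (Ω κ)]
  oracle : ∀ κ, Ω κ → ℕ → ℕ
  data : ∀ κ, Ω κ → ι κ → ℕ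

attribute [instance] Ensemble.fintype

/-- The probability that the circuit `D`, with access to the oracle, outputs `1` on the data. -/
noncomputable def Ensemble.accept {ι : ℕ → Type} (E : Ensemble ι) (κ : ℕ)
    (D : Circuit (ι κ) Unit) : ℝ :=
  (#{ω : E.Ω κ | D.eval (E.oracle κ ω) (E.data κ ω) () = 1} : ℝ) / Fintype.card (E.Ω κ)

/-- Indistinguishability by (non-uniform) circuit families of polynomial size. Distinguishers need
no coins, since the best choice of the coins can be wired into the circuits. -/
def CompIndist {ι : ℕ → Type} (E F : Ensemble ι) : Prop :=
  ∀ D : ∀ κ, Circuit (ι κ) Unit, PolyBounded (fun κ => (D κ).size) →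
    Negligible fun κ => |E.accept κ (D κ) - F.accept κ (D κ)|

/-! ### Groups and the DDH assumption -/

/-- A family of finite cyclic groups with a generator, whose elements are represented by integers of
polynomial bit length (each by exactly one), and with efficient multiplication. -/
structure GroupFamily where
  Carrier : ℕ → Type
  [group : ∀ κ, Group (Carrier κ)]
  [fintype : ∀ κ, Fintype (Carrier κ)]
  [decEq : ∀ κ, DecidableEq (Carrier κ)]
  gen : ∀ κ, Carrier κ
  generates : ∀ κ (y : Carrier κ), y ∈ Subgroup.zpowers (gen κ)
  len : ℕ → ℕ
  len_poly : PolyBounded len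
  code : ∀ κ, Carrier κ → ℕ
  code_injective : ∀ κ, Function.Injective (code κ)
  code_lt : ∀ κ y, code κ y < 2 ^ len κ
  mul_efficient : ∃ c : ℕ → Circuit (Fin 2) Unit, PolyBounded (fun κ => (c κ).size) ∧
    ∀ κ (y z : Carrier κ), (c κ).eval noOracle ![code κ y, code κ z] () = code κ (y * z)

attribute [instance] GroupFamily.group GroupFamily.fintype GroupFamily.decEq

/-- The order of the group. -/
def GroupFamily.q (𝔾 : GroupFamily) (κ : ℕ) : ℕ := Fintype.card (𝔾.Carrier κ)

instance (𝔾 : GroupFamily) (κ : ℕ) : NeZero (𝔾.q κ) :=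
  ⟨(Fintype.card_pos_iff.mpr ⟨1⟩).ne'⟩

/-- The tuples `(g ^ a, g ^ b, g ^ (a * b))` with independent uniform `a, b` in `ℤ/q`. -/
def ddhReal (𝔾 : GroupFamily) : Ensemble fun _ => Fin 3 where
  Ω κ := ZMod (𝔾.q κ) × ZMod (𝔾.q κ)
  oracle _ _ := noOracle
  data κ ω := ![𝔾.code κ (𝔾.gen κ ^ ω.1.val), 𝔾.code κ (𝔾.gen κ ^ ω.2.val),
    𝔾.code κ (𝔾.gen κ ^ (ω.1 * ω.2).val)]

/-- The tuples `(g ^ a, g ^ b, g ^ c)` with independent uniform `a, b, c` in `ℤ/q`. -/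
def ddhRandom (𝔾 : GroupFamily) : Ensemble fun _ => Fin 3 where
  Ω κ := ZMod (𝔾.q κ) × ZMod (𝔾.q κ) × ZMod (𝔾.q κ)
  oracle _ _ := noOracle
  data κ ω := ![𝔾.code κ (𝔾.gen κ ^ ω.1.val), 𝔾.code κ (𝔾.gen κ ^ ω.2.1.val),
    𝔾.code κ (𝔾.gen κ ^ ω.2.2.val)]

/-- The decisional Diffie-Hellman assumption. -/
def DDH (𝔾 : GroupFamily) : Prop := CompIndist (ddhReal 𝔾) (ddhRandom 𝔾)

/-! ### The functionalities and the protocol, for `m` parties with sets of `n` strings of `l` bits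

The parties are `0, …, m - 1`, and party `0` is the leader. The input set of party `i` is
listed as `x i 0, …, x i (n - 1)`. -/

instance (l : ℕ) : Fintype (BitVec l) :=
  Fintype.ofEquiv (Fin (2 ^ l)) ⟨BitVec.ofFin, BitVec.toFin, fun _ => rfl, fun _ => rfl⟩

section Protocol

variable {G : Type} [Group G] [Fintype G] [DecidableEq G] {m n l q : ℕ}

/-- Output of a party: all identifiers, and the identifiers of its own elements, in their order. -/
structure Output (G : Type) (n : ℕ) where
  all : Finset G
  own : Fin n → G

/-- The multi-party private-ID functionality: `R y` is the random identifier of `y`. (Only the values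
of `R` on the union of the input sets are used.) -/
def mpid (x : Fin m → Fin n → BitVec l) (R : BitVec l → G) (i : Fin m) : Output G n where
  all := (univ.biUnion fun p => univ.image (x p)).image R
  own := fun j => R (x i j)

/-- The private set union functionality: the union goes to the leader, the others get nothing. -/
def mpsu (Y : Fin m → Finset G) (i : Fin m) : Option (Finset G) :=
  if i.val = 0 then some (univ.biUnion Y) else none

/-- The party `r` steps after party `i` on the ring of the parties. -/
def ahead (i : Fin m) (r : ℕ) : Fin m := ⟨(i.val + r) % m, Nat.mod_lt _ i.pos⟩

/-- The random choices `(a, k)` of a party. -/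
abbrev Tape (q : ℕ) := ZMod q × ZMod q

/-- The list that starts with party `i`, after `r` further parties have raised it to their keys;
this is what party `i + r` sends to party `i + r + 1`. -/
def ringMsg (H : BitVec l → G) (x : Fin m → Fin n → BitVec l) (ω : Fin m → Tape q) (i : Fin m) :
    ℕ → Fin n → G
  | 0, j => H (x i j) ^ (ω i).1.val
  | r + 1, j => ringMsg H x ω i r j ^ (ω (ahead i (r + 1))).2.val

/-- The list that comes back to party `i` after passing through all other parties, unmasked and
raised to the key of party `i`. -/
def ownIds (H : BitVec l → G) (x : Fin m → Fin n → BitVec l) (ω : Fin m → Tape q) (i : Fin m)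
    (j : Fin n) : G :=
  ringMsg H x ω i (m - 1) j ^ ((ω i).1⁻¹ * (ω i).2).val

/-- What party `i` gets from the private set union functionality in the protocol. -/
def mpsuOut (H : BitVec l → G) (x : Fin m → Fin n → BitVec l) (ω : Fin m → Tape q) (i : Fin m) :
    Option (Finset G) :=
  mpsu (fun p => univ.image (ownIds H x ω p)) i

/-- The message with the union that party `i` gets from the leader, unless it is the leader. -/
def leaderMsg (H : BitVec l → G) (x : Fin m → Fin n → BitVec l) (ω : Fin m → Tape q) (i : Fin m) :
    Option (Finset G) :=
  if i.val = 0 then none else mpsuOut H x ω ⟨0, i.pos⟩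

/-- The output of party `i` in the protocol. -/
def realOutput (H : BitVec l → G) (x : Fin m → Fin n → BitVec l) (ω : Fin m → Tape q) (i : Fin m) :
    Output G n where
  all := ((mpsuOut H x ω i).or (leaderMsg H x ω i)).getD ∅
  own := ownIds H x ω i

/-- The view of a party: input, random choices, the list received from its predecessor on the ring in
each of the `m` rounds, output of the private set union functionality, message from the leader. -/
structure View (G : Type) (m n l q : ℕ) where
  input : Fin n → BitVec l
  tape : Tape q
  received : Fin m → Fin n → G
  mpsuOut : Option (Finset G)
  leaderMsg : Option (Finset G)

/-- The view of party `i`. In round `r` (counted from `0`) it receives the list that started with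
party `i - (r + 1)`; in the last round this is its own list. -/
def realView (H : BitVec l → G) (x : Fin m → Fin n → BitVec l) (ω : Fin m → Tape q) (i : Fin m) :
    View G m n l q where
  input := x i
  tape := ω i
  received := fun r => ringMsg H x ω (ahead i (m - 1 - r.val)) r.val
  mpsuOut := mpsuOut H x ω i
  leaderMsg := leaderMsg H x ω i

/-! Representation of outputs and views on wires. -/

/-- A set of group elements, as the increasing list of its codes (plus `1`), filled up with `0`. -/
def encodeSet (code : G → ℕ) (s : Finset G) (t : ℕ) : ℕ :=
  (((s.image code).sort)[t]?).elim 0 (· + 1)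

/-- The wires of an output. -/
inductive OutputWire (m n : ℕ)
  | all (t : Fin (m * n))
  | own (j : Fin n)

/-- The wires of a view. -/
inductive ViewWire (m n : ℕ)
  | input (j : Fin n)
  | tapeA
  | tapeK
  | received (r : Fin m) (j : Fin n)
  | mpsuOut (t : Fin (m * n))
  | leaderMsg (t : Fin (m * n))

def Output.encode (code : G → ℕ) (o : Output G n) : OutputWire m n → ℕ
  | .all t => encodeSet code o.all t
  | .own j => code (o.own j)

def View.encode (code : G → ℕ) (v : View G m n l q) : ViewWire m n → ℕ
  | .input j => (v.input j).toNat
  | .tapeA => v.tape.1.val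
  | .tapeK => v.tape.2.val
  | .received r j => code (v.received r j)
  | .mpsuOut t => v.mpsuOut.elim 0 fun s => encodeSet code s t
  | .leaderMsg t => v.leaderMsg.elim 0 fun s => encodeSet code s t

/-- The function `H` as an oracle on integers. -/
def hashOracle (code : G → ℕ) (H : BitVec l → G) : ℕ → ℕ := fun y => code (H (BitVec.ofNat l y))

end Protocol

/-! ### Simulation-based security -/

/-- A simulator for the corrupted parties `C`: a circuit with oracle access that produces the views of
the parties in `C` from their inputs, their outputs, and uniform coins (`coins` bits and as many
elements of `ℤ/q`). -/
structure Simulator (m n : ℕ) (C : Finset (Fin m)) where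
  coins : ℕ
  circuit : Circuit ((C × Fin n) ⊕ (C × OutputWire m n) ⊕ (Fin coins ⊕ Fin coins))
    (C × ViewWire m n)

def Simulator.size {m n : ℕ} {C : Finset (Fin m)} (S : Simulator m n C) : ℕ :=
  S.coins + S.circuit.size

section Security

variable (𝔾 : GroupFamily) (m n l : ℕ → ℕ)

/-- The data shown to the distinguisher: views of the parties in `C`, outputs of all parties. -/
abbrev ExecWire (C : ∀ κ, Finset (Fin (m κ))) (κ : ℕ) : Type :=
  (C κ × ViewWire (m κ) (n κ)) ⊕ (Fin (m κ) × OutputWire (m κ) (n κ))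

/-- The real execution on inputs `x`, with a uniformly random function `H` as oracle. -/
def realExec (C : ∀ κ, Finset (Fin (m κ)))
    (x : ∀ κ, Fin (m κ) → Fin (n κ) → BitVec (l κ)) : Ensemble (ExecWire m n C) where
  Ω κ := (BitVec (l κ) → 𝔾.Carrier κ) × (Fin (m κ) → Tape (𝔾.q κ))
  oracle κ ω := hashOracle (𝔾.code κ) ω.1
  data κ ω := Sum.elim
    (fun w => (realView ω.1 (x κ) ω.2 w.1).encode (𝔾.code κ) w.2)
    (fun w => (realOutput ω.1 (x κ) ω.2 w.1).encode (𝔾.code κ) w.2)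

/-- The ideal execution on inputs `x`: the functionality computes the outputs, and the simulator the
views of the corrupted parties, with the same random oracle (which it cannot program). -/
noncomputable def idealExec (S : ∀ κ (C : Finset (Fin (m κ))), Simulator (m κ) (n κ) C)
    (C : ∀ κ, Finset (Fin (m κ)))
    (x : ∀ κ, Fin (m κ) → Fin (n κ) → BitVec (l κ)) : Ensemble (ExecWire m n C) where
  Ω κ := (BitVec (l κ) → 𝔾.Carrier κ) × (BitVec (l κ) → 𝔾.Carrier κ) ×
    (Fin (S κ (C κ)).coins → Bool) × (Fin (S κ (C κ)).coins → ZMod (𝔾.q κ))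
  oracle κ ω := hashOracle (𝔾.code κ) ω.1
  data κ ω := Sum.elim
    ((S κ (C κ)).circuit.eval (hashOracle (𝔾.code κ) ω.1)
      (Sum.elim (fun w => (x κ w.1 w.2).toNat)
        (Sum.elim
          (fun w => (mpid (x κ) ω.2.1 w.1).encode (𝔾.code κ) w.2)
          (Sum.elim (fun s => (ω.2.2.1 s).toNat) (fun s => (ω.2.2.2 s).val)))))
    (fun w => (mpid (x κ) ω.2.1 w.1).encode (𝔾.code κ) w.2)

/-- One simulator, whose size is polynomial uniformly in the set of corrupted parties, works for all
families of corrupted sets and of inputs; an input set of `n` elements is an injective list.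
The conditions on these families are asymptotic, as the conclusion is. So:
the DH-based protocol securely implements the multi-party private-ID functionality against
semi-honest adversaries that corrupt fewer than `m` parties, in the random oracle model and
the hybrid model for private set union. -/
def SecurelyImplementsMPID : Prop :=
  ∃ S : ∀ κ (C : Finset (Fin (m κ))), Simulator (m κ) (n κ) C,
    (∃ p : Polynomial ℕ, ∀ κ C, (S κ C).size ≤ p.eval κ) ∧
    ∀ (C : ∀ κ, Finset (Fin (m κ))) (x : ∀ κ, Fin (m κ) → Fin (n κ) → BitVec (l κ)),
      (∀ᶠ κ in Filter.atTop, #(C κ) < m κ) →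
      (∀ᶠ κ in Filter.atTop, ∀ i, Function.Injective (x κ i)) →
        CompIndist (realExec 𝔾 m n l C x) (idealExec 𝔾 m n l S C x)

end Security

/-! Write `H y` as `g ^ w y` with independent uniform exponents `w y`. A message that starts at
party `p` is then `g` to the power `w x * a_p` times the keys on the path travelled so far. Once the
tapes of the corrupted parties are fixed, it is a known power of `g` to a monomial in the honest
secrets: one base exponent `w x`, the mask `a_p` if `p` is honest, and the honest keys on the path.
Under DDH such powers are indistinguishable from independent uniform elements, one for each distinct
monomial (`monomials_pseudorandom`). The proof is a hybrid argument over the variables, and for each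
variable over the elements that it multiplies (`one_key_pseudorandom`).

The simulator draws tapes for all parties. It starts the lists of honest parties from random
elements. It runs the lists of corrupted parties forward from `H` until every honest party has been
passed, and from then on computes them backwards from the given identifiers, by inverting the keys
of the remaining parties, which are all corrupted. The ideal data are again known powers of
monomials, with bases of three kinds: hash values, identifiers, random list entries. Two slots carry
the same monomial in the real execution exactly when they do in the ideal one
(`realLabel_injective`, `idealLabel_slotName_eq_iff`), so both executions are close to the same
distribution (`expect_labels`, `real_sub_ideal_le`). An honest party must exist, since otherwise the
identifiers would carry the same monomials as the hash values, which the distinguisher can query.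

Two matters remain. The distinguisher has a random oracle and DDH circuits have none.
`Circuit.exists_oracleFree` samples the oracle lazily: the hash values at the inputs are supplied on
wires, and all other answers are hard-wired. Moreover `q` need not be prime, so masks and keys can
fail to be invertible. DDH itself makes this improbable, because a small prime factor of `q` would
give a distinguisher (`one_div_prime_le`, `expect_not_isUnit_le`).

All reductions are inequalities at a fixed security parameter against `ddhAdv`, the best advantage
of circuits of a given size; asymptotics enter only at the end. -/

open scoped BigOperators

/-! ### Building circuits -/

/-- The circuit in which every oracle gate is replaced by the constant `0`. -/
def Circuit.deoracle : {α β : Type} → Circuit α β → Circuit α β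
  | _, _, .wire σ => .wire σ
  | _, _, .const c => .const c
  | _, _, .gate o b => .gate o b
  | _, _, .query => .const 0
  | _, _, .comp f g => .comp f.deoracle g.deoracle
  | _, _, .pair f g => .pair f.deoracle g.deoracle

theorem Circuit.size_deoracle {α β : Type} (c : Circuit α β) : c.deoracle.size = c.size := by
  induction c <;> simp_all [Circuit.deoracle, Circuit.size]

/-- The group multiplication circuit is only known to be correct relative to `noOracle`, but it has
to serve inside simulators and distinguishers that run with a real oracle. -/
theorem Circuit.eval_deoracle {α β : Type} (c : Circuit α β) (O : ℕ → ℕ) (v : α → ℕ) :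
    c.deoracle.eval O v = c.eval noOracle v := by
  induction c <;> simp_all [Circuit.deoracle, Circuit.eval, noOracle]

/-- In the situations `e`, in which the oracle is `O e` and the input wires carry `v e`, the numbers
`f e` are computed by one circuit of size at most `s`. -/
def Comput {E : Type*} {α : Type} (O : E → ℕ → ℕ) (v : E → α → ℕ) (s : ℕ) (f : E → ℕ) : Prop :=
  ∃ c : Circuit α Unit, c.size ≤ s ∧ ∀ e, c.eval (O e) (v e) () = f e

/-- The analogue of `Comput` for several output wires. -/
def ComputVec {E : Type*} {α β : Type} (O : E → ℕ → ℕ) (v : E → α → ℕ) (s : ℕ)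
    (w : E → β → ℕ) : Prop :=
  ∃ c : Circuit α β, c.size ≤ s ∧ ∀ e, c.eval (O e) (v e) = w e

section Comput

variable {E : Type*} {α : Type} {O : E → ℕ → ℕ} {v : E → α → ℕ} {s t u : ℕ} {f g h : E → ℕ}

theorem Comput.mono (hf : Comput O v s f) (hst : s ≤ t) : Comput O v t f := by
  obtain ⟨c, hc, h⟩ := hf
  exact ⟨c, hc.trans hst, h⟩

theorem ComputVec.mono {β : Type} {w : E → β → ℕ} (hf : ComputVec O v s w) (hst : s ≤ t) :
    ComputVec O v t w := by
  obtain ⟨c, hc, h⟩ := hf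
  exact ⟨c, hc.trans hst, h⟩

theorem Comput.congr (hf : Comput O v s f) (hfg : ∀ e, f e = g e) : Comput O v s g := by
  obtain rfl : f = g := funext hfg
  exact hf

theorem Comput.wire (i : α) : Comput O v 0 fun e => v e i :=
  ⟨.wire fun _ => i, by simp [Circuit.size], fun _ => rfl⟩

theorem Comput.const (c : ℕ) : Comput O v (c.size + 1) fun _ => c :=
  ⟨.const c, by simp [Circuit.size], fun _ => rfl⟩

theorem Comput.const_of_lt {c b : ℕ} (hc : c < 2 ^ b) : Comput O v (b + 1) fun _ => c :=
  (Comput.const c).mono (by simpa using Nat.size_le.2 hc)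

theorem Comput.query (hf : Comput O v s f) : Comput O v (s + 1) fun e => O e (f e) := by
  obtain ⟨c, hc, h⟩ := hf
  refine ⟨.comp c .query, by simpa [Circuit.size] using hc, fun e => ?_⟩
  simp [Circuit.eval, h]

/-- This is how intermediate results are shared: the cost `s` is paid once, however often the wires
of `w` are read. -/
theorem ComputVec.comput {β : Type} {w : E → β → ℕ} (hw : ComputVec O v s w)
    (hf : Comput O w t f) : Comput O v (s + t) f := by
  obtain ⟨c, hc, h⟩ := hw
  obtain ⟨d, hd, h'⟩ := hf
  refine ⟨.comp c d, by simp only [Circuit.size]; omega, fun e => ?_⟩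
  simp [Circuit.eval, h, h']

theorem Comput.vec {w : E → Unit → ℕ} (h : Comput O v s fun e => w e ()) :
    ComputVec O v s w := by
  obtain ⟨c, hc, h⟩ := h
  exact ⟨c, hc, fun e => funext fun _ => h e⟩

theorem Comput.comp_unit {f : E → ℕ} (hf : Comput O v s f)
    (hg : Comput O (fun e (_ : Unit) => f e) t g) : Comput O v (s + t) g :=
  ComputVec.comput (Comput.vec (w := fun e _ => f e) hf) hg

theorem ComputVec.rewire {β γ : Type} {w : E → β → ℕ} (hw : ComputVec O v s w) (σ : γ → β) :
    ComputVec O v s fun e i => w e (σ i) := by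
  obtain ⟨c, hc, h⟩ := hw
  exact ⟨.comp c (.wire σ), by simpa [Circuit.size] using hc, fun e => by simp [Circuit.eval, h]⟩

theorem ComputVec.pair {β γ : Type} {w : E → β → ℕ} {z : E → γ → ℕ} (hw : ComputVec O v s w)
    (hz : ComputVec O v t z) : ComputVec O v (s + t) fun e => Sum.elim (w e) (z e) := by
  obtain ⟨c, hc, h⟩ := hw
  obtain ⟨d, hd, h'⟩ := hz
  refine ⟨.pair c d, by simp only [Circuit.size]; omega, fun e => ?_⟩
  simp [Circuit.eval, h, h']

theorem ComputVec.pi_fin {N : ℕ} {w : E → Fin N → ℕ} (hw : ∀ i, Comput O v s fun e => w e i) :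
    ComputVec O v (N * s) w := by
  induction N with
  | zero => exact ⟨.wire Fin.elim0, by simp [Circuit.size], fun e => funext fun i => i.elim0⟩
  | succ N ih =>
    have h1 := (ih (w := fun e i => w e i.castSucc) fun i => hw i.castSucc).pair
      (Comput.vec (w := fun e _ => w e (Fin.last N)) (hw (Fin.last N)))
    have h2 := (h1.rewire fun i : Fin (N + 1) =>
      Fin.lastCases (motive := fun _ => Fin N ⊕ Unit) (Sum.inr ()) Sum.inl i).mono
      (t := (N + 1) * s) (by linarith)
    convert h2 using 3 with e i
    induction i using Fin.lastCases <;> simp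

theorem ComputVec.pi {ι : Type} [Fintype ι] {w : E → ι → ℕ}
    (hw : ∀ i, Comput O v s fun e => w e i) : ComputVec O v (Fintype.card ι * s) w := by
  have h := (ComputVec.pi_fin (w := fun e i => w e ((Fintype.equivFin ι).symm i))
    fun i => hw _).rewire (Fintype.equivFin ι)
  simpa using h

theorem Comput.gate (o : GateOp) (b : ℕ) (hf : Comput O v s f) (hg : Comput O v t g) :
    Comput O v (s + t + b + 1) fun e => o.apply (f e) (g e) % 2 ^ b := by
  have h := ((Comput.vec (w := fun e _ => f e) hf).pair
    (Comput.vec (w := fun e _ => g e) hg)).rewire ![Sum.inl (), Sum.inr ()]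
  refine (h.comput (t := b + 1) ?_).mono (by omega)
  exact ⟨.gate o b, by simp [Circuit.size], fun e => by simp [Circuit.eval]⟩

theorem Comput.gate_of_lt (o : GateOp) (b : ℕ) (hf : Comput O v s f) (hg : Comput O v t g)
    (hb : ∀ e, o.apply (f e) (g e) < 2 ^ b) :
    Comput O v (s + t + b + 1) fun e => o.apply (f e) (g e) :=
  (hf.gate o b hg).congr fun e => Nat.mod_eq_of_lt (hb e)

theorem Comput.bit_lt (hf : Comput O v s f) (hg : Comput O v t g) :
    Comput O v (s + t + 2) fun e => if f e < g e then 1 else 0 :=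
  hf.gate_of_lt .lt 1 hg fun e => by simp only [GateOp.apply]; split_ifs <;> simp

/-- Logical operations on wires that carry truth values. -/
theorem Comput.bit_not {p : E → Prop} [DecidablePred p]
    (hf : Comput O v s fun e => if p e then 1 else 0) :
    Comput O v (s + 4) fun e => if p e then 0 else 1 := by
  refine (((Comput.const 1).gate_of_lt .sub 1 hf fun e => ?_).congr fun e => ?_).mono ?_
  · simp only [GateOp.apply]; split_ifs <;> simp
  · simp only [GateOp.apply]; split_ifs <;> simp
  · simp [Nat.size]; omega

theorem Comput.bit_and {p r : E → Prop} [DecidablePred p] [DecidablePred r]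
    (hf : Comput O v s fun e => if p e then 1 else 0)
    (hg : Comput O v t fun e => if r e then 1 else 0) :
    Comput O v (s + t + 2) fun e => if p e ∧ r e then 1 else 0 := by
  refine (hf.gate_of_lt .mul 1 hg fun e => ?_).congr fun e => ?_
  · simp only [GateOp.apply]; split_ifs <;> simp
  · simp only [GateOp.apply]; split_ifs <;> simp_all

/-- Equality test; the wires are copied, so that their cost counts once. -/
theorem Comput.bit_eq (hf : Comput O v s f) (hg : Comput O v t g) :
    Comput O v (s + t + 14) fun e => if f e = g e then 1 else 0 := by
  have h := ((Comput.vec (w := fun e _ => f e) hf).pair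
    (Comput.vec (w := fun e _ => g e) hg)).rewire ![Sum.inl (), Sum.inr ()]
  refine (h.comput (t := 14) ?_).mono (by omega)
  have h0 : Comput O (fun e (i : Fin 2) => Sum.elim (fun _ : Unit => f e) (fun _ : Unit => g e)
    ((![Sum.inl (), Sum.inr ()] : Fin 2 → Unit ⊕ Unit) i)) 0 f := Comput.wire 0
  have h1 : Comput O (fun e (i : Fin 2) => Sum.elim (fun _ : Unit => f e) (fun _ : Unit => g e)
    ((![Sum.inl (), Sum.inr ()] : Fin 2 → Unit ⊕ Unit) i)) 0 g := Comput.wire 1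
  have h2 := (h0.bit_lt h1).bit_not
  have h3 := (h1.bit_lt h0).bit_not
  have h4 : ∀ p : E → Prop, [DecidablePred p] → ∀ e,
      (if p e then 0 else 1) = if ¬ p e then 1 else 0 := fun p _ e => by split_ifs <;> rfl
  refine ((h2.congr (h4 _)).bit_and (h3.congr (h4 _))).congr fun e => ?_
  simp only [not_lt, ← le_antisymm_iff]
  exact if_congr eq_comm rfl rfl

/-- Selection between two wires that carry numbers of `b` bits. -/
theorem Comput.select {p : E → Prop} [DecidablePred p] (b : ℕ)
    (hp : Comput O v s fun e => if p e then 1 else 0) (hf : Comput O v t f) (hg : Comput O v u g)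
    (hfb : ∀ e, f e < 2 ^ b) (hgb : ∀ e, g e < 2 ^ b) :
    Comput O v (s + t + u + 3 * b + 7) fun e => if p e then f e else g e := by
  have hb : 0 < 2 ^ b := by positivity
  have h := ((Comput.vec (w := fun e (_ : Unit) => if p e then 1 else 0) hp).pair
    (Comput.vec (w := fun e (_ : Unit) => f e) hf)).pair
    (Comput.vec (w := fun e (_ : Unit) => g e) hg)
  refine (h.comput (t := 3 * b + 7) ?_).mono (by omega)
  have hp' := Comput.wire (O := O) (v := fun e => Sum.elim (Sum.elim
    (fun _ : Unit => if p e then 1 else 0) fun _ : Unit => f e) fun _ : Unit => g e)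
    (Sum.inl (Sum.inl ()))
  have hf' := Comput.wire (O := O) (v := fun e => Sum.elim (Sum.elim
    (fun _ : Unit => if p e then 1 else 0) fun _ : Unit => f e) fun _ : Unit => g e)
    (Sum.inl (Sum.inr ()))
  have hg' := Comput.wire (O := O) (v := fun e => Sum.elim (Sum.elim
    (fun _ : Unit => if p e then 1 else 0) fun _ : Unit => f e) fun _ : Unit => g e)
    (Sum.inr ())
  simp only [Sum.elim_inl, Sum.elim_inr] at hp' hf' hg'
  -- Selection is `p * f + (1 - p) * g`, where one of the two products is always `0`.
  have h1 := hp'.gate_of_lt .mul b hf' fun e => by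
    simp only [GateOp.apply]; split_ifs <;> simp [hfb, hb]
  have h2 := hp'.bit_not.gate_of_lt .mul b hg' fun e => by
    simp only [GateOp.apply]; split_ifs <;> simp [hgb, hb]
  refine ((h1.gate_of_lt .add b h2 fun e => ?_).congr fun e => ?_).mono (by omega)
  · simp only [GateOp.apply]; split_ifs <;> simp [hfb, hgb]
  · simp only [GateOp.apply]; split_ifs <;> simp

/-- Sums of `N` numbers with a sum of at most `b` bits. -/
theorem Comput.sum_fin (b : ℕ) {N : ℕ} {F : Fin N → E → ℕ} (hF : ∀ i, Comput O v s (F i))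
    (hb : ∀ e, ∑ i, F i e < 2 ^ b) :
    Comput O v (N * (s + b + 1) + 1) fun e => ∑ i, F i e := by
  induction N with
  | zero => simpa using Comput.const 0
  | succ N ih =>
    simp only [Fin.sum_univ_castSucc] at hb ⊢
    have h1 := ih (F := fun i => F i.castSucc) (fun i => hF _) fun e =>
      (Nat.le_add_right _ _).trans_lt (hb e)
    exact (h1.gate_of_lt .add b (hF (Fin.last N)) hb).mono (by ring_nf; omega)

theorem Comput.sum (b : ℕ) {ι : Type} [Fintype ι] {F : ι → E → ℕ}
    (hF : ∀ i, Comput O v s (F i)) (hb : ∀ e, ∑ i, F i e < 2 ^ b) :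
    Comput O v (Fintype.card ι * (s + b + 1) + 1) fun e => ∑ i, F i e := by
  have h : ∀ e, ∑ i, F ((Fintype.equivFin ι).symm i) e = ∑ i, F i e := fun e =>
    (Fintype.equivFin ι).symm.sum_comp fun i => F i e
  exact (Comput.sum_fin b (F := fun i => F ((Fintype.equivFin ι).symm i)) (fun i => hF _)
    fun e => (h e).symm ▸ hb e).congr h

/-- A disjunction of `N` conditions. -/
theorem Comput.bit_exists {N : ℕ} {p : Fin N → E → Prop} [∀ i, DecidablePred (p i)]
    (hp : ∀ i, Comput O v s fun e => if p i e then 1 else 0) :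
    Comput O v (N * (s + 14) + 1) fun e => if ∃ i, p i e then 1 else 0 := by
  induction N with
  | zero => simpa using Comput.const 0
  | succ N ih =>
    -- De Morgan reduces a disjunction to the conjunction and negation of bits.
    have h1 := (ih (p := fun i => p i.castSucc) fun i => hp _).bit_not
    have h2 := (hp (Fin.last N)).bit_not
    have h4 : ∀ p : E → Prop, [DecidablePred p] → ∀ e,
      (if p e then 0 else 1) = if ¬ p e then 1 else 0 := fun p _ e => by split_ifs <;> rfl
    refine (((h1.congr (h4 _)).bit_and (h2.congr (h4 _))).bit_not.congr fun e => ?_).mono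
      (t := (N + 1) * (s + 14) + 1) (by ring_nf; omega)
    simp only [Fin.exists_fin_succ', ← not_or, ite_not]

end Comput

/-! ### Arithmetic in monoids whose elements are coded by integers -/

/-- Elements of `M` are coded by integers of `b` bits, and circuits of size `μ` multiply them. -/
structure CodedMul {M : Type} [Mul M] (code : M → ℕ) (b μ : ℕ) : Prop where
  code_lt : ∀ y, code y < 2 ^ b
  mul : ∃ c : Circuit (Fin 2) Unit, c.size ≤ μ ∧
    ∀ O y z, c.eval O ![code y, code z] () = code (y * z)

/-- The cost of raising an element to an exponent of `L` bits. -/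
def powCost (b μ L : ℕ) : ℕ := b + 1 + L * (2 * μ + 2 * L + 4 * b + 16)

section CodedMul

variable {E : Type*} {α : Type} {O : E → ℕ → ℕ} {v : E → α → ℕ} {s t u b μ : ℕ}
variable {M : Type} {code : M → ℕ}

theorem Comput.codedMul [Mul M] (hM : CodedMul code b μ) {y z : E → M}
    (hy : Comput O v s fun e => code (y e)) (hz : Comput O v t fun e => code (z e)) :
    Comput O v (s + t + μ) fun e => code (y e * z e) := by
  have h := ((Comput.vec (w := fun e _ => code (y e)) hy).pair
    (Comput.vec (w := fun e _ => code (z e)) hz)).rewire ![Sum.inl (), Sum.inr ()]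
  obtain ⟨c, hc, hmul⟩ := hM.mul
  refine h.comput ⟨c, hc, fun e => ?_⟩
  refine Eq.trans (congrFun (congrArg _ (funext fun i => ?_)) ()) (hmul (O e) (y e) (z e))
  fin_cases i <;> rfl

/-- The wire of `y` is copied, so that `s` is not doubled; this keeps repeated squaring linear in
the number of exponent bits. -/
theorem Comput.codedSq [Mul M] (hM : CodedMul code b μ) {y : E → M}
    (hy : Comput O v s fun e => code (y e)) :
    Comput O v (s + μ) fun e => code (y e * y e) :=
  hy.comp_unit (((Comput.wire ()).codedMul hM (Comput.wire ())).mono (by omega))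

theorem Comput.codedPow_wire [Monoid M] (hM : CodedMul code b μ) {L : ℕ} {y : E → M} {k : E → ℕ}
    (hk : ∀ e, k e < 2 ^ L) (hy : Comput O v 0 fun e => code (y e)) (hk' : Comput O v 0 k) :
    Comput O v (powCost b μ L) fun e => code (y e ^ k e) := by
  -- Square and multiply from the top: after `d` steps the exponent consists of the leading `d` of
  -- the `L` bits.
  have key : ∀ d ≤ L, Comput O v (b + 1 + d * (2 * μ + 2 * L + 4 * b + 16))
      fun e => code (y e ^ (k e / 2 ^ (L - d))) := by
    intro d hd
    induction d with
    | zero =>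
      refine ((Comput.const_of_lt (hM.code_lt 1)).congr fun e => ?_).mono (by omega)
      rw [Nat.sub_zero, Nat.div_eq_of_lt (hk e), pow_zero]
    | succ d ih =>
      set i := L - (d + 1) with hi
      have hi' : L - d = i + 1 := by omega
      have h1 := (ih (by omega)).codedSq hM
      rw [hi'] at h1
      have h2 := hk'.gate_of_lt .div L
        (Comput.const_of_lt (b := L) (Nat.pow_lt_pow_right (by omega) (by omega : i < L)))
        fun e => (Nat.div_le_self _ _).trans_lt (hk e)
      have h3 := h2.gate_of_lt .mod 1 (Comput.const_of_lt (c := 2) (b := 2) (by norm_num)) fun e =>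
        Nat.mod_lt _ (by norm_num)
      have h4 : Comput O v (2 * L + 8) fun e => if k e / 2 ^ i % 2 = 1 then 1 else 0 := by
        refine (h3.congr fun e => ?_).mono (by omega)
        simp only [GateOp.apply]
        rcases Nat.mod_two_eq_zero_or_one (k e / 2 ^ i) with h | h <;> simp [h]
      have h5 := h4.select b hy (Comput.const_of_lt (hM.code_lt 1))
        (fun e => hM.code_lt _) (fun e => hM.code_lt _)
      have h6 : Comput O v (2 * L + 4 * b + 16) fun e =>
          code (if k e / 2 ^ i % 2 = 1 then y e else 1) :=
        (h5.congr fun e => by split_ifs <;> rfl).mono (by omega)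
      refine ((h1.codedMul hM h6).congr fun e => ?_).mono (by ring_nf; omega)
      have h7 : k e / 2 ^ i = 2 * (k e / 2 ^ (i + 1)) + k e / 2 ^ i % 2 := by
        rw [pow_succ, ← Nat.div_div_eq_div_mul]; omega
      congr 1
      conv_rhs => rw [h7, pow_add, two_mul, pow_add]
      rcases Nat.mod_two_eq_zero_or_one (k e / 2 ^ i) with h | h <;> simp [h]
  simpa [powCost] using key L le_rfl

theorem Comput.codedPow [Monoid M] (hM : CodedMul code b μ) {L : ℕ} {y : E → M} {k : E → ℕ}
    (hk : ∀ e, k e < 2 ^ L) (hy : Comput O v s fun e => code (y e)) (hk' : Comput O v t k) :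
    Comput O v (s + t + powCost b μ L) fun e => code (y e ^ k e) := by
  have h := (Comput.vec (w := fun e (_ : Unit) => code (y e)) hy).pair
    (Comput.vec (w := fun e (_ : Unit) => k e) hk')
  refine h.comput (Comput.codedPow_wire hM hk ?_ ?_)
  · exact Comput.wire (v := fun e => Sum.elim (fun _ : Unit => code (y e)) fun _ : Unit => k e)
      (Sum.inl ())
  · exact Comput.wire (v := fun e => Sum.elim (fun _ : Unit => code (y e)) fun _ : Unit => k e)
      (Sum.inr ())

theorem Comput.codedProd [CommMonoid M] (hM : CodedMul code b μ) {F : ℕ → E → M} {N : ℕ}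
    (hF : ∀ i < N, Comput O v s fun e => code (F i e)) :
    Comput O v (b + 1 + N * (s + μ)) fun e => code (∏ i ∈ range N, F i e) := by
  induction N with
  | zero => simpa using Comput.const_of_lt (hM.code_lt 1)
  | succ N ih =>
    simp only [prod_range_succ]
    exact ((ih fun i hi => hF i (by omega)).codedMul hM (hF N (by omega))).mono (by ring_nf; omega)

end CodedMul

theorem ZMod.codedMul (q b : ℕ) [NeZero q] (hq : q ≤ 2 ^ b) :
    CodedMul (ZMod.val : ZMod q → ℕ) b (4 * b + 5) where
  code_lt y := (ZMod.val_lt y).trans_le hq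
  mul := by
    -- The oracle is made part of the situation, because one circuit must be correct for every
    -- oracle.
    have h : Comput (E := (ℕ → ℕ) × ZMod q × ZMod q) (fun e => e.1)
        (fun e => ![e.2.1.val, e.2.2.val]) (4 * b + 5) fun e => (e.2.1 * e.2.2).val := by
      have hlt : ∀ y : ZMod q, y.val < 2 ^ b := fun y => (ZMod.val_lt y).trans_le hq
      have h1 := (Comput.wire (O := fun e : (ℕ → ℕ) × ZMod q × ZMod q => e.1)
        (v := fun e => ![e.2.1.val, e.2.2.val]) 0).gate_of_lt .mul (2 * b) (Comput.wire 1) fun e => by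
          rw [two_mul, pow_add]
          exact Nat.mul_lt_mul'' (hlt _) (hlt _)
      have h2 := h1.gate_of_lt .mod b (Comput.const_of_lt (c := q) (b := b + 1)
        (hq.trans_lt (Nat.pow_lt_pow_right (by omega) (by omega)))) fun e =>
          (Nat.mod_lt _ (NeZero.pos q)).trans_le hq
      exact (h2.congr fun e => (ZMod.val_mul _ _).symm).mono (by omega)
    obtain ⟨c, hc, h⟩ := h
    exact ⟨c, hc, fun O y z => h (O, y, z)⟩

/-- A power that inverts the units of `ℤ/q`. -/
def totientInv {q : ℕ} (k : ZMod q) : ZMod q := k ^ (q.totient - 1)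

theorem totientInv_mul {q : ℕ} [NeZero q] {k : ZMod q} (hk : IsUnit k) : totientInv k * k = 1 := by
  rw [totientInv, ← pow_succ, Nat.sub_add_cancel (Nat.totient_pos.2 (NeZero.pos q))]
  obtain ⟨u, rfl⟩ := hk
  rw [← Units.val_pow_eq_pow_val, ZMod.pow_totient, Units.val_one]

/-- The exponent `q.totient - 1` is a constant of the circuit, so inversion costs one exponentiation
and needs no Euclidean algorithm. -/
theorem Comput.totientInv {E : Type*} {α : Type} {O : E → ℕ → ℕ} {v : E → α → ℕ} {s b q : ℕ}
    [NeZero q] (hq : q ≤ 2 ^ b) {k : E → ZMod q} (hk : Comput O v s fun e => (k e).val) :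
    Comput O v (s + (b + 1) + powCost b (4 * b + 5) b) fun e => (totientInv (k e)).val := by
  have hlt : q.totient - 1 < 2 ^ b := by
    have := Nat.totient_le q
    have := NeZero.pos q
    omega
  exact Comput.codedPow (ZMod.codedMul q b hq) (fun _ => hlt) hk (Comput.const_of_lt hlt)

/-! ### Encodings of sets -/

/-- In a sorted list, the entry at position `t` is the only element with exactly `t` smaller ones.
The sum has at most one nonzero term, and no sorting circuit is needed. -/
theorem encodeSet_eq_sum {G : Type} [DecidableEq G] (code : G → ℕ) (S : Finset G) (t : ℕ) :
    encodeSet code S t =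
      ∑ c ∈ S.image code, if #{d ∈ S.image code | d < c} = t then c + 1 else 0 := by
  set A := S.image code with hA
  have hmap := A.map_orderEmbOfFin_univ rfl
  have hrank : ∀ i : Fin #A, #{d ∈ A | d < A.orderEmbOfFin rfl i} = i := by
    intro i
    have : ({d ∈ A | d < A.orderEmbOfFin rfl i} : Finset ℕ) =
        (Iio i).map (A.orderEmbOfFin rfl).toEmbedding := by
      ext d
      simp only [mem_filter, mem_map, mem_Iio, RelEmbedding.coe_toEmbedding]
      constructor
      · rintro ⟨hd, hlt⟩
        rw [← hmap] at hd
        obtain ⟨j, -, rfl⟩ := mem_map.1 hd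
        exact ⟨j, by simpa using hlt, rfl⟩
      · rintro ⟨j, hj, rfl⟩
        exact ⟨A.orderEmbOfFin_mem rfl j, by simpa using hj⟩
    rw [this, card_map, Fin.card_Iio]
  have hsum : (∑ c ∈ A, if #{d ∈ A | d < c} = t then c + 1 else 0) =
      ∑ i : Fin #A, if (i : ℕ) = t then A.orderEmbOfFin rfl i + 1 else 0 := by
    refine (sum_congr hmap.symm fun _ _ => rfl).trans ?_
    rw [sum_map]
    exact sum_congr rfl fun i _ => by
      simp only [RelEmbedding.coe_toEmbedding]
      rw [hrank]
  rw [hsum, encodeSet, ← hA]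
  by_cases ht : t < #A
  · rw [List.getElem?_eq_getElem (by simpa using ht), sum_eq_single ⟨t, ht⟩]
    · simp [orderEmbOfFin_apply]
    · intro i _ hi
      rw [if_neg]
      exact fun h => hi (Fin.ext h)
    · simp
  · rw [List.getElem?_eq_none (by simpa using ht), sum_eq_zero]
    · rfl
    · intro i _
      rw [if_neg (by have := i.2; omega)]

/-- Each value is counted at its first occurrence in the list. -/
theorem sum_image_univ_fin {N : ℕ} {α β : Type*} [DecidableEq α] [AddCommMonoid β] (f : Fin N → α)
    (g : α → β) :
    ∑ c ∈ univ.image f, g c = ∑ i, if ∃ j, j < i ∧ f j = f i then 0 else g (f i) := by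
  have h1 : univ.image f = ({i | ¬ ∃ j, j < i ∧ f j = f i} : Finset (Fin N)).image f := by
    ext c
    simp only [mem_image, mem_univ, true_and, mem_filter]
    constructor
    · rintro ⟨i, rfl⟩
      obtain ⟨j, hj, hmin⟩ := WellFounded.has_min (wellFounded_lt (α := Fin N)) {j | f j = f i}
        ⟨i, rfl⟩
      exact ⟨j, fun ⟨k, hk, hkj⟩ => hmin k (hkj.trans hj) hk, hj⟩
    · rintro ⟨i, -, rfl⟩
      exact ⟨i, rfl⟩
  rw [h1, sum_image, sum_filter]
  · exact sum_congr rfl fun i _ => by split_ifs <;> simp_all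
  · intro i hi j hj hij
    simp only [coe_filter, mem_univ, true_and, Set.mem_ofPred_eq, not_exists, not_and] at hi hj
    rcases lt_trichotomy i j with h | h | h
    · exact absurd hij (hj i h)
    · exact h
    · exact absurd hij.symm (hi j h)

theorem encodeSet_image_fin {G : Type} [DecidableEq G] (code : G → ℕ) {N : ℕ} (Y : Fin N → G)
    (t : ℕ) : encodeSet code (univ.image Y) t =
      ∑ i, if (¬ ∃ j, j < i ∧ code (Y j) = code (Y i)) ∧
        (∑ k, if (¬ ∃ j, j < k ∧ code (Y j) = code (Y k)) ∧ code (Y k) < code (Y i) then 1 else 0) = t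
        then code (Y i) + 1 else 0 := by
  have himg : (univ.image Y).image code = univ.image fun i => code (Y i) := by
    rw [image_image]; rfl
  rw [encodeSet_eq_sum, himg, sum_image_univ_fin]
  have hrank : ∀ i, #{d ∈ univ.image fun i => code (Y i) | d < code (Y i)} =
      ∑ k, if (¬ ∃ j, j < k ∧ code (Y j) = code (Y k)) ∧ code (Y k) < code (Y i) then 1 else 0 := by
    intro i
    rw [card_filter, sum_image_univ_fin]
    exact sum_congr rfl fun k _ => by split_ifs <;> simp_all
  refine sum_congr rfl fun i _ => ?_
  rw [hrank]
  split_ifs <;> simp_all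

theorem encodeSet_lt {G : Type} [DecidableEq G] {code : G → ℕ} {b : ℕ}
    (hb : ∀ y, code y < 2 ^ b) (S : Finset G) (t : ℕ) : encodeSet code S t < 2 ^ (b + 1) := by
  rw [encodeSet]
  have h2 : 2 ^ (b + 1) = 2 ^ b + 2 ^ b := by ring
  cases h : ((S.image code).sort)[t]? with
  | none => simp
  | some c =>
    have hc := List.mem_of_getElem? h
    simp only [mem_sort, mem_image] at hc
    obtain ⟨y, -, rfl⟩ := hc
    have := hb y
    simp only [Option.elim_some]
    omega

/-- The cost of finding one entry of the encoding of a set of `N` elements, listed in some order. -/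
def encodeCost (b N : ℕ) : ℕ :=
  N * ((N * 28 + 5) + (N * ((N * 28 + 5) + 4 + N + 1) + 1 + (N + 1) + 14) + 2 + (b + 4 + b + 1) + 1 +
    3 * (b + 1) + 7 + (b + 1) + 1) + 1

theorem Comput.encodeSet {E : Type*} {α : Type} {O : E → ℕ → ℕ} {v : E → α → ℕ} {b : ℕ} {G : Type}
    [DecidableEq G] {code : G → ℕ} (hb : ∀ y, code y < 2 ^ b) {N : ℕ} {Y : E → Fin N → G}
    (hY : ∀ i, Comput O v 0 fun e => code (Y e i)) (t : ℕ) :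
    Comput O v (encodeCost b N) fun e => _root_.encodeSet code (univ.image (Y e)) t := by
  have hcode : ∀ e, _root_.encodeSet code (univ.image (Y e)) t = _ := fun e =>
    encodeSet_image_fin code (Y e) t
  -- Positions from `N` on are padding; otherwise `t < N < 2 ^ N`, and `t` is a constant of `N`
  -- bits.
  by_cases ht : N ≤ t
  · refine ((Comput.const 0).congr fun e => ?_).mono (by simp [encodeCost])
    rw [_root_.encodeSet, List.getElem?_eq_none]
    · rfl
    · rw [length_sort]
      exact (card_image_le.trans card_image_le).trans (by simpa using ht)
  have hfirst : ∀ i, Comput O v (N * 28 + 5) fun e =>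
      if ¬ ∃ j, j < i ∧ code (Y e j) = code (Y e i) then 1 else 0 := by
    intro i
    have h : ∀ j, Comput O v 14 fun e => if j < i ∧ code (Y e j) = code (Y e i) then 1 else 0 := by
      intro j
      by_cases hj : j < i
      · exact ((hY j).bit_eq (hY i)).congr fun e => by simp [hj]
      · exact ((Comput.const 0).mono (by simp)).congr fun e => by simp [hj]
    exact (Comput.bit_exists h).bit_not.congr fun e => by split_ifs <;> simp_all
  have hrank : ∀ i, Comput O v (N * ((N * 28 + 5) + 4 + N + 1) + 1) fun e =>
      ∑ k, if (¬ ∃ j, j < k ∧ code (Y e j) = code (Y e k)) ∧ code (Y e k) < code (Y e i)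
        then 1 else 0 := by
    intro i
    have h := Comput.sum (O := O) (v := v) N (ι := Fin N)
      (fun k => ((hfirst k).bit_and ((hY k).bit_lt (hY i)))) fun e => ?_
    · simpa using h
    · refine (sum_le_card_nsmul univ _ 1 fun k _ => by split_ifs <;> simp).trans_lt ?_
      simpa using Nat.lt_two_pow_self
  have hterm := fun i => ((hfirst i).bit_and ((hrank i).bit_eq
    (Comput.const_of_lt (c := t) (b := N) ((not_le.1 ht).trans Nat.lt_two_pow_self)))).select (b + 1)
    ((hY i).gate_of_lt .add (b + 1) (Comput.const_of_lt (c := 1) (b := 1) (by norm_num)) fun e => by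
      have := hb (Y e i)
      have h2 : 2 ^ (b + 1) = 2 ^ b + 2 ^ b := by ring
      simp only [GateOp.apply]; omega) (Comput.const_of_lt (c := 0) (b := 0) (by norm_num)) (fun e => by
      have := hb (Y e i)
      have h2 : 2 ^ (b + 1) = 2 ^ b + 2 ^ b := by ring
      simp only [GateOp.apply]; omega) (fun e => by positivity)
  have hsum := Comput.sum (O := O) (v := v) (b + 1) (ι := Fin N) hterm fun e => by
    have := encodeSet_lt hb (univ.image (Y e)) t
    rw [hcode] at this
    exact this
  refine (hsum.congr fun e => (hcode e).symm).mono ?_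
  simp only [Fintype.card_fin, encodeCost]
  exact Nat.add_le_add_right (Nat.mul_le_mul_left _ (by omega)) _

/-! ### Uniform averages -/

section Expect

variable {α β T : Type*}

theorem expect_prod [Fintype α] [Fintype β] (f : α × β → ℝ) :
    𝔼 p, f p = 𝔼 a, 𝔼 b, f (a, b) := by
  rw [← univ_product_univ, expect_product]

/-- Exchanging the values of `w` at the points `σ i` with an independent family is an involution of
the pairs, hence preserves the uniform measure. The next two lemmas rest on similar exchanges. -/
theorem expect_comp_injective [Fintype α] [Nonempty α] {P Q : Type*} [Fintype P] [Fintype Q]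
    [DecidableEq P] [DecidableEq Q]
    {σ : Q → P} (hσ : σ.Injective) (F : (Q → α) → ℝ) :
    𝔼 w : P → α, F (fun i => w (σ i)) = 𝔼 u, F u := by
  have h1 : 𝔼 p : (P → α) × (Q → α), F (fun i => p.1 (σ i)) = 𝔼 p : (P → α) × (Q → α), F p.2 := by
    let φ : (P → α) × (Q → α) → (P → α) × (Q → α) :=
      fun p => (Function.extend σ p.2 p.1, fun i => p.1 (σ i))
    have hφ : Function.Involutive φ := by
      rintro ⟨w, u⟩
      simp only [φ, Prod.mk.injEq]
      constructor
      · funext x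
        by_cases hx : ∃ i, σ i = x
        · obtain ⟨i, rfl⟩ := hx
          rw [hσ.extend_apply]
        · rw [Function.extend_apply' _ _ _ hx, Function.extend_apply' _ _ _ hx]
      · funext i
        exact hσ.extend_apply _ _ _
    exact Fintype.expect_bijective φ hφ.bijective _ _ fun p => rfl
  simpa [expect_prod] using h1

theorem expect_update [Fintype T] [DecidableEq T] [Fintype α] [Nonempty α] (t : T)
    (F : (T → α) → ℝ) : 𝔼 w, 𝔼 y, F (Function.update w t y) = 𝔼 w, F w := by
  have h1 : 𝔼 p : (T → α) × α, F (Function.update p.1 t p.2) = 𝔼 p : (T → α) × α, F p.1 := by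
    let φ : (T → α) × α → (T → α) × α := fun p => (Function.update p.1 t p.2, p.1 t)
    have hφ : Function.Involutive φ := by
      rintro ⟨w, u⟩
      simp [φ]
    exact Fintype.expect_bijective φ hφ.bijective _ _ fun p => rfl
  simpa [expect_prod] using h1

theorem expect_ite [Fintype T] [DecidableEq T] [Fintype α] [Nonempty α] (p : T → Prop)
    [DecidablePred p] (F : (T → α) → ℝ) :
    𝔼 w : T → α, 𝔼 w' : T → α, F (fun x => if p x then w x else w' x) = 𝔼 w, F w := by
  have h1 : 𝔼 z : (T → α) × (T → α), F (fun x => if p x then z.1 x else z.2 x) =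
      𝔼 z : (T → α) × (T → α), F z.1 := by
    let φ : (T → α) × (T → α) → (T → α) × (T → α) := fun z =>
      (fun x => if p x then z.1 x else z.2 x, fun x => if p x then z.2 x else z.1 x)
    have hφ : Function.Involutive φ := by
      rintro ⟨w, u⟩
      simp only [φ, Prod.mk.injEq]
      constructor <;> funext x <;> by_cases hx : p x <;> simp [hx]
    exact Fintype.expect_bijective φ hφ.bijective _ _ fun p => rfl
  simpa [expect_prod] using h1

/-- The joint distribution of a uniform function at some labels depends only on which labels
are equal. -/
theorem expect_labels [Fintype α] [Nonempty α] {Λ P Q : Type*} [Fintype Λ] [Fintype P] [Fintype Q]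
    [DecidableEq P] [DecidableEq Q] (a : Λ → P) (b : Λ → Q)
    (hab : ∀ i j, a i = a j ↔ b i = b j) (F : (Λ → α) → ℝ) :
    𝔼 w : P → α, F (fun i => w (a i)) = 𝔼 w : Q → α, F (fun i => w (b i)) := by
  classical
  -- Both labelings factor through injections of the quotient by equality of labels, so both
  -- averages equal the average over uniform functions on `R`.
  let R := Quotient (Setoid.ker a)
  let a' : R → P := Quotient.lift a fun _ _ h => h
  let b' : R → Q := Quotient.lift b fun i j h => (hab i j).1 h
  have ha : a'.Injective := by
    rintro ⟨i⟩ ⟨j⟩ h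
    exact Quotient.sound (s := Setoid.ker a) h
  have hb : b'.Injective := by
    rintro ⟨i⟩ ⟨j⟩ h
    exact Quotient.sound (s := Setoid.ker a) ((hab i j).2 h)
  have h1 := expect_comp_injective ha fun u : R → α => F fun i => u ⟦i⟧
  have h2 := expect_comp_injective hb fun u : R → α => F fun i => u ⟦i⟧
  exact h1.trans h2.symm

theorem abs_expect_sub_le [Fintype α] [Nonempty α] {f g : α → ℝ} {c : ℝ}
    (h : ∀ a, |f a - g a| ≤ c) : |𝔼 a, f a - 𝔼 a, g a| ≤ c := by
  rw [← expect_sub_distrib]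
  exact (abs_expect_le _ _).trans (expect_le univ_nonempty fun a _ => h a)

theorem abs_expect_sub_le_expect [Fintype α] {f g c : α → ℝ}
    (h : ∀ a, |f a - g a| ≤ c a) : |𝔼 a, f a - 𝔼 a, g a| ≤ 𝔼 a, c a := by
  rw [← expect_sub_distrib]
  exact (abs_expect_le _ _).trans (expect_le_expect fun a _ => h a)

end Expect

/-! ### Lazy sampling of the random oracle -/

/-- Adaptive queries to a function from strings to `G`. -/
inductive QueryTree (l : ℕ) (G : Type)
  | ret (a : ℝ)
  | ask (y : BitVec l) (k : G → QueryTree l G)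

/-- Answers that are known: `A j` is the answer to the query `K j`, for `j < i`. -/
def knownAnswer {l : ℕ} {G : Type} (K : ℕ → BitVec l) (A : ℕ → G) : ℕ → BitVec l → Option G
  | 0, _ => none
  | i + 1, y => if y = K i then some (A i) else knownAnswer K A i y

theorem knownAnswer_congr {l : ℕ} {G : Type} {K K' : ℕ → BitVec l} {A A' : ℕ → G} {i : ℕ}
    (hK : ∀ j < i, K j = K' j) (hA : ∀ j < i, A j = A' j) (y : BitVec l) :
    knownAnswer K A i y = knownAnswer K' A' i y := by
  induction i with
  | zero => rfl
  | succ i ih =>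
    simp only [knownAnswer]
    rw [ih (fun j hj => hK j (by omega)) (fun j hj => hA j (by omega)), hK i (by omega),
      hA i (by omega)]

/-- The function `H`, overridden by the known answers. -/
def override {l : ℕ} {G : Type} (K : ℕ → BitVec l) (A : ℕ → G) (i : ℕ) (H : BitVec l → G) :
    BitVec l → G :=
  fun y => (knownAnswer K A i y).getD (H y)

/-- The first `N` terms of a sequence, continued by `1`. -/
def extendOne {G : Type} {N : ℕ} [One G] (r : Fin N → G) (i : ℕ) : G := if h : i < N then r ⟨i, h⟩ else 1

namespace QueryTree

variable {l : ℕ} {G : Type}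

/-- The result, when a function answers the queries. -/
def run (H : BitVec l → G) : QueryTree l G → ℝ
  | ret a => a
  | ask y k => (k (H y)).run H

/-- The result, when query number `i` is answered from the table of known answers, or else by `r i`. -/
def runLazy (r : ℕ → G) : QueryTree l G → (ℕ → BitVec l) → (ℕ → G) → ℕ → ℝ
  | ret a, _, _, _ => a
  | ask y k, K, A, i => (k ((knownAnswer K A i y).getD (r i))).runLazy r (Function.update K i y)
      (Function.update A i ((knownAnswer K A i y).getD (r i))) (i + 1)

/-- There are at most `d` queries. -/
def DepthLE : QueryTree l G → ℕ → Prop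
  | ret _, _ => True
  | ask _ _, 0 => False
  | ask _ k, d + 1 => ∀ a, (k a).DepthLE d

theorem runLazy_congr {r r' : ℕ → G} (t : QueryTree l G) (K : ℕ → BitVec l) (A : ℕ → G) (i : ℕ)
    (h : ∀ j, i ≤ j → r j = r' j) : t.runLazy r K A i = t.runLazy r' K A i := by
  induction t generalizing K A i with
  | ret a => rfl
  | ask y k ih =>
    simp only [runLazy]
    rw [h i le_rfl]
    exact ih _ _ _ _ fun j hj => h j (by omega)

theorem knownAnswer_update_succ (K : ℕ → BitVec l) (A : ℕ → G) (i : ℕ) (y : BitVec l) (a : G)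
    (z : BitVec l) : knownAnswer (Function.update K i y) (Function.update A i a) (i + 1) z =
      if z = y then some a else knownAnswer K A i z := by
  simp only [knownAnswer, Function.update_self]
  rw [knownAnswer_congr (K' := K) (A' := A)]
  · intro j hj; rw [Function.update_of_ne (by omega)]
  · intro j hj; rw [Function.update_of_ne (by omega)]

/-- Deferred decisions: a query outside the table reads a value of `H` on which nothing has depended
so far, so it may be drawn at that moment. The bound `i + d ≤ N` ensures that the fresh answers do
not run out. -/
theorem expect_runLazy [Fintype G] [Group G] {N : ℕ} (t : QueryTree l G) (d i : ℕ)
    (hd : t.DepthLE d) (hi : i + d ≤ N) (K : ℕ → BitVec l) (A : ℕ → G) :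
    𝔼 r : Fin N → G, t.runLazy (extendOne r) K A i = 𝔼 H, t.run (override K A i H) := by
  classical
  induction t generalizing K A i d with
  | ret a => simp only [runLazy, run, Fintype.expect_const]
  | ask y k ih =>
    obtain _ | d := d
    · exact hd.elim
    simp only [runLazy, run]
    cases hy : knownAnswer K A i y with
    -- A repeated query adds to the table an answer that it already contains, which leaves the
    -- overridden function unchanged.
    | some a =>
      simp only [Option.getD_some]
      rw [ih a d (i + 1) (hd a) (by omega)]
      refine expect_congr rfl fun H _ => ?_
      have h1 : override (Function.update K i y) (Function.update A i a) (i + 1) H =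
          override K A i H := by
        funext z
        simp only [override, knownAnswer_update_succ]
        split_ifs with hz
        · rw [hz, hy]
        · rfl
      rw [h1]
      simp [override, hy]
    | none =>
      simp only [Option.getD_none]
      have hiN : i < N := by omega
      -- For a new query, coordinate `i` of the fresh answers and the value of `H` at `y` are both
      -- resampled and identified.
      rw [← expect_update (⟨i, hiN⟩ : Fin N)]
      have h1 : ∀ (r : Fin N → G) (a : G), extendOne (Function.update r ⟨i, hiN⟩ a) i = a := by
        intro r a; simp [extendOne, hiN]
      have h2 : ∀ (r : Fin N → G) (a : G), ∀ j, i + 1 ≤ j →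
          extendOne (Function.update r ⟨i, hiN⟩ a) j = extendOne r j := by
        intro r a j hj
        simp only [extendOne]
        split_ifs with h
        · rw [Function.update_of_ne]
          simp only [ne_eq, Fin.mk.injEq]; omega
        · rfl
      simp only [h1]
      simp only [runLazy_congr _ _ _ _ (h2 _ _)]
      rw [expect_comm, ← expect_update y, expect_comm (univ : Finset (BitVec l → G))]
      refine expect_congr rfl fun a _ => ?_
      rw [ih a d (i + 1) (hd a) (by omega)]
      refine expect_congr rfl fun H _ => ?_
      have h3 : override (Function.update K i y) (Function.update A i a) (i + 1) H =
          override K A i (Function.update H y a) := by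
        funext z
        simp only [override, knownAnswer_update_succ, Function.update_apply]
        split_ifs with hz
        · rw [hz, hy]; rfl
        · rfl
      rw [h3]
      simp [override, hy]

end QueryTree

/-- The number of oracle queries of a circuit. -/
def Circuit.numQueries : {α β : Type} → Circuit α β → ℕ
  | _, _, .wire _ => 0
  | _, _, .const _ => 0
  | _, _, .gate _ _ => 0
  | _, _, .query => 1
  | _, _, .comp f g => f.numQueries + g.numQueries
  | _, _, .pair f g => f.numQueries + g.numQueries

theorem Circuit.numQueries_le_size {α β : Type} (c : Circuit α β) : c.numQueries ≤ c.size := by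
  induction c <;> simp [numQueries, size] <;> omega

/-- The queries of a circuit, followed by those of the continuation `k`. -/
def Circuit.toTree {l : ℕ} {G : Type} (code : G → ℕ) : {α β : Type} → Circuit α β → (α → ℕ) →
    ((β → ℕ) → QueryTree l G) → QueryTree l G
  | _, _, .wire σ, v, k => k fun i => v (σ i)
  | _, _, .const c, _, k => k fun _ => c
  | _, _, .gate o b, v, k => k fun _ => o.apply (v 0) (v 1) % 2 ^ b
  | _, _, .query, v, k => .ask (BitVec.ofNat l (v ())) fun y => k fun _ => code y
  | _, _, .comp f g, v, k => f.toTree code v fun w => g.toTree code w k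
  | _, _, .pair f g, v, k => f.toTree code v fun w => g.toTree code v fun z => k (Sum.elim w z)

theorem Circuit.run_toTree {l : ℕ} {G : Type} (code : G → ℕ) (H : BitVec l → G) {α β : Type}
    (c : Circuit α β) (v : α → ℕ) (k : (β → ℕ) → QueryTree l G) :
    (c.toTree code v k).run H = (k (c.eval (hashOracle code H) v)).run H := by
  induction c <;> simp_all [toTree, eval, QueryTree.run, hashOracle]

theorem Circuit.depthLE_toTree {l : ℕ} {G : Type} (code : G → ℕ) {α β : Type}
    (c : Circuit α β) (v : α → ℕ) (k : (β → ℕ) → QueryTree l G) (d : ℕ)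
    (hk : ∀ w, (k w).DepthLE d) : (c.toTree code v k).DepthLE (c.numQueries + d) := by
  induction c generalizing d with
  | wire σ => simpa [toTree, numQueries] using hk _
  | const c => simpa [toTree, numQueries] using hk _
  | gate o b => simpa [toTree, numQueries] using hk _
  | query =>
    rw [numQueries, add_comm]
    exact fun a => hk _
  | comp f g ihf ihg =>
    simp only [numQueries, toTree, add_assoc]
    exact ihf _ _ _ fun w => ihg _ _ _ hk
  | pair f g ihf ihg =>
    simp only [numQueries, toTree, add_assoc]
    exact ihf _ _ _ fun w => ihg _ _ _ fun z => hk _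

/-- Wires that carry a table of known answers and fresh answers. -/
def tableWires {l : ℕ} {G : Type} (code : G → ℕ) (K : ℕ → BitVec l) (A r : ℕ → G) :
    ℕ ⊕ ℕ ⊕ ℕ → ℕ :=
  Sum.elim (fun j => (K j).toNat) (Sum.elim (fun j => code (A j)) fun j => code (r j))

/-- The cost of answering one query from a table with at most `P` entries. -/
def lookupCost (b l P : ℕ) : ℕ := 2 * (P * (2 * l + 3 * b + 24)) + 2 * l + 10

theorem comput_knownAnswer {E : Type*} {α : Type} {O : E → ℕ → ℕ} {v : E → α → ℕ} {s b l : ℕ}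
    {G : Type} {code : G → ℕ} (hb : ∀ y, code y < 2 ^ b) {K : E → ℕ → BitVec l} {A : E → ℕ → G}
    {r : E → G} {y : E → BitVec l} (hK : ∀ j, Comput O v 0 fun e => (K e j).toNat)
    (hA : ∀ j, Comput O v 0 fun e => code (A e j)) (hr : Comput O v 0 fun e => code (r e))
    (hy : Comput O v s fun e => (y e).toNat) (i : ℕ) :
    Comput O v (i * (s + 3 * b + 21)) fun e =>
      code ((knownAnswer (K e) (A e) i (y e)).getD (r e)) := by
  induction i with
  | zero => exact (hr.mono (by omega)).congr fun e => by simp [knownAnswer]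
  | succ i ih =>
    refine (((hy.bit_eq (hK i)).select b (hA i) ih (fun e => hb _) fun e => hb _).congr
      fun e => ?_).mono (by ring_nf; omega)
    simp only [knownAnswer, BitVec.toNat_inj]
    split_ifs <;> rfl

/-- A circuit can be run without an oracle, by sampling the oracle lazily. -/
theorem Circuit.exists_lazy {b l : ℕ} {G : Type} {code : G → ℕ} (hb : ∀ y, code y < 2 ^ b) (P : ℕ)
    {α β : Type} (c : Circuit α β) (i : ℕ) (hi : i + c.numQueries ≤ P) :
    ∃ d : Circuit (α ⊕ ℕ ⊕ ℕ ⊕ ℕ) (β ⊕ ℕ ⊕ ℕ ⊕ ℕ), d.size ≤ c.size * lookupCost b l P ∧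
      ∀ (r : ℕ → G) (K : ℕ → BitVec l) (A : ℕ → G) (v : α → ℕ), ∃ w K' A',
        d.eval noOracle (Sum.elim v (tableWires code K A r)) =
          Sum.elim w (tableWires code K' A' r) ∧
        ∀ k : (β → ℕ) → QueryTree l G, (c.toTree code v k).runLazy r K A i =
          (k w).runLazy r K' A' (i + c.numQueries) := by
  have hQ : 1 ≤ lookupCost b l P := by simp [lookupCost]
  -- The number of queries made before a gate is fixed by the shape of the circuit. The table
  -- position `i` is therefore known during the construction, and storing an entry is mere rewiring.
  induction c generalizing i with
  | @wire α β σ =>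
    refine ⟨.wire (Sum.map σ id), by simp [size], fun r K A v => ⟨_, K, A, ?_, fun k => rfl⟩⟩
    funext z
    rcases z with z | z <;> simp [eval]
  | @const α c =>
    refine ⟨.comp (.pair (.const c) (.wire Sum.inr)) (.wire id), ?_,
      fun r K A v => ⟨fun _ => c, K, A, ?_, fun k => rfl⟩⟩
    · simp only [size]
      nlinarith
    · funext z
      rcases z with z | z <;> simp [eval]
  | gate o b' =>
    refine ⟨.comp (.pair (.comp (.wire Sum.inl) (.gate o b')) (.wire Sum.inr)) (.wire id), ?_,
      fun r K A v => ⟨fun _ => o.apply (v 0) (v 1) % 2 ^ b', K, A, ?_, fun k => rfl⟩⟩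
    · simp only [size]
      nlinarith
    · funext z
      rcases z with z | z <;> simp [eval]
  | query =>
    simp only [numQueries] at hi
    let E := (ℕ → G) × (ℕ → BitVec l) × (ℕ → G) × (Unit → ℕ)
    let V : E → Unit ⊕ ℕ ⊕ ℕ ⊕ ℕ → ℕ := fun e =>
      Sum.elim e.2.2.2 (tableWires code e.2.1 e.2.2.1 e.1)
    let O : E → ℕ → ℕ := fun _ => noOracle
    have hy : Comput O V (2 * l + 3) fun e => (BitVec.ofNat l (e.2.2.2 ())).toNat := by
      refine (((Comput.wire (Sum.inl ())).gate .mod l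
        (Comput.const_of_lt (c := 2 ^ l) (b := l + 1) (Nat.pow_lt_pow_right (by omega)
          (by omega)))).congr fun e => ?_).mono (by omega)
      simp [GateOp.apply, V]
    have ha := comput_knownAnswer (O := O) (v := V) hb (K := fun e => e.2.1) (A := fun e => e.2.2.1)
      (r := fun e => e.1 i) (fun j => Comput.wire (Sum.inr (Sum.inl j)))
      (fun j => Comput.wire (Sum.inr (Sum.inr (Sum.inl j))))
      (Comput.wire (Sum.inr (Sum.inr (Sum.inr i)))) hy i
    have hid : ComputVec O V 0 V := ⟨.wire id, by simp [size], fun e => rfl⟩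
    -- The query and its answer become entry `i` of the table; all other wires pass through
    -- unchanged.
    have hall := (((Comput.vec (w := fun e (_ : Unit) => (BitVec.ofNat l (e.2.2.2 ())).toNat) hy).pair
      (Comput.vec (w := fun e (_ : Unit) => code ((knownAnswer e.2.1 e.2.2.1 i
        (BitVec.ofNat l (e.2.2.2 ()))).getD (e.1 i))) ha)).pair hid).rewire
      (Sum.elim (fun _ : Unit => Sum.inl (Sum.inr ())) (Sum.elim
        (fun j => if j = i then Sum.inl (Sum.inl ()) else Sum.inr (Sum.inr (Sum.inl j)))
        (Sum.elim
          (fun j => if j = i then Sum.inl (Sum.inr ()) else Sum.inr (Sum.inr (Sum.inr (Sum.inl j))))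
          fun j => Sum.inr (Sum.inr (Sum.inr (Sum.inr j))))))
    obtain ⟨d, hd, hd'⟩ := hall
    refine ⟨d, hd.trans ?_, fun r K A v => ⟨fun _ => code ((knownAnswer K A i
      (BitVec.ofNat l (v ()))).getD (r i)), Function.update K i (BitVec.ofNat l (v ())),
      Function.update A i ((knownAnswer K A i (BitVec.ofNat l (v ()))).getD (r i)), ?_,
      fun k => rfl⟩⟩
    · simp only [size, lookupCost]
      have : i * (2 * l + 3 + 3 * b + 21) ≤ P * (2 * l + 3 * b + 24) :=
        Nat.mul_le_mul (by omega) (by omega)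
      omega
    · refine (hd' (r, K, A, v)).trans (funext fun z => ?_)
      rcases z with z | j | j | j
      · rfl
      · simp only [Sum.elim_inr, Sum.elim_inl, tableWires, V]
        split_ifs with hj
        · simp [hj]
        · simp [hj]
      · simp only [Sum.elim_inr, Sum.elim_inl, tableWires, V]
        split_ifs with hj
        · simp [hj]
        · simp [hj]
      · rfl
  | @comp α β γ f g ihf ihg =>
    simp only [numQueries] at hi
    obtain ⟨d, hd, hd'⟩ := ihf i (by omega)
    obtain ⟨d₂, hd₂, hd₂'⟩ := ihg (i + f.numQueries) (by omega)
    refine ⟨.comp d d₂, ?_, fun r K A v => ?_⟩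
    · simp only [size, add_mul]
      omega
    · obtain ⟨w, K', A', h1, h2⟩ := hd' r K A v
      obtain ⟨w₂, K₂, A₂, h3, h4⟩ := hd₂' r K' A' w
      refine ⟨w₂, K₂, A₂, ?_, fun k => ?_⟩
      · simp only [eval, h1, h3]
      · simp only [toTree, h2, h4, numQueries, add_assoc]
  | @pair α β γ f g ihf ihg =>
    simp only [numQueries] at hi
    obtain ⟨d, hd, hd'⟩ := ihf i (by omega)
    obtain ⟨d₂, hd₂, hd₂'⟩ := ihg (i + f.numQueries) (by omega)
    -- The second circuit needs the original input together with the table as the first one leaves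
    -- it, so the input is carried along beside `d`.
    refine ⟨.comp (.comp (.pair d (.wire Sum.inl))
      (.pair (.wire (Sum.elim (fun z => Sum.inl (Sum.inl z)) id ∘ fun z : β => Sum.inl z))
        (.comp (.wire (Sum.elim (fun z : α => Sum.inr z) fun z => Sum.inl (Sum.inr z))) d₂)))
      (.wire (Sum.elim (Sum.elim (fun z => Sum.inl z) fun z => Sum.inr (Sum.inl z))
        fun z => Sum.inr (Sum.inr z))), ?_, fun r K A v => ?_⟩
    · simp only [size, add_mul]
      omega
    · obtain ⟨w, K', A', h1, h2⟩ := hd' r K A v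
      obtain ⟨w₂, K₂, A₂, h3, h4⟩ := hd₂' r K' A' v
      refine ⟨Sum.elim w w₂, K₂, A₂, ?_, fun k => ?_⟩
      · have h5 : (fun z => Sum.elim (Sum.elim w (tableWires code K' A' r)) v
            (Sum.elim (fun z : α => Sum.inr z) (fun z => Sum.inl (Sum.inr z)) z)) =
            Sum.elim v (tableWires code K' A' r) := by
          funext z
          rcases z with z | z <;> rfl
        have h6 : (fun i => Sum.elim v (tableWires code K A r) (Sum.inl i)) = v := rfl
        simp only [eval, h1, h6, h5, h3]
        funext z
        rcases z with (z | z) | z <;> rfl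
      · simp only [toTree, h2, h4, numQueries, add_assoc]

/-- The indicator of acceptance. -/
def accepts (y : ℕ) : ℝ := if y = 1 then 1 else 0

/-- The size of an oracle-free version of a circuit of size `s`. -/
def lazyCost (b l M s : ℕ) : ℕ := 3 * ((M + s + 1) * (l + b + 1)) + s * lookupCost b l (M + s)

/-- The lazy simulation starts with a table of the points `xs`, whose hash values arrive on wires,
and with the fresh answers `r` hard-wired. Averaging over `r` costs nothing against non-uniform
circuits, as a bound for every fixed `r` bounds the average. -/
theorem Circuit.exists_oracleFree {b l : ℕ} {G : Type} [Fintype G] [Group G]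
    {code : G → ℕ} (hb : ∀ y, code y < 2 ^ b) {M : ℕ} (xs : Fin M → BitVec l) {α : Type}
    (D : Circuit α Unit) :
    ∃ D' : (Fin (M + D.size) → G) → Circuit (α ⊕ Fin M) Unit,
      (∀ r, (D' r).size ≤ lazyCost b l M D.size) ∧ ∀ (v : α → ℕ) (H₀ : BitVec l → G),
        𝔼 H : BitVec l → G, accepts (D.eval (hashOracle code fun y =>
          if ∃ j, xs j = y then H₀ y else H y) v ()) =
        𝔼 r, accepts ((D' r).eval noOracle (Sum.elim v fun j => code (H₀ (xs j))) ()) := by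
  set P := M + D.size with hP
  have hPM : M + D.numQueries ≤ P := by have := D.numQueries_le_size; omega
  obtain ⟨d, hd, hd'⟩ := Circuit.exists_lazy (l := l) hb P D M hPM
  let K : ℕ → BitVec l := fun j => if h : j < M then xs ⟨j, h⟩ else 0
  let A : (Fin M → G) → ℕ → G := fun h => extendOne h
  have hinit : ∀ r : Fin P → G, ComputVec (E := (α → ℕ) × (Fin M → G)) (fun _ => noOracle)
      (fun e => Sum.elim e.1 fun j => code (e.2 j)) (3 * ((P + 1) * (l + b + 1)))
      fun e => Sum.elim e.1 (tableWires code K (A e.2) (extendOne r)) := by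
    intro r
    have hid : ComputVec (E := (α → ℕ) × (Fin M → G)) (fun _ => noOracle)
      (fun e => Sum.elim e.1 fun j => code (e.2 j)) 0 fun e => e.1 :=
        ⟨.wire Sum.inl, by simp [size], fun e => rfl⟩
    have hK : ComputVec (E := (α → ℕ) × (Fin M → G)) (fun _ => noOracle)
        (fun e => Sum.elim e.1 fun j => code (e.2 j)) ((P + 1) * (l + b + 1))
        fun e (j : Fin (P + 1)) => (K j).toNat :=
      ComputVec.pi_fin fun j => (Comput.const_of_lt (K j).isLt).mono (by omega)
    have hA : ComputVec (E := (α → ℕ) × (Fin M → G)) (fun _ => noOracle)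
        (fun e => Sum.elim e.1 fun j => code (e.2 j)) ((P + 1) * (l + b + 1))
        fun e (j : Fin (P + 1)) => code (A e.2 j) := by
      refine ComputVec.pi_fin fun j => ?_
      by_cases hj : (j : ℕ) < M
      · exact ((Comput.wire (Sum.inr ⟨j, hj⟩)).mono (by omega)).congr fun e => by
          simp [A, extendOne, hj]
      · exact ((Comput.const_of_lt (hb 1)).mono (by omega)).congr fun e => by
          simp [A, extendOne, hj]
    have hr : ComputVec (E := (α → ℕ) × (Fin M → G)) (fun _ => noOracle)
        (fun e => Sum.elim e.1 fun j => code (e.2 j)) ((P + 1) * (l + b + 1))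
        fun e (j : Fin (P + 1)) => code (extendOne r (j : ℕ)) :=
      ComputVec.pi_fin fun j => (Comput.const_of_lt (hb _)).mono (by omega)
    -- All three sequences are constant from index `P` on, so entry `P` can feed the infinitely many
    -- remaining wires.
    let cut : ℕ → Fin (P + 1) := fun j => ⟨min j P, by omega⟩
    have hcut : ∀ j < P, (cut j : ℕ) = j := fun j hj => min_eq_left hj.le
    have hall := (hid.pair (hK.pair (hA.pair hr))).rewire
      (Sum.map id (Sum.map cut (Sum.map cut cut)))
    obtain ⟨c, hc, hc'⟩ := hall
    refine ⟨c, by omega, fun e => (hc' e).trans (funext fun z => ?_)⟩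
    rcases z with z | j | j | j
    · rfl
    · change (K (cut j)).toNat = (K j).toNat
      by_cases hj : j < P
      · rw [hcut j hj]
      · have h1 : K j = 0 := dif_neg (by omega)
        have h2 : K (cut j) = 0 := dif_neg (by simp only [cut]; omega)
        rw [h1, h2]
    · change code (A e.2 (cut j)) = code (A e.2 j)
      by_cases hj : j < P
      · rw [hcut j hj]
      · have h1 : A e.2 j = 1 := dif_neg (by omega)
        have h2 : A e.2 (cut j) = 1 := dif_neg (by simp only [cut]; omega)
        rw [h1, h2]
    · change code (extendOne r (cut j)) = code (extendOne r j)
      by_cases hj : j < P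
      · rw [hcut j hj]
      · have h1 : extendOne r j = 1 := dif_neg (by omega)
        have h2 : extendOne r (cut j) = 1 := dif_neg (by simp only [cut]; omega)
        rw [h1, h2]
  choose c hc hc' using hinit
  refine ⟨fun r => .comp (c r) (.comp d (.wire Sum.inl)), fun r => ?_, fun v H₀ => ?_⟩
  · simp only [size, lazyCost, ← hP]
    have := hc r
    omega
  · let t := D.toTree (l := l) (G := G) code v fun w => .ret (accepts (w ()))
    have h1 := QueryTree.expect_runLazy (N := P) t D.numQueries M
      (D.depthLE_toTree code v _ 0 fun w => by simp [QueryTree.DepthLE]) hPM K (A fun j => H₀ (xs j))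
    -- Repetitions among the points `xs` are harmless, because all stored answers are values of the
    -- one function `H₀`.
    have h2 : ∀ i ≤ M, ∀ y, knownAnswer K (A fun j => H₀ (xs j)) i y =
        if ∃ j : Fin M, j < i ∧ xs j = y then some (H₀ y) else none := by
      intro i hi y
      induction i with
      | zero => simp [knownAnswer]
      | succ i ih =>
        simp only [knownAnswer]
        by_cases hy : y = K i
        · have hKi : K i = xs ⟨i, hi⟩ := dif_pos hi
          rw [if_pos hy, if_pos ⟨⟨i, hi⟩, by simp, by rw [hy, hKi]⟩, hy, hKi]
          have : A (fun j => H₀ (xs j)) i = H₀ (xs ⟨i, hi⟩) :=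
            dif_pos (c := i < M) (Nat.lt_of_succ_le hi)
          rw [this]
        · rw [if_neg hy, ih (by omega)]
          refine if_congr ⟨?_, ?_⟩ rfl rfl
          · rintro ⟨j, hj, rfl⟩
            exact ⟨j, by omega, rfl⟩
          · rintro ⟨j, hj, rfl⟩
            refine ⟨j, lt_of_le_of_ne (by omega) fun h => hy ?_, rfl⟩
            have : K i = xs ⟨i, hi⟩ := dif_pos hi
            rw [this]
            congr 1
            exact Fin.ext h
    have h3 : ∀ H, override K (A fun j => H₀ (xs j)) M H =
        fun y => if ∃ j, xs j = y then H₀ y else H y := by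
      intro H
      funext y
      simp only [override, h2 M le_rfl, Fin.is_lt, true_and]
      split_ifs <;> rfl
    simp only [h3, t, run_toTree, QueryTree.run] at h1
    refine h1.symm.trans (expect_congr rfl fun r _ => ?_)
    obtain ⟨w, K', A', h4, h5⟩ := hd' (extendOne r) K (A fun j => H₀ (xs j)) v
    rw [h5]
    simp only [QueryTree.runLazy, eval]
    have h6 := hc' r (v, fun j => H₀ (xs j))
    simp only at h6
    rw [h6, h4]
    rfl

/-! ### Powers of the generator -/

theorem pow_val_mul {G : Type*} [Group G] [Fintype G] {q : ℕ} (hq : Fintype.card G = q)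
    (y : G) (a b : ZMod q) : y ^ (a * b).val = (y ^ a.val) ^ b.val := by
  have h := pow_mod_card y (a.val * b.val)
  rw [hq] at h
  rw [ZMod.val_mul, ← pow_mul, h]

namespace GroupFamily

variable {𝔾 : GroupFamily} {κ : ℕ}

/-- The group element with a given logarithm. -/
def expo (𝔾 : GroupFamily) (κ : ℕ) (a : ZMod (𝔾.q κ)) : 𝔾.Carrier κ := 𝔾.gen κ ^ a.val

theorem expo_mul (a b : ZMod (𝔾.q κ)) : 𝔾.expo κ (a * b) = 𝔾.expo κ a ^ b.val :=
  pow_val_mul rfl _ _ _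

theorem expo_bijective : Function.Bijective (𝔾.expo κ) := by
  refine (Fintype.bijective_iff_surjective_and_card _).2 ⟨fun y => ?_, ZMod.card _⟩
  obtain ⟨n, hn⟩ := (mem_powers_iff_mem_zpowers (x := 𝔾.gen κ)).2 (𝔾.generates κ y)
  refine ⟨n, ?_⟩
  simp only at hn
  rw [expo, ZMod.val_natCast, ← hn]
  exact pow_mod_card _ _

theorem q_le : 𝔾.q κ ≤ 2 ^ 𝔾.len κ := by
  have h := Fintype.card_le_of_injective
    (fun y => (⟨𝔾.code κ y, 𝔾.code_lt κ y⟩ : Fin (2 ^ 𝔾.len κ)))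
    fun y z h => 𝔾.code_injective κ (Fin.mk.inj h)
  rwa [Fintype.card_fin] at h

theorem val_lt (a : ZMod (𝔾.q κ)) : a.val < 2 ^ 𝔾.len κ := (ZMod.val_lt a).trans_le q_le

theorem exists_codedMul (𝔾 : GroupFamily) : ∃ μ : ℕ → ℕ, PolyBounded μ ∧
    ∀ κ, CodedMul (𝔾.code κ) (𝔾.len κ) (μ κ) := by
  obtain ⟨c, hc, hmul⟩ := 𝔾.mul_efficient
  refine ⟨_, hc, fun κ => ⟨𝔾.code_lt κ, (c κ).deoracle, (c κ).size_deoracle.le, fun O y z => ?_⟩⟩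
  rw [Circuit.eval_deoracle, hmul]

end GroupFamily

/-! ### The advantage against the decisional Diffie-Hellman assumption -/

theorem Ensemble.accept_eq_expect {ι : ℕ → Type} (E : Ensemble ι) (κ : ℕ)
    (D : Circuit (ι κ) Unit) :
    E.accept κ D = 𝔼 ω, accepts (D.eval (E.oracle κ ω) (E.data κ ω) ()) := by
  rw [Fintype.expect_eq_sum_div_card, accept]
  simp [accepts, sum_boole]

theorem accepts_nonneg (y : ℕ) : 0 ≤ accepts y := by
  rw [accepts]; split_ifs <;> simp

theorem accepts_le_one (y : ℕ) : accepts y ≤ 1 := by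
  rw [accepts]; split_ifs <;> simp

theorem abs_accepts_sub_le_one (y z : ℕ) : |accepts y - accepts z| ≤ 1 := by
  rw [accepts, accepts]; split_ifs <;> simp

theorem Ensemble.accept_mem {ι : ℕ → Type} (E : Ensemble ι) (κ : ℕ) (D : Circuit (ι κ) Unit) :
    0 ≤ E.accept κ D ∧ E.accept κ D ≤ 1 := by
  rw [accept]
  refine ⟨by positivity, div_le_one_of_le₀ ?_ (by positivity)⟩
  exact_mod_cast card_le_univ _

/-- The best advantage of circuits of size at most `s` against DDH. -/
noncomputable def ddhAdv (𝔾 : GroupFamily) (κ s : ℕ) : ℝ :=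
  sSup {x | ∃ D : Circuit (Fin 3) Unit, D.size ≤ s ∧
    x = |(ddhReal 𝔾).accept κ D - (ddhRandom 𝔾).accept κ D|}

theorem le_ddhAdv (𝔾 : GroupFamily) (κ : ℕ) {s : ℕ} (D : Circuit (Fin 3) Unit) (hD : D.size ≤ s) :
    |(ddhReal 𝔾).accept κ D - (ddhRandom 𝔾).accept κ D| ≤ ddhAdv 𝔾 κ s := by
  refine le_csSup ⟨1, ?_⟩ ⟨D, hD, rfl⟩
  rintro x ⟨D, -, rfl⟩
  have h1 := (ddhReal 𝔾).accept_mem κ D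
  have h2 := (ddhRandom 𝔾).accept_mem κ D
  rw [abs_le]
  constructor <;> linarith [h1.1, h1.2, h2.1, h2.2]

theorem ddhAdv_nonneg (𝔾 : GroupFamily) (κ s : ℕ) : 0 ≤ ddhAdv 𝔾 κ s :=
  Real.sSup_nonneg fun _ ⟨_, _, hx⟩ => hx ▸ abs_nonneg _

theorem PolyBounded.of_le {f g : ℕ → ℕ} (hg : PolyBounded g) (h : ∀ κ, f κ ≤ g κ) :
    PolyBounded f :=
  hg.imp fun _ hp κ => (h κ).trans (hp κ)

/-- At each security parameter some circuit attains at least half of the supremum; these circuits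
form one non-uniform family to which DDH applies. -/
theorem negligible_ddhAdv {𝔾 : GroupFamily} (h : DDH 𝔾) {s : ℕ → ℕ} (hs : PolyBounded s) :
    Negligible fun κ => ddhAdv 𝔾 κ (s κ) := by
  have hD : ∀ κ, ∃ D : Circuit (Fin 3) Unit, D.size ≤ s κ ∧
      ddhAdv 𝔾 κ (s κ) ≤ 2 * |(ddhReal 𝔾).accept κ D - (ddhRandom 𝔾).accept κ D| := by
    intro κ
    rcases (ddhAdv_nonneg 𝔾 κ (s κ)).eq_or_lt with h0 | h0
    · exact ⟨.wire fun _ => 0, by simp [Circuit.size], by rw [← h0]; positivity⟩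
    · obtain ⟨x, ⟨D, hD, rfl⟩, hx⟩ := exists_lt_of_lt_csSup
        (s := {x | ∃ D : Circuit (Fin 3) Unit, D.size ≤ s κ ∧
          x = |(ddhReal 𝔾).accept κ D - (ddhRandom 𝔾).accept κ D|})
        ⟨_, .wire fun _ => 0, by simp [Circuit.size], rfl⟩ (half_lt_self h0)
      have hx' : ddhAdv 𝔾 κ (s κ) / 2 < _ := hx
      exact ⟨D, hD, by linarith⟩
  choose D hsize hle using hD
  have h2 := h D (hs.of_le hsize)
  refine (h2.const_mul 2).trans_abs_le fun κ => ?_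
  rw [abs_of_nonneg (ddhAdv_nonneg _ _ _)]
  exact (hle κ).trans (le_abs_self _)

theorem abs_expect_ddh_le (𝔾 : GroupFamily) (κ : ℕ) {s : ℕ} (D : Circuit (Fin 3) Unit)
    (hD : D.size ≤ s) :
    |𝔼 a, 𝔼 b, accepts (D.eval noOracle (fun i => 𝔾.code κ (𝔾.expo κ (![a, b, a * b] i))) ()) -
      𝔼 a, 𝔼 b, 𝔼 c, accepts (D.eval noOracle (fun i => 𝔾.code κ (𝔾.expo κ (![a, b, c] i))) ())| ≤
      ddhAdv 𝔾 κ s := by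
  have h := le_ddhAdv 𝔾 κ D hD
  have hreal : ∀ a b c : ZMod (𝔾.q κ), (fun i => 𝔾.code κ (𝔾.expo κ (![a, b, c] i))) =
      ![𝔾.code κ (𝔾.gen κ ^ a.val), 𝔾.code κ (𝔾.gen κ ^ b.val), 𝔾.code κ (𝔾.gen κ ^ c.val)] := by
    intro a b c
    ext i
    fin_cases i <;> rfl
  simp only [hreal]
  have h1 : (ddhReal 𝔾).accept κ D = 𝔼 p : ZMod (𝔾.q κ) × ZMod (𝔾.q κ), accepts (D.eval noOracle
      ![𝔾.code κ (𝔾.gen κ ^ p.1.val), 𝔾.code κ (𝔾.gen κ ^ p.2.val),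
        𝔾.code κ (𝔾.gen κ ^ (p.1 * p.2).val)] ()) := Ensemble.accept_eq_expect _ _ _
  have h2 : (ddhRandom 𝔾).accept κ D = 𝔼 p : ZMod (𝔾.q κ) × ZMod (𝔾.q κ) × ZMod (𝔾.q κ),
      accepts (D.eval noOracle ![𝔾.code κ (𝔾.gen κ ^ p.1.val), 𝔾.code κ (𝔾.gen κ ^ p.2.1.val),
        𝔾.code κ (𝔾.gen κ ^ p.2.2.val)] ()) := Ensemble.accept_eq_expect _ _ _
  rw [h1, h2, expect_prod, expect_prod] at h
  simpa only [expect_prod] using h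

/-! ### Pseudorandomness of monomials in the exponent -/

/-- The size of a circuit that raises group elements to `N` constants and runs a circuit of size `s`
on the results. -/
def reductionCost (b μ N s : ℕ) : ℕ := N * (b + 1 + powCost b μ b) + s

section Hybrids

variable {𝔾 : GroupFamily} {κ μ : ℕ}

/-- Each input of `D` is a component of the DDH triple raised to a hard-wired exponent, or a
hard-wired element where `src` is `none`. -/
theorem exists_reduction (hμ : CodedMul (𝔾.code κ) (𝔾.len κ) μ) {Λ : Type} [Fintype Λ]
    (D : Circuit Λ Unit) (src : Λ → Option (Fin 3)) (e : Λ → ZMod (𝔾.q κ)) :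
    ∃ D' : Circuit (Fin 3) Unit, D'.size ≤ reductionCost (𝔾.len κ) μ (Fintype.card Λ) D.size ∧
      ∀ z : Fin 3 → ZMod (𝔾.q κ), D'.eval noOracle (fun i => 𝔾.code κ (𝔾.expo κ (z i))) () =
        D.eval noOracle (fun i => 𝔾.code κ (𝔾.expo κ ((src i).elim 1 z * e i))) () := by
  have h : ComputVec (E := Fin 3 → ZMod (𝔾.q κ)) (fun _ => noOracle)
      (fun z i => 𝔾.code κ (𝔾.expo κ (z i)))
      (Fintype.card Λ * (𝔾.len κ + 1 + powCost (𝔾.len κ) μ (𝔾.len κ)))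
      (fun z i => 𝔾.code κ (𝔾.expo κ ((src i).elim 1 z * e i))) := by
    refine ComputVec.pi fun i => ?_
    cases src i with
    | none => exact (Comput.const_of_lt (𝔾.code_lt κ (𝔾.expo κ (1 * e i)))).mono (by omega)
    | some j =>
      refine ((Comput.codedPow hμ (fun _ => 𝔾.val_lt (e i)) (Comput.wire j)
        (Comput.const_of_lt (𝔾.val_lt (e i)))).congr fun z => ?_).mono (by omega)
      rw [Option.elim_some, 𝔾.expo_mul]
  have h2 := h.comput (f := fun z =>
    D.eval noOracle (fun i => 𝔾.code κ (𝔾.expo κ ((src i).elim 1 z * e i))) ())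
    ⟨D, le_rfl, fun z => rfl⟩
  exact h2

/-- A hybrid argument over the tags that occur: at each step the product `w t₀ * k` of one tag is
replaced by the fresh `w' t₀`, at the price of one DDH advantage. -/
theorem one_key_pseudorandom (hμ : CodedMul (𝔾.code κ) (𝔾.len κ) μ) {T Λ : Type} [Fintype T]
    [DecidableEq T] [Fintype Λ] (D : Circuit Λ Unit) (t : Λ → T) (p : Λ → Prop) [DecidablePred p]
    (c : Λ → ZMod (𝔾.q κ)) :
    |𝔼 w : T → ZMod (𝔾.q κ), 𝔼 k : ZMod (𝔾.q κ), accepts (D.eval noOracle (fun i =>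
        𝔾.code κ (𝔾.expo κ ((if p i then w (t i) * k else w (t i)) * c i))) ()) -
      𝔼 w : T → ZMod (𝔾.q κ), 𝔼 w' : T → ZMod (𝔾.q κ), accepts (D.eval noOracle (fun i =>
        𝔾.code κ (𝔾.expo κ ((if p i then w' (t i) else w (t i)) * c i))) ())| ≤
      Fintype.card Λ * ddhAdv 𝔾 κ (reductionCost (𝔾.len κ) μ (Fintype.card Λ) D.size) := by
  set ε := ddhAdv 𝔾 κ (reductionCost (𝔾.len κ) μ (Fintype.card Λ) D.size) with hε
  -- `A` is the set of tags whose products have already been replaced.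
  let f : Finset T → (T → ZMod (𝔾.q κ)) → (T → ZMod (𝔾.q κ)) → ZMod (𝔾.q κ) → ℝ := fun A w w' k =>
    accepts (D.eval noOracle (fun i => 𝔾.code κ (𝔾.expo κ ((if p i then
      (if t i ∈ A then w' (t i) else w (t i) * k) else w (t i)) * c i))) ())
  let h : Finset T → ℝ := fun A => 𝔼 w, 𝔼 w', 𝔼 k, f A w w' k
  -- The values `w t₀` and `w' t₀` get averages of their own, in order to play the second and third
  -- exponents of the DDH triple.
  have hresample : ∀ A t₀, h A = 𝔼 w, 𝔼 w', 𝔼 k, 𝔼 b, 𝔼 c,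
      f A (Function.update w t₀ b) (Function.update w' t₀ c) k := by
    intro A t₀
    simp only [h]
    rw [← expect_update t₀]
    refine expect_congr rfl fun w _ => ?_
    have h1 : ∀ b, 𝔼 w', 𝔼 k, f A (Function.update w t₀ b) w' k =
        𝔼 w', 𝔼 k, 𝔼 c, f A (Function.update w t₀ b) (Function.update w' t₀ c) k := by
      intro b
      rw [← expect_update t₀]
      exact expect_congr rfl fun w' _ => expect_comm _ _ _
    simp only [h1]
    rw [expect_comm]
    exact expect_congr rfl fun w' _ => expect_comm _ _ _
  have hstep : ∀ A t₀, t₀ ∉ A → |h A - h (insert t₀ A)| ≤ ε := by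
    intro A t₀ ht₀
    rw [hresample A t₀, hresample (insert t₀ A) t₀]
    refine abs_expect_sub_le fun w => abs_expect_sub_le fun w' => ?_
    -- The triple is `g ^ k`, `g ^ b`, and `g ^ (k * b)` or `g ^ c`. Tag `t₀` takes the last two
    -- components; the other tags still multiplied by `k` use the first, raised to the known `w (t
    -- i)`; everything else is known.
    obtain ⟨D', hD', hD''⟩ := exists_reduction hμ D
      (fun i => if t i = t₀ then (if p i then some 2 else some 1) else
        if p i ∧ t i ∉ A then some 0 else none)
      (fun i => if t i = t₀ then c i else if p i then (if t i ∈ A then w' (t i) * c i else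
        w (t i) * c i) else w (t i) * c i)
    refine le_of_eq_of_le ?_ (abs_expect_ddh_le 𝔾 κ D' hD')
    congr 2
    · refine expect_congr rfl fun k _ => expect_congr rfl fun b _ => ?_
      rw [← Fintype.expect_const (ι := ZMod (𝔾.q κ)) (accepts _)]
      refine expect_congr rfl fun c₀ _ => ?_
      rw [hD'']
      simp only [f]
      congr 3
      funext i
      congr 2
      by_cases hi : t i = t₀
      · by_cases hp : p i
        · simp [hi, hp, ht₀, mul_comm]
        · simp [hi, hp]
      · by_cases hp : p i
        · by_cases hA : t i ∈ A
          · simp [hi, hp, hA]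
          · simp [hi, hp, hA, mul_comm, mul_left_comm]
        · simp [hi, hp]
    · refine expect_congr rfl fun k _ => expect_congr rfl fun b _ => expect_congr rfl fun c₀ _ => ?_
      rw [hD'']
      simp only [f]
      congr 3
      funext i
      congr 2
      by_cases hi : t i = t₀
      · by_cases hp : p i
        · simp [hi, hp]
        · simp [hi, hp]
      · by_cases hp : p i
        · by_cases hA : t i ∈ A
          · simp [hi, hp, hA]
          · simp [hi, hp, hA, mul_comm, mul_left_comm]
        · simp [hi, hp]
  have hall : ∀ A, |h ∅ - h A| ≤ #A * ε := by
    intro A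
    induction A using Finset.induction_on with
    | empty => simp
    | insert t₀ A ht₀ ih =>
      rw [card_insert_of_notMem ht₀]
      push_cast
      calc |h ∅ - h (insert t₀ A)| ≤ |h ∅ - h A| + |h A - h (insert t₀ A)| := abs_sub_le _ _ _
        _ ≤ (#A + 1) * ε := by linarith [hstep A t₀ ht₀]
  have h1 := hall (univ.image t)
  have h2 : (#(univ.image t) : ℝ) * ε ≤ Fintype.card Λ * ε := by
    gcongr
    · exact ddhAdv_nonneg _ _ _
    · exact card_image_le
  refine le_of_eq_of_le ?_ (h1.trans h2)
  congr 2
  · refine expect_congr rfl fun w _ => ?_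
    simp only [f, notMem_empty, if_false, Fintype.expect_const]
  · refine expect_congr rfl fun w _ => expect_congr rfl fun w' _ => ?_
    simp only [f, mem_image, mem_univ, true_and, exists_apply_eq_apply, if_true,
      Fintype.expect_const]

/-- Distinct labels read distinct places of the two families, so together these act as one uniform
family. This absorbs the variable `v` into the label once its key has been eliminated. -/
theorem expect_merge {B V α : Type} [Fintype B] [Fintype V] [DecidableEq B] [DecidableEq V]
    [Fintype α] [Nonempty α] (v : V) (F : (B × Finset V → α) → ℝ) :
    𝔼 w : B × Finset V → α, 𝔼 w' : B × Finset V → α,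
      F (fun x => if v ∈ x.2 then w' (x.1, x.2.erase v) else w x) = 𝔼 w, F w := by
  let σ : B × Finset V → (B × Finset V) ⊕ (B × Finset V) := fun x =>
    if v ∈ x.2 then Sum.inr (x.1, x.2.erase v) else Sum.inl x
  have hσ : σ.Injective := by
    rintro ⟨b, S⟩ ⟨b', S'⟩ h
    simp only [σ] at h
    split_ifs at h with h1 h2 h2
    · simp only [Sum.inr.injEq, Prod.mk.injEq] at h
      rw [h.1, ← insert_erase h1, h.2, insert_erase h2]
    · simpa using h
  rw [← expect_comp_injective hσ F]
  refine (expect_prod fun z : (B × Finset V → α) × (B × Finset V → α) =>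
    F (fun x => if v ∈ x.2 then z.2 (x.1, x.2.erase v) else z.1 x)).symm.trans ?_
  refine (Fintype.expect_equiv (Equiv.sumArrowEquivProdArrow _ _ _) _ _ fun u => ?_).symm
  congr 1
  funext x
  simp only [σ]
  split_ifs <;> rfl

/-- Powers of the generator whose exponents are monomials, each with one factor `w b`, are
pseudorandom. -/
theorem monomials_pseudorandom (hμ : CodedMul (𝔾.code κ) (𝔾.len κ) μ) {B V Λ : Type} [Fintype B]
    [DecidableEq B] [Fintype V] [DecidableEq V] [Fintype Λ] (D : Circuit Λ Unit) (β : Λ → B)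
    (S : Λ → Finset V) :
    |𝔼 w : B → ZMod (𝔾.q κ), 𝔼 k : V → ZMod (𝔾.q κ), accepts (D.eval noOracle (fun i =>
        𝔾.code κ (𝔾.expo κ (w (β i) * ∏ v ∈ S i, k v))) ()) -
      𝔼 w : B × Finset V → ZMod (𝔾.q κ), accepts (D.eval noOracle (fun i =>
        𝔾.code κ (𝔾.expo κ (w (β i, S i)))) ())| ≤
      Fintype.card V * (Fintype.card Λ *
        ddhAdv 𝔾 κ (reductionCost (𝔾.len κ) μ (Fintype.card Λ) D.size)) := by
  set ε := Fintype.card Λ * ddhAdv 𝔾 κ (reductionCost (𝔾.len κ) μ (Fintype.card Λ) D.size) with hε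
  -- The variables in `E` have moved from the product into the label of the base.
  let f : Finset V → (B × Finset V → ZMod (𝔾.q κ)) → (V → ZMod (𝔾.q κ)) → ℝ := fun E w k =>
    accepts (D.eval noOracle (fun i =>
      𝔾.code κ (𝔾.expo κ (w (β i, S i ∩ E) * ∏ v ∈ S i \ E, k v))) ())
  let h : Finset V → ℝ := fun E => 𝔼 w, 𝔼 k, f E w k
  have hstep : ∀ E v, v ∉ E → |h E - h (insert v E)| ≤ ε := by
    intro E v hv
    simp only [h]
    rw [expect_comm, ← expect_update v, expect_comm (f := fun w k => f (insert v E) w k)]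
    -- All keys other than that of `v` are now fixed and enter the reduction as known exponents.
    refine abs_expect_sub_le fun k => ?_
    rw [expect_comm]
    refine le_of_eq_of_le ?_ (one_key_pseudorandom hμ D (fun i => (β i, S i ∩ E))
      (fun i => v ∈ S i) fun i => ∏ u ∈ S i \ insert v E, k u)
    congr 2
    · refine expect_congr rfl fun w _ => expect_congr rfl fun y _ => ?_
      simp only [f]
      congr 3
      funext i
      congr 2
      by_cases hi : v ∈ S i
      · have h1 : S i \ E = insert v (S i \ insert v E) := by
          ext u
          by_cases hu : u = v
          · simp [hu, hi, hv]
          · simp [hu]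
        rw [if_pos hi, h1, prod_insert (by simp), Function.update_self, mul_assoc]
        congr 2
        refine prod_congr rfl fun u hu => ?_
        rw [Function.update_of_ne]
        rintro rfl
        simp at hu
      · have h1 : S i \ E = S i \ insert v E := by
          ext u
          by_cases hu : u = v
          · simp [hu, hi]
          · simp [hu]
        rw [if_neg hi, h1]
        congr 1
        refine prod_congr rfl fun u hu => ?_
        rw [Function.update_of_ne]
        rintro rfl
        simp at hu
    · rw [← expect_merge v]
      refine expect_congr rfl fun w _ => expect_congr rfl fun w' _ => ?_
      simp only [f]
      congr 3
      funext i
      congr 3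
      by_cases hi : v ∈ S i
      · have h1 : (S i ∩ insert v E).erase v = S i ∩ E := by
          ext u
          by_cases hu : u = v
          · simp [hu, hv]
          · simp [hu]
        simp only [mem_inter, hi, mem_insert_self, and_self, if_true, h1]
      · have h1 : S i ∩ insert v E = S i ∩ E := by
          ext u
          by_cases hu : u = v
          · simp [hu, hi]
          · simp [hu]
        simp only [mem_inter, hi, false_and, if_false, h1]
  have hall : ∀ E, |h ∅ - h E| ≤ #E * ε := by
    intro E
    induction E using Finset.induction_on with
    | empty => simp
    | insert v E hv ih =>
      rw [card_insert_of_notMem hv]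
      push_cast
      calc |h ∅ - h (insert v E)| ≤ |h ∅ - h E| + |h E - h (insert v E)| := abs_sub_le _ _ _
        _ ≤ (#E + 1) * ε := by linarith [hstep E v hv]
  refine le_of_eq_of_le ?_ (hall univ)
  congr 2
  -- For `E = ∅` only the labels `(b, ∅)` are read.
  · have hinj : Function.Injective fun b : B => (b, (∅ : Finset V)) := fun b b' h => by simpa using h
    rw [← expect_comp_injective hinj]
    refine expect_congr rfl fun w _ => expect_congr rfl fun k _ => ?_
    simp only [f, inter_empty, sdiff_empty]
  · refine expect_congr rfl fun w _ => ?_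
    simp only [f, inter_univ, sdiff_eq_empty_iff_subset.2 (subset_univ _), prod_empty, mul_one,
      Fintype.expect_const]

end Hybrids

/-! ### Most exponents are invertible -/

theorem expect_dvd_val {q p : ℕ} [NeZero q] (hp : 0 < p) (hpq : p ∣ q) :
    𝔼 a : ZMod q, (if p ∣ a.val then 1 else 0 : ℝ) = 1 / p := by
  obtain ⟨r, rfl⟩ := hpq
  have hr : 0 < r := Nat.pos_of_mul_pos_left (NeZero.pos (p * r))
  have hcard : #{a : ZMod (p * r) | p ∣ a.val} = r := by
    have himg : ({a : ZMod (p * r) | p ∣ a.val} : Finset _).image ZMod.val =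
        (range r).image fun i => p * i := by
      ext x
      simp only [mem_image, mem_filter, mem_univ, true_and, mem_range]
      constructor
      · rintro ⟨a, ⟨i, hi⟩, rfl⟩
        refine ⟨i, ?_, hi.symm⟩
        have := ZMod.val_lt a
        rw [hi] at this
        exact lt_of_mul_lt_mul_left this (Nat.zero_le _)
      · rintro ⟨i, hi, rfl⟩
        have hval : ((p * i : ℕ) : ZMod (p * r)).val = p * i :=
          ZMod.val_cast_of_lt (Nat.mul_lt_mul_of_pos_left hi hp)
        exact ⟨_, by rw [hval]; exact dvd_mul_right _ _, hval⟩
    rw [← card_image_of_injective _ (ZMod.val_injective (p * r)), himg, card_image_of_injective,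
      card_range]
    exact fun i j h => Nat.eq_of_mul_eq_mul_left hp h
  rw [Fintype.expect_eq_sum_div_card, sum_boole, hcard, ZMod.card]
  push_cast
  field_simp

/-- The size of a circuit that tests the divisibility of exponents. -/
def testCost (b μ : ℕ) : ℕ := 2 * (2 * b + 16 + powCost b μ b) + 2

section Units

variable {𝔾 : GroupFamily} {κ μ : ℕ}

/-- This makes divisibility of a hidden exponent by `p` testable with one exponentiation. -/
theorem GroupFamily.expo_pow_eq_one_iff {p r : ℕ} (hr : 0 < r) (hq : 𝔾.q κ = p * r)
    (a : ZMod (𝔾.q κ)) : 𝔾.expo κ a ^ r = 1 ↔ p ∣ a.val := by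
  have hord : orderOf (𝔾.gen κ) = 𝔾.q κ := by
    rw [orderOf_eq_card_of_forall_mem_zpowers (𝔾.generates κ), Nat.card_eq_fintype_card]; rfl
  rw [expo, ← pow_mul, ← orderOf_dvd_iff_pow_eq_one, hord]
  generalize a.val = k
  rw [hq, Nat.mul_dvd_mul_iff_right hr]

/-- Test whether `p` divides the first and the third exponent. In a DDH triple the first
divisibility implies the second, so the probability is `1 / p`; for independent exponents it is `1 /
p ^ 2`. As `p ≥ 2`, the gap is at least half of `1 / p`. -/
theorem one_div_prime_le (hμ : CodedMul (𝔾.code κ) (𝔾.len κ) μ) {p : ℕ} (hp : p.Prime)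
    (hpq : p ∣ 𝔾.q κ) : (1 / p : ℝ) ≤ 2 * ddhAdv 𝔾 κ (testCost (𝔾.len κ) μ) := by
  obtain ⟨r, hr⟩ := id hpq
  have hrpos : 0 < r := Nat.pos_of_ne_zero fun h => NeZero.ne (𝔾.q κ) (by rw [hr, h, mul_zero])
  have hrlt : r < 2 ^ 𝔾.len κ := lt_of_lt_of_le (by
    rw [hr]; exact (lt_mul_iff_one_lt_left hrpos).2 hp.one_lt) 𝔾.q_le
  have htest : ∀ i : Fin 3, Comput (E := Fin 3 → ZMod (𝔾.q κ)) (fun _ => noOracle)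
      (fun z i => 𝔾.code κ (𝔾.expo κ (z i))) (2 * 𝔾.len κ + 16 + powCost (𝔾.len κ) μ (𝔾.len κ))
      fun z => if p ∣ (z i).val then 1 else 0 := by
    intro i
    refine (((Comput.codedPow hμ (fun _ => hrlt) (Comput.wire i)
      (Comput.const_of_lt hrlt)).bit_eq (Comput.const_of_lt (𝔾.code_lt κ 1))).congr
      fun z => ?_).mono (by omega)
    exact if_congr ((𝔾.code_injective κ).eq_iff.trans (𝔾.expo_pow_eq_one_iff hrpos hr _)) rfl rfl
  obtain ⟨D, hD, hD'⟩ := (htest 0).bit_and (htest 2)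
  have h := abs_expect_ddh_le 𝔾 κ (s := testCost (𝔾.len κ) μ) D (hD.trans (by
    rw [testCost]; omega))
  have hacc : ∀ z : Fin 3 → ZMod (𝔾.q κ),
      accepts (D.eval noOracle (fun i => 𝔾.code κ (𝔾.expo κ (z i))) ()) =
        (if p ∣ (z 0).val then 1 else 0) * (if p ∣ (z 2).val then 1 else 0) := by
    intro z
    rw [show D.eval noOracle (fun i => 𝔾.code κ (𝔾.expo κ (z i))) () = _ from hD' z, accepts]
    split_ifs <;> simp_all
  simp only [hacc] at h
  change |(𝔼 a : ZMod (𝔾.q κ), 𝔼 b : ZMod (𝔾.q κ), (if p ∣ a.val then 1 else 0 : ℝ) *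
    if p ∣ (a * b).val then 1 else 0) - 𝔼 a : ZMod (𝔾.q κ), 𝔼 _b : ZMod (𝔾.q κ),
    𝔼 c : ZMod (𝔾.q κ), (if p ∣ a.val then 1 else 0 : ℝ) * if p ∣ c.val then 1 else 0| ≤ _ at h
  have hreal : ∀ a b : ZMod (𝔾.q κ), ((if p ∣ a.val then 1 else 0 : ℝ) *
      if p ∣ (a * b).val then 1 else 0) = if p ∣ a.val then 1 else 0 := by
    intro a b
    by_cases ha : p ∣ a.val
    · have : p ∣ (a * b).val := by
        rw [ZMod.val_mul, Nat.dvd_mod_iff hpq]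
        exact ha.mul_right _
      simp [ha, this]
    · simp [ha]
  simp only [hreal, Fintype.expect_const, ← mul_expect, ← expect_mul,
    expect_dvd_val hp.pos hpq] at h
  have hp2 : (2 : ℝ) ≤ p := by exact_mod_cast hp.two_le
  have h2 : (1 / p : ℝ) ≤ 2 * (1 / p - 1 / p * (1 / p)) := by
    have : (1 / p : ℝ) ≤ 1 / 2 := one_div_le_one_div_of_le (by norm_num) hp2
    have h0 : (0 : ℝ) < 1 / p := by positivity
    nlinarith
  exact h2.trans (by linarith [le_abs_self ((1 / p : ℝ) - 1 / p * (1 / p))])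

theorem card_primeFactors_le {q b : ℕ} (hq : q ≠ 0) (hb : q ≤ 2 ^ b) : #q.primeFactors ≤ b := by
  have h1 : 2 ^ #q.primeFactors ≤ ∏ p ∈ q.primeFactors, p :=
    pow_card_le_prod _ _ _ fun p hp => (Nat.prime_of_mem_primeFactors hp).two_le
  have h2 := Nat.le_of_dvd (Nat.pos_of_ne_zero hq) (Nat.prod_primeFactors_dvd q)
  exact (Nat.pow_le_pow_iff_right (by norm_num)).1 (h1.trans (h2.trans hb))

-- A union bound over the prime divisors of `q`, of which there are at most `𝔾.len κ`.
open Classical in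
theorem expect_not_isUnit_le (hμ : CodedMul (𝔾.code κ) (𝔾.len κ) μ) :
    𝔼 a : ZMod (𝔾.q κ), (if IsUnit a then 0 else 1 : ℝ) ≤
      𝔾.len κ * (2 * ddhAdv 𝔾 κ (testCost (𝔾.len κ) μ)) := by
  have hε := ddhAdv_nonneg 𝔾 κ (testCost (𝔾.len κ) μ)
  calc 𝔼 a : ZMod (𝔾.q κ), (if IsUnit a then 0 else 1 : ℝ)
      ≤ 𝔼 a : ZMod (𝔾.q κ), ∑ p ∈ (𝔾.q κ).primeFactors, (if p ∣ a.val then 1 else 0 : ℝ) := by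
        refine expect_le_expect fun a _ => ?_
        by_cases ha : IsUnit a
        · rw [if_pos ha]
          exact sum_nonneg fun p _ => by split_ifs <;> simp
        · rw [if_neg ha]
          rw [← ZMod.natCast_zmod_val a, ZMod.isUnit_iff_coprime, Nat.Prime.not_coprime_iff_dvd] at ha
          obtain ⟨p, hp, hpa, hpq⟩ := ha
          refine le_trans ?_ (single_le_sum (f := fun p => (if p ∣ a.val then 1 else 0 : ℝ))
            (fun p _ => by split_ifs <;> simp)
            (Nat.mem_primeFactors.2 ⟨hp, hpq, NeZero.ne _⟩))
          simp [hpa]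
    _ = ∑ p ∈ (𝔾.q κ).primeFactors, (1 / p : ℝ) := by
        rw [expect_sum_comm]
        exact sum_congr rfl fun p hp => expect_dvd_val (Nat.pos_of_mem_primeFactors hp)
          (Nat.dvd_of_mem_primeFactors hp)
    _ ≤ #(𝔾.q κ).primeFactors • (2 * ddhAdv 𝔾 κ (testCost (𝔾.len κ) μ)) :=
        sum_le_card_nsmul _ _ _ fun p hp => one_div_prime_le hμ (Nat.prime_of_mem_primeFactors hp)
          (Nat.dvd_of_mem_primeFactors hp)
    _ ≤ 𝔾.len κ * (2 * ddhAdv 𝔾 κ (testCost (𝔾.len κ) μ)) := by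
        rw [nsmul_eq_mul]
        gcongr
        exact card_primeFactors_le (NeZero.ne _) 𝔾.q_le

end Units

/-! ### The messages of the protocol -/

section Ring

variable {m n l q : ℕ}

/-- The `r` parties that follow party `p` on the ring. -/
def pathSet (p : Fin m) (r : ℕ) : Finset (Fin m) := (range r).image fun s => ahead p (s + 1)

theorem ahead_injOn (p : Fin m) {r : ℕ} (hr : r ≤ m) :
    Set.InjOn (fun s => ahead p (s + 1)) (range r : Finset ℕ) := by
  intro s hs t ht h
  simp only [coe_range, Set.mem_Iio] at hs ht
  have h1 : (p.val + (s + 1)) % m = (p.val + (t + 1)) % m := Fin.mk.inj h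
  have h2 : s + 1 ≡ t + 1 [MOD m] := Nat.ModEq.add_left_cancel' p.val h1
  have h3 : s ≡ t [MOD m] := Nat.ModEq.add_right_cancel' 1 h2
  exact h3.eq_of_lt_of_lt (by omega) (by omega)

theorem prod_ahead {M : Type*} [CommMonoid M] (p : Fin m) {r : ℕ} (hr : r ≤ m) (f : Fin m → M) :
    ∏ s ∈ range r, f (ahead p (s + 1)) = ∏ i ∈ pathSet p r, f i := by
  rw [pathSet, prod_image (ahead_injOn p hr)]

theorem pathSet_self (p : Fin m) : pathSet p m = univ := by
  rw [← card_eq_iff_eq_univ, pathSet, card_image_of_injOn (ahead_injOn p le_rfl), card_range,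
    Fintype.card_fin]

/-- The parties still to come on the way round the ring, of which the last is `p` itself, are those
off the path. The backward computation of the simulator inverts exactly their keys. -/
theorem prod_Ico_ahead {M : Type*} [CommMonoid M] (p : Fin m) (r : ℕ) (f : Fin m → M) :
    ∏ s ∈ range (m - r), f (ahead p (r + s + 1)) = ∏ i ∈ (pathSet p r)ᶜ, f i := by
  have hIco : ∏ s ∈ range (m - r), f (ahead p (r + s + 1)) =
      ∏ s ∈ Ico r m, f (ahead p (s + 1)) :=
    (prod_Ico_eq_prod_range (fun s => f (ahead p (s + 1))) r m).symm
  have hcompl : (pathSet p r)ᶜ = (Ico r m).image fun s => ahead p (s + 1) := by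
    ext i
    simp only [mem_compl, pathSet, mem_image, mem_range, mem_Ico]
    have hi : i ∈ pathSet p m := by rw [pathSet_self]; exact mem_univ _
    simp only [pathSet, mem_image, mem_range] at hi
    obtain ⟨s, hs, rfl⟩ := hi
    constructor
    · intro h
      exact ⟨s, ⟨by by_contra hsr; exact h ⟨s, by omega, rfl⟩, hs⟩, rfl⟩
    · rintro ⟨t, ⟨htr, htm⟩, ht⟩ ⟨t', ht', h⟩
      have h1 := ahead_injOn p le_rfl (by simpa using htm)
        (by simpa using (by omega : t' < m)) (ht.trans h.symm)
      omega
  rw [hIco, hcompl, prod_image]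
  exact (ahead_injOn p le_rfl).mono fun s hs => by
    simp only [coe_Ico, Set.mem_Ico] at hs
    simpa using hs.2

variable {G : Type} [Group G] [Fintype G]

theorem ringMsg_eq (hq : Fintype.card G = q) (H : BitVec l → G) (x : Fin m → Fin n → BitVec l) (ω : Fin m → Tape q)
    (p : Fin m) (r : ℕ) (j : Fin n) : ringMsg H x ω p r j =
      H (x p j) ^ ((ω p).1 * ∏ s ∈ range r, (ω (ahead p (s + 1))).2).val := by
  induction r with
  | zero => simp [ringMsg]
  | succ r ih => rw [ringMsg, ih, prod_range_succ, ← mul_assoc,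
      pow_val_mul hq _ _ (ω (ahead p (r + 1))).2]

theorem ownIds_eq (hq : Fintype.card G = q) (H : BitVec l → G) (x : Fin m → Fin n → BitVec l) (ω : Fin m → Tape q)
    (p : Fin m) (j : Fin n) (hp : IsUnit (ω p).1) :
    ownIds H x ω p j = H (x p j) ^ (∏ i, (ω i).2).val := by
  have hm : m - 1 + 1 = m := Nat.sub_add_cancel p.pos
  have hself : ahead p (m - 1 + 1) = p := by
    simp [ahead, hm, Nat.mod_eq_of_lt p.isLt]
  -- The factor applied by `p` itself is step `m` of the walk and completes the product over the
  -- ring.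
  have hprod : ∏ i, (ω i).2 = (∏ s ∈ range (m - 1), (ω (ahead p (s + 1))).2) * (ω p).2 := by
    rw [← pathSet_self p, ← prod_ahead p le_rfl]
    have h0 : range m = range (m - 1 + 1) := by rw [hm]
    rw [h0, prod_range_succ, hself]
  rw [ownIds, ringMsg_eq hq, ← pow_val_mul hq, hprod]
  congr 2
  have h := ZMod.mul_inv_of_unit _ hp
  linear_combination (∏ s ∈ range (m - 1), (ω (ahead p (s + 1))).2) * (ω p).2 * h

end Ring

section Wires

variable {G : Type} [DecidableEq G] {m n l q : ℕ}

/-- The set of all identifiers. -/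
def allIds (ids : Fin m → Fin n → G) : Finset G := univ.biUnion fun p => univ.image (ids p)

/-- The encoded view of a party, in terms of the messages on the ring and the identifiers. -/
def viewWires (code : G → ℕ) (x : Fin m → Fin n → BitVec l) (tape : Fin m → Tape q)
    (msg : Fin m → ℕ → Fin n → G) (ids : Fin m → Fin n → G) (i : Fin m) : ViewWire m n → ℕ
  | .input j => (x i j).toNat
  | .tapeA => (tape i).1.val
  | .tapeK => (tape i).2.val
  | .received r j => code (msg (ahead i (m - 1 - r.val)) r.val j)
  | .mpsuOut t => if i.val = 0 then encodeSet code (allIds ids) t else 0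
  | .leaderMsg t => if i.val = 0 then 0 else encodeSet code (allIds ids) t

/-- The encoded output of a party, in terms of the identifiers. -/
def outputWires (code : G → ℕ) (ids : Fin m → Fin n → G) (i : Fin m) : OutputWire m n → ℕ
  | .all t => encodeSet code (allIds ids) t
  | .own j => code (ids i j)

theorem encode_realView [Group G] (code : G → ℕ) (H : BitVec l → G) (x : Fin m → Fin n → BitVec l)
    (ω : Fin m → Tape q) (i : Fin m) (w : ViewWire m n) :
    (realView H x ω i).encode code w =
      viewWires code x ω (ringMsg H x ω) (ownIds H x ω) i w := by
  cases w with
  | mpsuOut t =>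
    simp only [View.encode, realView, mpsuOut, mpsu, viewWires, allIds]
    split_ifs <;> rfl
  | leaderMsg t =>
    simp only [View.encode, realView, leaderMsg, mpsuOut, mpsu, viewWires, allIds]
    split_ifs <;> rfl
  | _ => rfl

theorem encode_realOutput [Group G] (code : G → ℕ) (H : BitVec l → G) (x : Fin m → Fin n → BitVec l)
    (ω : Fin m → Tape q) (i : Fin m) (w : OutputWire m n) :
    (realOutput H x ω i).encode code w = outputWires code (ownIds H x ω) i w := by
  cases w with
  | all t =>
    simp only [Output.encode, realOutput, leaderMsg, mpsuOut, mpsu, outputWires, allIds]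
    split_ifs <;> rfl
  | own j => rfl

theorem encode_mpid (code : G → ℕ) (x : Fin m → Fin n → BitVec l) (R : BitVec l → G) (i : Fin m)
    (w : OutputWire m n) :
    (mpid x R i).encode code w = outputWires code (fun p j => R (x p j)) i w := by
  cases w with
  | all t =>
    simp only [Output.encode, mpid, outputWires, allIds, biUnion_image]
    congr 1
    ext y
    simp
  | own j => rfl

/-- The wires of a view, as a sum of finite types. -/
def viewWireEquiv (m n : ℕ) :
    ViewWire m n ≃ Fin n ⊕ Fin 2 ⊕ (Fin m × Fin n) ⊕ Fin (m * n) ⊕ Fin (m * n) where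
  toFun
    | .input j => .inl j
    | .tapeA => .inr (.inl 0)
    | .tapeK => .inr (.inl 1)
    | .received r j => .inr (.inr (.inl (r, j)))
    | .mpsuOut t => .inr (.inr (.inr (.inl t)))
    | .leaderMsg t => .inr (.inr (.inr (.inr t)))
  invFun
    | .inl j => .input j
    | .inr (.inl 0) => .tapeA
    | .inr (.inl 1) => .tapeK
    | .inr (.inr (.inl (r, j))) => .received r j
    | .inr (.inr (.inr (.inl t))) => .mpsuOut t
    | .inr (.inr (.inr (.inr t))) => .leaderMsg t
  left_inv w := by cases w <;> rfl
  right_inv w := by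
    rcases w with j | i | ⟨r, j⟩ | t | t
    · rfl
    · fin_cases i <;> rfl
    all_goals rfl

/-- The wires of an output, as a sum of finite types. -/
def outputWireEquiv (m n : ℕ) : OutputWire m n ≃ Fin (m * n) ⊕ Fin n where
  toFun
    | .all t => .inl t
    | .own j => .inr j
  invFun
    | .inl t => .all t
    | .inr j => .own j
  left_inv w := by cases w <;> rfl
  right_inv w := by rcases w with t | j <;> rfl

instance (m n : ℕ) : Fintype (ViewWire m n) := Fintype.ofEquiv _ (viewWireEquiv m n).symm

instance (m n : ℕ) : Fintype (OutputWire m n) := Fintype.ofEquiv _ (outputWireEquiv m n).symm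

theorem card_viewWire (m n : ℕ) : Fintype.card (ViewWire m n) = n + 2 + 3 * (m * n) := by
  rw [Fintype.card_congr (viewWireEquiv m n)]
  simp
  ring

theorem card_outputWire (m n : ℕ) : Fintype.card (OutputWire m n) = m * n + n := by
  rw [Fintype.card_congr (outputWireEquiv m n)]
  simp

end Wires

/-! ### The simulator -/

section Simulator

variable {𝔾 : GroupFamily} {κ μ m n l : ℕ}

/-- The simulated messages: the lists of honest parties start with random elements, and the lists of
corrupted parties, once they have passed all honest parties, are computed backwards from the
identifiers. Until then the simulator runs the protocol with keys of its own. -/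
def simMsg (𝔾 : GroupFamily) (κ : ℕ) (C : Finset (Fin m)) (H : BitVec l → 𝔾.Carrier κ)
    (x : Fin m → Fin n → BitVec l) (tape : Fin m → Tape (𝔾.q κ)) (u : Fin m → Fin n → ZMod (𝔾.q κ))
    (ids : Fin m → Fin n → 𝔾.Carrier κ) (p : Fin m) (r : ℕ) (j : Fin n) : 𝔾.Carrier κ :=
  if p ∈ C then
    if Cᶜ ⊆ pathSet p r then
      ids p j ^ ((tape p).1 * ∏ s ∈ range (m - r), totientInv (tape (ahead p (r + s + 1))).2).val
    else H (x p j) ^ ((tape p).1 * ∏ s ∈ range r, (tape (ahead p (s + 1))).2).val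
  else 𝔾.gen κ ^ (u p j * ∏ s ∈ range r, (tape (ahead p (s + 1))).2).val

/-- The coins of the simulator: keys of all parties, and exponents for the lists. -/
abbrev SimCoin (m n : ℕ) : Type := (Fin m ⊕ Fin m) ⊕ (Fin m × Fin n)

/-- The keys of the parties that are given by the coins of the simulator. -/
def coinTape {Z : Type} (z : SimCoin m n → Z) (i : Fin m) : Z × Z :=
  (z (.inl (.inl i)), z (.inl (.inr i)))

/-- A bound for the size of the circuit that computes one wire of the simulated view. -/
def simWireCost (b μ m : ℕ) : ℕ :=
  (b + 1) + ((b + 1 + m * (b + 1 + powCost b (4 * b + 5) b + (4 * b + 5))) + (4 * b + 5)) +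
    powCost b μ b + 1

/-- A bound for the size of the simulator. -/
def simCost (b μ m n : ℕ) : ℕ :=
  m + m + m * n + m * (n + 2 + 3 * (m * n)) * simWireCost b μ m

theorem comput_power (hμ : CodedMul (𝔾.code κ) (𝔾.len κ) μ) {E : Type*} {α : Type}
    {O : E → ℕ → ℕ} {v : E → α → ℕ} {s t N : ℕ} {y : E → 𝔾.Carrier κ} {a : E → ZMod (𝔾.q κ)}
    {F : ℕ → E → ZMod (𝔾.q κ)} (hy : Comput O v s fun e => 𝔾.code κ (y e))
    (ha : Comput O v 0 fun e => (a e).val) (hF : ∀ i < N, Comput O v t fun e => (F i e).val) :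
    Comput O v (s + ((𝔾.len κ + 1 + N * (t + (4 * 𝔾.len κ + 5))) + (4 * 𝔾.len κ + 5)) +
      powCost (𝔾.len κ) μ (𝔾.len κ))
      fun e => 𝔾.code κ (y e ^ (a e * ∏ i ∈ range N, F i e).val) := by
  have hZ := ZMod.codedMul (𝔾.q κ) (𝔾.len κ) 𝔾.q_le
  exact (Comput.codedPow hμ (fun e => 𝔾.val_lt _) hy
    (ha.codedMul hZ (Comput.codedProd hZ hF))).mono (by omega)

theorem exists_simulator (hμ : CodedMul (𝔾.code κ) (𝔾.len κ) μ) (C : Finset (Fin m)) :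
    ∃ c : Circuit ((C × Fin n) ⊕ (C × OutputWire m n) ⊕ (Fin (Fintype.card (SimCoin m n)) ⊕
        Fin (Fintype.card (SimCoin m n)))) (C × ViewWire m n),
      c.size ≤ m * (n + 2 + 3 * (m * n)) * simWireCost (𝔾.len κ) μ m ∧
      ∀ {l : ℕ} (H : BitVec l → 𝔾.Carrier κ) (x : Fin m → Fin n → BitVec l)
        (ids : Fin m → Fin n → 𝔾.Carrier κ) (bits : Fin (Fintype.card (SimCoin m n)) → ℕ)
        (z : Fin (Fintype.card (SimCoin m n)) → ZMod (𝔾.q κ)),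
        c.eval (hashOracle (𝔾.code κ) H) (Sum.elim (fun w => (x w.1 w.2).toNat)
          (Sum.elim (fun w => outputWires (𝔾.code κ) ids w.1 w.2)
            (Sum.elim bits fun s => (z s).val))) =
        fun w => viewWires (𝔾.code κ) x (coinTape fun s => z (Fintype.equivFin _ s))
          (simMsg 𝔾 κ C H x (coinTape fun s => z (Fintype.equivFin _ s))
            (fun p j => z (Fintype.equivFin _ (.inr (p, j)))) ids) ids w.1 w.2 := by
  -- The situation contains everything on which the circuit must not depend, including `l`.
  let E := Σ l : ℕ, (BitVec l → 𝔾.Carrier κ) × (Fin m → Fin n → BitVec l) ×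
    (Fin m → Fin n → 𝔾.Carrier κ) × (Fin (Fintype.card (SimCoin m n)) → ℕ) ×
    (Fin (Fintype.card (SimCoin m n)) → ZMod (𝔾.q κ))
  let O : E → ℕ → ℕ := fun e => hashOracle (𝔾.code κ) e.2.1
  let V : E → (C × Fin n) ⊕ (C × OutputWire m n) ⊕ (Fin (Fintype.card (SimCoin m n)) ⊕
      Fin (Fintype.card (SimCoin m n))) → ℕ := fun e =>
    Sum.elim (fun w => (e.2.2.1 w.1 w.2).toNat)
      (Sum.elim (fun w => outputWires (𝔾.code κ) e.2.2.2.1 w.1 w.2)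
        (Sum.elim e.2.2.2.2.1 fun s => (e.2.2.2.2.2 s).val))
  let tape : E → Fin m → Tape (𝔾.q κ) := fun e =>
    coinTape fun s => e.2.2.2.2.2 (Fintype.equivFin _ s)
  let msg : E → Fin m → ℕ → Fin n → 𝔾.Carrier κ := fun e =>
    simMsg 𝔾 κ C e.2.1 e.2.2.1 (tape e)
      (fun p j => e.2.2.2.2.2 (Fintype.equivFin _ (.inr (p, j)))) e.2.2.2.1
  have hA : ∀ i, Comput O V 0 fun e => (tape e i).1.val := fun i =>
    Comput.wire (O := O) (v := V) (.inr (.inr (.inr (Fintype.equivFin _ (.inl (.inl i))))))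
  have hK : ∀ i, Comput O V 0 fun e => (tape e i).2.val := fun i =>
    Comput.wire (O := O) (v := V) (.inr (.inr (.inr (Fintype.equivFin _ (.inl (.inr i))))))
  have hU : ∀ p j, Comput O V 0 fun e =>
      (e.2.2.2.2.2 (Fintype.equivFin (SimCoin m n) (.inr (p, j)))).val := fun p j =>
    Comput.wire (O := O) (v := V) (.inr (.inr (.inr (Fintype.equivFin _ (.inr (p, j))))))
  have hinv := fun i => Comput.totientInv 𝔾.q_le (hK i)
  have hmsg : ∀ p r j, r < m → Comput O V (simWireCost (𝔾.len κ) μ m)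
      fun e => 𝔾.code κ (msg e p r j) := by
    intro p r j hr
    -- The branch of `simMsg` depends only on `C`, `p` and `r`, so it is chosen during the
    -- construction and not by a gate.
    by_cases hp : p ∈ C
    · by_cases hC : Cᶜ ⊆ pathSet p r
      · have hid : Comput O V 0 fun e => 𝔾.code κ (e.2.2.2.1 p j) :=
          Comput.wire (O := O) (v := V) (.inr (.inl (⟨p, hp⟩, .own j)))
        refine ((comput_power hμ (N := m - r) hid (hA p) fun s _ =>
          hinv (ahead p (r + s + 1))).congr fun e => ?_).mono ?_
        · simp only [msg, simMsg, if_pos hp, if_pos hC]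
        · have := Nat.mul_le_mul_right (0 + (𝔾.len κ + 1) +
            powCost (𝔾.len κ) (4 * 𝔾.len κ + 5) (𝔾.len κ) + (4 * 𝔾.len κ + 5)) (Nat.sub_le m r)
          simp only [simWireCost, zero_add] at this ⊢
          omega
      · have hx : Comput O V 1 fun e => 𝔾.code κ (e.2.1 (e.2.2.1 p j)) := by
          refine ((Comput.wire (O := O) (v := V) (.inl (⟨p, hp⟩, j))).query).congr fun e => ?_
          simp [O, V, hashOracle]
        refine ((comput_power hμ (N := r) hx (hA p) fun s _ =>
          hK (ahead p (s + 1))).congr fun e => ?_).mono ?_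
        · simp only [msg, simMsg, if_pos hp, if_neg hC]
        · have := Nat.mul_le_mul hr.le (le_add_self : 4 * 𝔾.len κ + 5 ≤ 𝔾.len κ + 1 +
            powCost (𝔾.len κ) (4 * 𝔾.len κ + 5) (𝔾.len κ) + (4 * 𝔾.len κ + 5))
          simp only [simWireCost, zero_add] at this ⊢
          omega
    · refine ((comput_power hμ (N := r) (y := fun _ => 𝔾.gen κ)
        (Comput.const_of_lt (𝔾.code_lt κ (𝔾.gen κ))) (hU p j) fun s _ =>
        hK (ahead p (s + 1))).congr fun e => ?_).mono ?_
      · simp only [msg, simMsg, if_neg hp]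
      · have := Nat.mul_le_mul hr.le (le_add_self : 4 * 𝔾.len κ + 5 ≤ 𝔾.len κ + 1 +
          powCost (𝔾.len κ) (4 * 𝔾.len κ + 5) (𝔾.len κ) + (4 * 𝔾.len κ + 5))
        simp only [simWireCost, zero_add] at this ⊢
        omega
  have hwire : ∀ w : C × ViewWire m n, Comput O V (simWireCost (𝔾.len κ) μ m) fun e =>
      viewWires (𝔾.code κ) e.2.2.1 (tape e) (msg e) e.2.2.2.1 w.1 w.2 := by
    rintro ⟨i, w⟩
    cases w with
    | input j => exact (Comput.wire (O := O) (v := V) (.inl (i, j))).mono (Nat.zero_le _)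
    | tapeA => exact (hA i).mono (Nat.zero_le _)
    | tapeK => exact (hK i).mono (Nat.zero_le _)
    | received r j => exact hmsg _ _ _ r.isLt
    | mpsuOut t =>
      by_cases hi : i.1.val = 0
      · exact ((Comput.wire (O := O) (v := V) (.inr (.inl (i, .all t)))).mono
          (Nat.zero_le _)).congr fun e => by simp [viewWires, hi, V, outputWires]
      · exact ((Comput.const 0).mono (by simp [simWireCost])).congr fun e => by
          simp [viewWires, hi]
    | leaderMsg t =>
      by_cases hi : i.1.val = 0
      · exact ((Comput.const 0).mono (by simp [simWireCost])).congr fun e => by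
          simp [viewWires, hi]
      · exact ((Comput.wire (O := O) (v := V) (.inr (.inl (i, .all t)))).mono
          (Nat.zero_le _)).congr fun e => by simp [viewWires, hi, V, outputWires]
  obtain ⟨c, hc, hc'⟩ := ComputVec.pi hwire
  refine ⟨c, hc.trans ?_, fun {l} H x ids bits z => hc' ⟨l, H, x, ids, bits, z⟩⟩
  rw [Fintype.card_prod, card_viewWire, Fintype.card_coe]
  gcongr
  exact card_finset_fin_le C

end Simulator

/-! ### Both executions as functions of group elements with monomial exponents -/

section Slots

variable {𝔾 : GroupFamily} {κ μ m n l : ℕ}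

/-- The data shown to the distinguisher, in terms of messages and identifiers. -/
def execWires {G : Type} [DecidableEq G] {q : ℕ} (code : G → ℕ) (C : Finset (Fin m))
    (x : Fin m → Fin n → BitVec l) (tape : Fin m → Tape q)
    (msg : Fin m → ℕ → Fin n → G) (ids : Fin m → Fin n → G) :
    (C × ViewWire m n) ⊕ (Fin m × OutputWire m n) → ℕ :=
  Sum.elim (fun w => viewWires code x tape msg ids w.1 w.2) fun w => outputWires code ids w.1 w.2

theorem execWires_congr {G : Type} [DecidableEq G] {q : ℕ} (code : G → ℕ) (C : Finset (Fin m))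
    (x : Fin m → Fin n → BitVec l) {tape tape' : Fin m → Tape q}
    {msg msg' : Fin m → ℕ → Fin n → G} {ids ids' : Fin m → Fin n → G}
    (htape : ∀ i ∈ C, tape i = tape' i) (hmsg : ∀ p, ∀ r < m, ∀ j, msg p r j = msg' p r j)
    (hids : ∀ p j, ids p j = ids' p j) :
    execWires code C x tape msg ids = execWires code C x tape' msg' ids' := by
  obtain rfl : ids = ids' := funext fun p => funext fun j => hids p j
  funext w
  rcases w with ⟨i, w⟩ | w
  · cases w with
    | input j => rfl
    | tapeA => simp only [execWires, Sum.elim_inl, viewWires, htape i i.2]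
    | tapeK => simp only [execWires, Sum.elim_inl, viewWires, htape i i.2]
    | received r j => simp only [execWires, Sum.elim_inl, viewWires, hmsg _ _ r.isLt]
    | mpsuOut t => rfl
    | leaderMsg t => rfl
  · rfl

/-- Group elements that determine the data shown to the distinguisher: one for each entry of each
message, one for each identifier, and the values of the random oracle at the inputs. -/
abbrev Slot (m n : ℕ) : Type := (Fin m × Fin m × Fin n) ⊕ (Fin m × Fin n) ⊕ Fin (m * n)

/-- Names of pseudorandom group elements: they belong to a string, or to an entry of the list of
an honest party, and to a set of honest parties whose keys have been applied. -/
abbrev Name (m n l : ℕ) : Type :=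
  (BitVec l × Finset (Fin m)) ⊕ ((Fin m × Fin n) × Finset (Fin m))

/-- The name of the group element in a slot. -/
def slotName (C : Finset (Fin m)) (x : Fin m → Fin n → BitVec l) : Slot m n → Name m n l
  | .inl (p, r, j) => if p ∈ C then .inl (x p j, pathSet p r ∩ Cᶜ) else .inr ((p, j), pathSet p r ∩ Cᶜ)
  | .inr (.inl (p, j)) => .inl (x p j, Cᶜ)
  | .inr (.inr i) => .inl (x (finProdFinEquiv.symm i).1 (finProdFinEquiv.symm i).2, ∅)

/-- The exponent that the corrupted parties contribute to a message. -/
def slotExp {q : ℕ} (C : Finset (Fin m)) (τ : Fin m → Tape q) (p : Fin m) (r : ℕ) : ZMod q :=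
  (if p ∈ C then (τ p).1 else 1) * ∏ i ∈ pathSet p r ∩ C, (τ i).2

/-- The data shown to the distinguisher, in terms of the group elements in the slots. -/
def assemble (𝔾 : GroupFamily) (κ : ℕ) (C : Finset (Fin m)) (x : Fin m → Fin n → BitVec l)
    (τ : Fin m → Tape (𝔾.q κ)) (y : Slot m n → 𝔾.Carrier κ) :
    (C × ViewWire m n) ⊕ (Fin m × OutputWire m n) → ℕ :=
  execWires (𝔾.code κ) C x τ
    (fun p r j => if h : r < m then y (.inl (p, ⟨r, h⟩, j)) ^ (slotExp C τ p r).val else 1)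
    fun p j => y (.inr (.inl (p, j))) ^ (∏ i ∈ C, (τ i).2).val

/-- The real monomials: `mid y I` stands for `H y` to the keys of `I`. -/
def realLabel (x : Fin m → Fin n → BitVec l) : Name m n l → BitVec l × Finset (Fin m ⊕ Fin m)
  | .inl (y, I) => (y, disjSum ∅ I)
  | .inr ((p, j), I) => (x p j, disjSum {p} I)

/-- The monomials of the ideal execution: the bases are the values of `H`, the identifiers, and the
random lists. -/
def idealLabel (C : Finset (Fin m)) :
    Name m n l → (BitVec l ⊕ BitVec l ⊕ (Fin m × Fin n)) × Finset (Fin m ⊕ Fin m)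
  | .inl (y, I) => if Cᶜ ⊆ I then (.inr (.inl y), disjSum ∅ ∅) else (.inl y, disjSum ∅ I)
  | .inr (pj, I) => (.inr (.inr pj), disjSum ∅ I)

/-- The mask variable tells lists of honest parties from unmasked values and names their owner; the
position `j` is recovered from `x p j` because the elements of an input list are distinct. -/
theorem realLabel_injective {x : Fin m → Fin n → BitVec l} (hx : ∀ i, Function.Injective (x i)) :
    Function.Injective (realLabel x) := by
  have key : ∀ {A A' I I' : Finset (Fin m)}, disjSum A I = disjSum A' I' → A = A' ∧ I = I' := by
    intro A A' I I' h
    constructor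
    · ext i
      rw [← inl_mem_disjSum (t := I), h, inl_mem_disjSum]
    · ext i
      rw [← inr_mem_disjSum (s := A), h, inr_mem_disjSum]
  rintro (⟨y, I⟩ | ⟨⟨p, j⟩, I⟩) (⟨y', I'⟩ | ⟨⟨p', j'⟩, I'⟩) h
  · simp only [realLabel, Prod.mk.injEq] at h
    rw [h.1, (key h.2).2]
  · simp only [realLabel, Prod.mk.injEq] at h
    exact absurd (key h.2).1.symm (singleton_ne_empty _)
  · simp only [realLabel, Prod.mk.injEq] at h
    exact absurd (key h.2).1 (singleton_ne_empty _)
  · simp only [realLabel, Prod.mk.injEq] at h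
    obtain ⟨h1, h2⟩ := key h.2
    obtain rfl := singleton_injective h1
    rw [hx p h.1, h2]

/-- `idealLabel` forgets the set once it contains `Cᶜ`, but sets in slot names with a string lie
inside `Cᶜ`, so nothing is lost on them. -/
theorem idealLabel_slotName_eq_iff {C : Finset (Fin m)} (x : Fin m → Fin n → BitVec l)
    (s t : Slot m n) :
    idealLabel C (slotName C x s) = idealLabel C (slotName C x t) ↔
      slotName C x s = slotName C x t := by
  refine ⟨fun h => ?_, congrArg _⟩
  have key : ∀ {A A' I I' : Finset (Fin m)}, disjSum A I = disjSum A' I' → I = I' := by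
    intro A A' I I' h
    ext i
    rw [← inr_mem_disjSum (s := A), h, inr_mem_disjSum]
  have hsub : ∀ s : Slot m n, ∀ y I, slotName C x s = .inl (y, I) → I ⊆ Cᶜ := by
    rintro (⟨p, r, j⟩ | ⟨p, j⟩ | i) y I h
    · simp only [slotName] at h
      split_ifs at h
      simp only [Sum.inl.injEq, Prod.mk.injEq] at h
      rw [← h.2]
      exact inter_subset_right
    · simp only [slotName, Sum.inl.injEq, Prod.mk.injEq] at h
      rw [h.2]
    · simp only [slotName, Sum.inl.injEq, Prod.mk.injEq] at h
      rw [← h.2]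
      exact empty_subset _
  have hs := hsub s
  have ht := hsub t
  revert h hs ht
  generalize slotName C x s = a
  generalize slotName C x t = b
  rcases a with ⟨y, I⟩ | ⟨pj, I⟩ <;> rcases b with ⟨y', I'⟩ | ⟨pj', I'⟩ <;> intro h hs ht
  · simp only [idealLabel] at h
    split_ifs at h with h1 h2 h2
    · simp only [Prod.mk.injEq, Sum.inr.injEq, Sum.inl.injEq, and_true] at h
      rw [h, subset_antisymm (hs _ _ rfl) h1, subset_antisymm (ht _ _ rfl) h2]
    · simp at h
    · simp at h
    · simp only [Prod.mk.injEq, Sum.inl.injEq] at h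
      rw [h.1, key h.2]
  · simp only [idealLabel] at h
    split_ifs at h <;> simp at h
  · simp only [idealLabel] at h
    split_ifs at h <;> simp at h
  · simp only [idealLabel, Prod.mk.injEq, Sum.inr.injEq] at h
    rw [h.1, key h.2]

/-- The tapes that are given by a family of keys. -/
def tapeOf {Z : Type} (k : Fin m ⊕ Fin m → Z) (i : Fin m) : Z × Z := (k (.inl i), k (.inr i))

/-- The tapes `τ` of the corrupted parties and `ω` of the honest parties. -/
def mixTape {q : ℕ} (C : Finset (Fin m)) (τ ω : Fin m → Tape q) (i : Fin m) : Tape q :=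
  if i ∈ C then τ i else ω i

theorem prod_mixTape {q : ℕ} (C : Finset (Fin m)) (τ : Fin m → Tape q)
    (k : Fin m ⊕ Fin m → ZMod q) (P : Finset (Fin m)) :
    ∏ i ∈ P, (mixTape C τ (tapeOf k) i).2 =
      (∏ i ∈ P ∩ Cᶜ, k (.inr i)) * ∏ i ∈ P ∩ C, (τ i).2 := by
  have h1 : P.filter (· ∈ C) = P ∩ C := by ext; simp
  have h2 : P.filter (¬ · ∈ C) = P ∩ Cᶜ := by ext; simp
  rw [← prod_filter_mul_prod_filter_not P (· ∈ C), h1, h2, mul_comm]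
  congr 1
  · exact prod_congr rfl fun i hi => by
      rw [mixTape, if_neg (mem_compl.1 (mem_inter.1 hi).2)]; rfl
  · exact prod_congr rfl fun i hi => by rw [mixTape, if_pos (mem_inter.1 hi).2]

/-- The exponent of each element splits into the secret monomial, which forms the slot, and the
corrupted contribution, a constant applied by `assemble`. -/
theorem real_assemble (C : Finset (Fin m)) (x : Fin m → Fin n → BitVec l)
    (τ : Fin m → Tape (𝔾.q κ)) (w : BitVec l → ZMod (𝔾.q κ)) (k : Fin m ⊕ Fin m → ZMod (𝔾.q κ)) :
    execWires (𝔾.code κ) C x (mixTape C τ (tapeOf k))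
      (ringMsg (fun y => 𝔾.expo κ (w y)) x (mixTape C τ (tapeOf k)))
      (fun p j => 𝔾.expo κ (w (x p j)) ^ (∏ i, (mixTape C τ (tapeOf k) i).2).val) =
    assemble 𝔾 κ C x τ fun s => 𝔾.expo κ (w (realLabel x (slotName C x s)).1 *
      ∏ v ∈ (realLabel x (slotName C x s)).2, k v) := by
  refine execWires_congr _ _ _ (fun i hi => if_pos hi) (fun p r hr j => ?_) fun p j => ?_
  · rw [dif_pos hr, ringMsg_eq (show Fintype.card (𝔾.Carrier κ) = 𝔾.q κ from rfl), prod_ahead p hr.le fun i => (mixTape C τ (tapeOf k) i).2,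
      prod_mixTape, ← 𝔾.expo_mul, ← 𝔾.expo_mul]
    congr 1
    by_cases hp : p ∈ C
    · simp only [slotName, if_pos hp, realLabel, prod_disjSum, prod_empty, one_mul, slotExp, mixTape]
      ring
    · simp only [slotName, if_neg hp, realLabel, prod_disjSum, prod_singleton, slotExp, mixTape,
        tapeOf]
      ring
  · rw [prod_mixTape, univ_inter, univ_inter, ← 𝔾.expo_mul, ← 𝔾.expo_mul]
    congr 1
    simp only [slotName, realLabel, prod_disjSum, prod_empty, one_mul]
    ring

/-- The identifiers are written with the corrupted keys as a factor, so that `assemble` treats them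
as in the real execution and the backward computation cancels the inverted keys. -/
theorem ideal_assemble {C : Finset (Fin m)} (x : Fin m → Fin n → BitVec l)
    {τ : Fin m → Tape (𝔾.q κ)} (hτ : ∀ i ∈ C, IsUnit (τ i).2)
    (w : BitVec l ⊕ BitVec l ⊕ (Fin m × Fin n) → ZMod (𝔾.q κ))
    (k : Fin m ⊕ Fin m → ZMod (𝔾.q κ)) :
    execWires (𝔾.code κ) C x (mixTape C τ (tapeOf k))
      (simMsg 𝔾 κ C (fun y => 𝔾.expo κ (w (.inl y))) x (mixTape C τ (tapeOf k))
        (fun p j => w (.inr (.inr (p, j))))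
        fun p j => 𝔾.expo κ (w (.inr (.inl (x p j))) * ∏ i ∈ C, (τ i).2))
      (fun p j => 𝔾.expo κ (w (.inr (.inl (x p j))) * ∏ i ∈ C, (τ i).2)) =
    assemble 𝔾 κ C x τ fun s => 𝔾.expo κ (w (idealLabel C (slotName C x s)).1 *
      ∏ v ∈ (idealLabel C (slotName C x s)).2, k v) := by
  refine execWires_congr _ _ _ (fun i hi => if_pos hi) (fun p r hr j => ?_) fun p j => ?_
  · rw [dif_pos hr, ← 𝔾.expo_mul, simMsg]
    by_cases hp : p ∈ C
    · rw [if_pos hp]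
      have hsub : Cᶜ ⊆ pathSet p r ∩ Cᶜ ↔ Cᶜ ⊆ pathSet p r :=
        ⟨fun h => h.trans inter_subset_left, fun h => subset_inter h subset_rfl⟩
      by_cases hpath : Cᶜ ⊆ pathSet p r
      · rw [if_pos hpath, prod_Ico_ahead p r fun i => totientInv (mixTape C τ (tapeOf k) i).2,
          ← 𝔾.expo_mul]
        simp only [slotName, if_pos hp, idealLabel, if_pos (hsub.2 hpath), prod_disjSum, prod_empty,
          mul_one, slotExp]
        congr 1
        -- After the last honest party only corrupted ones remain, and their keys are invertible by
        -- `hτ`.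
        have hcompl : (pathSet p r)ᶜ ⊆ C := fun i hi => by
          by_contra hiC
          exact mem_compl.1 hi (hpath (mem_compl.2 hiC))
        have h1 : ∏ i ∈ C, (τ i).2 =
            (∏ i ∈ pathSet p r ∩ C, (τ i).2) * ∏ i ∈ (pathSet p r)ᶜ, (τ i).2 := by
          rw [← prod_union]
          · congr 1
            ext i
            have := @hcompl i
            simp only [mem_union, mem_inter, mem_compl] at this ⊢
            tauto
          · rw [disjoint_left]
            intro i hi hi'
            exact mem_compl.1 hi' (mem_inter.1 hi).1
        have h2 : (∏ i ∈ (pathSet p r)ᶜ, totientInv (mixTape C τ (tapeOf k) i).2) *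
            ∏ i ∈ (pathSet p r)ᶜ, (τ i).2 = 1 := by
          rw [← prod_mul_distrib]
          exact prod_eq_one fun i hi => by
            rw [mixTape, if_pos (hcompl hi), totientInv_mul (hτ i (hcompl hi))]
        have h3 : (mixTape C τ (tapeOf k) p).1 = (τ p).1 := by rw [mixTape, if_pos hp]
        rw [h1, h3]
        linear_combination w (.inr (.inl (x p j))) * (τ p).1 *
          (∏ i ∈ pathSet p r ∩ C, (τ i).2) * h2
      · rw [if_neg hpath, prod_ahead p hr.le fun i => (mixTape C τ (tapeOf k) i).2, prod_mixTape,
          ← 𝔾.expo_mul]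
        simp only [slotName, if_pos hp, idealLabel, if_neg (hsub.not.2 hpath), prod_disjSum,
          prod_empty, one_mul, slotExp, mixTape]
        congr 1
        ring
    · rw [if_neg hp, prod_ahead p hr.le fun i => (mixTape C τ (tapeOf k) i).2, prod_mixTape]
      simp only [slotName, if_neg hp, idealLabel, prod_disjSum, prod_empty, one_mul, slotExp]
      rw [GroupFamily.expo]
      congr 2
      ring
  · rw [← 𝔾.expo_mul]
    simp only [slotName, idealLabel, if_pos subset_rfl, prod_disjSum, prod_empty, mul_one]

/-- A bound for the size of the circuit that assembles the data shown to the distinguisher. -/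
def assembleCost (b μ l m n : ℕ) : ℕ :=
  (m * (n + 2 + 3 * (m * n)) + m * (m * n + n) + m * n) *
    (m * n * (b + 1 + powCost b μ b) + encodeCost b (m * n) + powCost b μ b + l + 2 * b + 4)

/-- The additional output wires pass on the hash values at the inputs, from which the oracle-free
distinguisher starts its table. -/
theorem exists_assemble (hμ : CodedMul (𝔾.code κ) (𝔾.len κ) μ) (C : Finset (Fin m))
    (x : Fin m → Fin n → BitVec l) (τ : Fin m → Tape (𝔾.q κ)) :
    ∃ c : Circuit (Slot m n) (((C × ViewWire m n) ⊕ (Fin m × OutputWire m n)) ⊕ Fin (m * n)),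
      c.size ≤ assembleCost (𝔾.len κ) μ l m n ∧ ∀ y : Slot m n → 𝔾.Carrier κ,
        c.eval noOracle (fun s => 𝔾.code κ (y s)) =
          Sum.elim (assemble 𝔾 κ C x τ y) fun i => 𝔾.code κ (y (.inr (.inr i))) := by
  let O : (Slot m n → 𝔾.Carrier κ) → ℕ → ℕ := fun _ => noOracle
  let V : (Slot m n → 𝔾.Carrier κ) → Slot m n → ℕ := fun y s => 𝔾.code κ (y s)
  set cost := m * n * (𝔾.len κ + 1 + powCost (𝔾.len κ) μ (𝔾.len κ)) +
    encodeCost (𝔾.len κ) (m * n) + powCost (𝔾.len κ) μ (𝔾.len κ) + l + 2 * 𝔾.len κ + 4 with hcost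
  have hslot : ∀ s, Comput O V 0 fun y => 𝔾.code κ (y s) := fun s => Comput.wire s
  have hpow : ∀ s a, Comput O V (𝔾.len κ + 1 + powCost (𝔾.len κ) μ (𝔾.len κ))
      fun y => 𝔾.code κ (y s ^ (a : ZMod (𝔾.q κ)).val) := fun s a =>
    (Comput.codedPow hμ (fun _ => 𝔾.val_lt a) (hslot s)
      (Comput.const_of_lt (𝔾.val_lt a))).mono (by omega)
  have hall : ∀ t, Comput O V cost fun y => encodeSet (𝔾.code κ)
      (allIds fun p j => y (.inr (.inl (p, j))) ^ (∏ i ∈ C, (τ i).2).val) t := by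
    intro t
    -- The identifiers are computed once, and the entry of the encoded set then reads them as wires.
    have h1 := ComputVec.pi_fin (O := O) (v := V) (w := fun y (i : Fin (m * n)) =>
      𝔾.code κ (y (.inr (.inl (finProdFinEquiv.symm i))) ^ (∏ i ∈ C, (τ i).2).val))
      fun i => hpow _ _
    have h2 := h1.comput (Comput.encodeSet (O := O) (𝔾.code_lt κ)
      (Y := fun y i => y (.inr (.inl (finProdFinEquiv.symm i))) ^ (∏ i ∈ C, (τ i).2).val)
      (fun i => Comput.wire i) t)
    refine (h2.congr fun y => ?_).mono (by omega)
    congr 1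
    ext z
    simp only [mem_image, mem_univ, true_and, allIds, mem_biUnion]
    constructor
    · rintro ⟨i, rfl⟩
      exact ⟨_, _, rfl⟩
    · rintro ⟨p, j, rfl⟩
      exact ⟨finProdFinEquiv (p, j), by simp⟩
  have hwire : ∀ z, Comput O V cost fun y =>
      Sum.elim (assemble 𝔾 κ C x τ y) (fun i => 𝔾.code κ (y (.inr (.inr i)))) z := by
    rintro ((⟨i, w⟩ | ⟨i, w⟩) | i)
    · cases w with
      | input j => exact (Comput.const_of_lt (x i j).isLt).mono (by omega)
      | tapeA => exact (Comput.const_of_lt (𝔾.val_lt (τ i).1)).mono (by omega)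
      | tapeK => exact (Comput.const_of_lt (𝔾.val_lt (τ i).2)).mono (by omega)
      | received r j =>
        refine ((hpow (.inl (ahead i (m - 1 - r.val), r, j)) (slotExp C τ (ahead i (m - 1 - r.val))
          r)).mono (by omega)).congr fun y => ?_
        simp [assemble, execWires, viewWires]
      | mpsuOut t =>
        by_cases hi : i.1.val = 0
        · exact (hall t).congr fun y => by simp [assemble, execWires, viewWires, hi]
        · exact ((Comput.const 0).mono (by simp; omega)).congr fun y => by
            simp [assemble, execWires, viewWires, hi]
      | leaderMsg t =>
        by_cases hi : i.1.val = 0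
        · exact ((Comput.const 0).mono (by simp; omega)).congr fun y => by
            simp [assemble, execWires, viewWires, hi]
        · exact (hall t).congr fun y => by simp [assemble, execWires, viewWires, hi]
    · cases w with
      | all t => exact hall t
      | own j => exact (hpow (.inr (.inl (i, j))) _).mono (by omega)
    · exact (hslot _).mono (Nat.zero_le _)
  obtain ⟨c, hc, hc'⟩ := ComputVec.pi hwire
  refine ⟨c, hc.trans ?_, hc'⟩
  simp only [Fintype.card_sum, Fintype.card_prod, Fintype.card_coe, Fintype.card_fin, card_viewWire,
    card_outputWire, assembleCost]
  gcongr
  exact card_finset_fin_le C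

end Slots

/-! ### Security for fixed keys of the corrupted parties -/

theorem expect_tape {m q : ℕ} [NeZero q] (F : (Fin m → Tape q) → ℝ) :
    𝔼 ω, F ω = 𝔼 k : Fin m ⊕ Fin m → ZMod q, F (tapeOf k) := by
  refine (Fintype.expect_bijective tapeOf ⟨fun k k' h => ?_, fun ω => ?_⟩ _ _ fun k => rfl).symm
  · funext v
    rcases v with i | i
    · exact congrArg Prod.fst (congrFun h i)
    · exact congrArg Prod.snd (congrFun h i)
  · exact ⟨Sum.elim (fun i => (ω i).1) fun i => (ω i).2, rfl⟩

section Core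

variable {𝔾 : GroupFamily} {κ μ m n l : ℕ}

theorem expect_expo {α : Type*} [Fintype α] [DecidableEq α] (F : (α → 𝔾.Carrier κ) → ℝ) :
    𝔼 H, F H = 𝔼 w : α → ZMod (𝔾.q κ), F fun y => 𝔾.expo κ (w y) :=
  (Fintype.expect_bijective (fun (w : α → ZMod (𝔾.q κ)) y => 𝔾.expo κ (w y))
    𝔾.expo_bijective.comp_left _ _ fun _ => rfl).symm

theorem expect_expo_mul_unit {α : Type*} [Fintype α] [DecidableEq α] {K : ZMod (𝔾.q κ)}
    (hK : IsUnit K) (F : (α → 𝔾.Carrier κ) → ℝ) :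
    𝔼 H, F H = 𝔼 w : α → ZMod (𝔾.q κ), F fun y => 𝔾.expo κ (w y * K) := by
  rw [expect_expo]
  have hbij : Function.Bijective fun a : ZMod (𝔾.q κ) => a * K :=
    (Units.mulRight_bijective hK.unit)
  exact (Fintype.expect_bijective (fun (w : α → ZMod (𝔾.q κ)) y => w y * K)
    hbij.comp_left _ _ fun _ => rfl).symm

/-- The random oracle can be removed from an experiment that evaluates it at the points `xs`. -/
theorem expect_oracleFree {l M : ℕ} {G α P : Type} [Fintype G] [Group G]
    [Fintype P] {code : G → ℕ} {xs : Fin M → BitVec l} {D : Circuit α Unit}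
    {D' : (Fin (M + D.size) → G) → Circuit (α ⊕ Fin M) Unit}
    (hD' : ∀ (v : α → ℕ) (H₀ : BitVec l → G),
        𝔼 H : BitVec l → G, accepts (D.eval (hashOracle code fun y =>
          if ∃ j, xs j = y then H₀ y else H y) v ()) =
        𝔼 r, accepts ((D' r).eval noOracle (Sum.elim v fun j => code (H₀ (xs j))) ()))
    (d : (BitVec l → G) → P → α → ℕ)
    (hd : ∀ H H' p, (∀ j, H (xs j) = H' (xs j)) → d H p = d H' p) :
    𝔼 H, 𝔼 p, accepts (D.eval (hashOracle code H) (d H p) ()) =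
      𝔼 r, 𝔼 H, 𝔼 p, accepts ((D' r).eval noOracle
        (Sum.elim (d H p) fun j => code (H (xs j))) ()) := by
  rw [expect_comm, expect_comm (s := (univ : Finset (Fin (M + D.size) → G)))]
  have h1 : ∀ p, 𝔼 H, accepts (D.eval (hashOracle code H) (d H p) ()) =
      𝔼 H, 𝔼 r, accepts ((D' r).eval noOracle
        (Sum.elim (d H p) fun j => code (H (xs j))) ()) := by
    intro p
    -- `H` is split into its values at the points `xs`, which alone affect the data, and an
    -- independent `H'` elsewhere, which only the distinguisher sees.
    rw [← expect_ite fun y => ∃ j, xs j = y]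
    refine expect_congr rfl fun H _ => ?_
    rw [← hD' (d H p) H]
    refine expect_congr rfl fun H' _ => ?_
    rw [hd (fun y => if ∃ j, xs j = y then H y else H' y) H p fun j => if_pos ⟨j, rfl⟩]
  simp only [h1]
  rw [expect_comm]
  exact expect_congr rfl fun H _ => expect_comm _ _ _

/-- The size of the oracle-free distinguisher of group elements in the slots. -/
def distinguisherCost (b μ m n l s : ℕ) : ℕ := assembleCost b μ l m n + lazyCost b l (m * n) s

/-- The number of slots. -/
def slotCount (m n : ℕ) : ℕ := m * (m * n) + (m * n + m * n)

theorem card_slot (m n : ℕ) : Fintype.card (Slot m n) = slotCount m n := by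
  simp [slotCount]

theorem ddhAdv_mono {s t : ℕ} (h : s ≤ t) : ddhAdv 𝔾 κ s ≤ ddhAdv 𝔾 κ t := by
  refine Real.sSup_le ?_ (ddhAdv_nonneg _ _ _)
  rintro _ ⟨D, hD, rfl⟩
  exact le_ddhAdv 𝔾 κ D (hD.trans h)

/-- A bound for the distinguishing advantage when the corrupted keys are invertible. -/
noncomputable def coreBound (𝔾 : GroupFamily) (κ μ m n l s : ℕ) : ℝ :=
  2 * ((m + m : ℕ) * (slotCount m n * ddhAdv 𝔾 κ (reductionCost (𝔾.len κ) μ (slotCount m n)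
    (distinguisherCost (𝔾.len κ) μ m n l s))))

/-- With the corrupted tapes fixed, both executions feed the same oracle-free circuits with powers
of `g` to monomials. Each side pays once for replacing them by independent elements, and the two
resulting distributions coincide. -/
theorem real_sub_ideal_le (hμ : CodedMul (𝔾.code κ) (𝔾.len κ) μ) {C : Finset (Fin m)}
    (hC : #C < m) {x : Fin m → Fin n → BitVec l} (hx : ∀ i, Function.Injective (x i))
    {τ : Fin m → Tape (𝔾.q κ)} (hτ : ∀ i ∈ C, IsUnit (τ i).2)
    (D : Circuit ((C × ViewWire m n) ⊕ (Fin m × OutputWire m n)) Unit) :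
    |𝔼 H : BitVec l → 𝔾.Carrier κ, 𝔼 ω : Fin m → Tape (𝔾.q κ),
        accepts (D.eval (hashOracle (𝔾.code κ) H) (execWires (𝔾.code κ) C x (mixTape C τ ω)
          (ringMsg H x (mixTape C τ ω))
          fun p j => H (x p j) ^ (∏ i, (mixTape C τ ω i).2).val) ()) -
      𝔼 H : BitVec l → 𝔾.Carrier κ, 𝔼 R : BitVec l → 𝔾.Carrier κ,
        𝔼 ω : Fin m → Tape (𝔾.q κ), 𝔼 u : Fin m × Fin n → ZMod (𝔾.q κ),
        accepts (D.eval (hashOracle (𝔾.code κ) H) (execWires (𝔾.code κ) C x (mixTape C τ ω)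
          (simMsg 𝔾 κ C H x (mixTape C τ ω) (fun p j => u (p, j)) fun p j => R (x p j))
          fun p j => R (x p j)) ())| ≤ coreBound 𝔾 κ μ m n l D.size := by
  -- An honest party exists, so a bare hash value never gets the label of an identifier.
  have hCne : ¬ Cᶜ ⊆ ∅ := by
    rw [subset_empty, compl_eq_empty_iff, ← card_eq_iff_eq_univ, Fintype.card_fin]
    exact hC.ne
  let xs : Fin (m * n) → BitVec l := fun i => x (finProdFinEquiv.symm i).1 (finProdFinEquiv.symm i).2
  have hxs : ∀ {H H' : BitVec l → 𝔾.Carrier κ}, (∀ j, H (xs j) = H' (xs j)) →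
      ∀ p j, H (x p j) = H' (x p j) := by
    intro H H' h p j
    have h1 := h (finProdFinEquiv (p, j))
    simp only [xs, Equiv.symm_apply_apply] at h1
    exact h1
  obtain ⟨D', hDsize, hD'⟩ := Circuit.exists_oracleFree (𝔾.code_lt κ) xs D
  obtain ⟨c, hcsize, hc⟩ := exists_assemble hμ C x τ
  let T : (Fin (m * n + D.size) → 𝔾.Carrier κ) → Circuit (Slot m n) Unit := fun r => .comp c (D' r)
  have hT : ∀ r, (T r).size ≤ distinguisherCost (𝔾.len κ) μ m n l D.size := fun r =>
    Nat.add_le_add hcsize (hDsize r)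
  have hTeval : ∀ r (y : Slot m n → 𝔾.Carrier κ), (T r).eval noOracle (fun s => 𝔾.code κ (y s)) () =
      (D' r).eval noOracle (Sum.elim (assemble 𝔾 κ C x τ y)
        fun i => 𝔾.code κ (y (.inr (.inr i)))) () := fun r y => by
    simp only [T, Circuit.eval, hc]
  let fr : Slot m n → BitVec l × Finset (Fin m ⊕ Fin m) := fun s => realLabel x (slotName C x s)
  let fi : Slot m n → (BitVec l ⊕ BitVec l ⊕ (Fin m × Fin n)) × Finset (Fin m ⊕ Fin m) := fun s =>
    idealLabel C (slotName C x s)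
  have hreal : 𝔼 H : BitVec l → 𝔾.Carrier κ, 𝔼 ω : Fin m → Tape (𝔾.q κ),
        accepts (D.eval (hashOracle (𝔾.code κ) H) (execWires (𝔾.code κ) C x (mixTape C τ ω)
          (ringMsg H x (mixTape C τ ω))
          fun p j => H (x p j) ^ (∏ i, (mixTape C τ ω i).2).val) ()) =
      𝔼 r, 𝔼 w : BitVec l → ZMod (𝔾.q κ), 𝔼 k : Fin m ⊕ Fin m → ZMod (𝔾.q κ),
        accepts ((T r).eval noOracle
          (fun s => 𝔾.code κ (𝔾.expo κ (w (fr s).1 * ∏ v ∈ (fr s).2, k v))) ()) := by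
    rw [expect_oracleFree hD' (fun H ω => execWires (𝔾.code κ) C x (mixTape C τ ω)
      (ringMsg H x (mixTape C τ ω)) fun p j => H (x p j) ^ (∏ i, (mixTape C τ ω i).2).val)]
    · refine expect_congr rfl fun r _ => ?_
      rw [expect_expo]
      refine expect_congr rfl fun w _ => ?_
      rw [expect_tape]
      refine expect_congr rfl fun k _ => ?_
      rw [hTeval, real_assemble]
      congr 4
      funext i
      simp [fr, slotName, realLabel, xs]
    · intro H H' ω h
      refine execWires_congr _ _ _ (fun i _ => rfl) (fun p r _ j => ?_) fun p j => ?_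
      · rw [ringMsg_eq (show Fintype.card (𝔾.Carrier κ) = 𝔾.q κ from rfl),
          ringMsg_eq (show Fintype.card (𝔾.Carrier κ) = 𝔾.q κ from rfl), hxs h]
      · rw [hxs h]
  have hK : IsUnit (∏ i ∈ C, (τ i).2) := by
    exact IsUnit.prod_iff.2 hτ
  have hideal : 𝔼 H : BitVec l → 𝔾.Carrier κ, 𝔼 R : BitVec l → 𝔾.Carrier κ,
        𝔼 ω : Fin m → Tape (𝔾.q κ), 𝔼 u : Fin m × Fin n → ZMod (𝔾.q κ),
        accepts (D.eval (hashOracle (𝔾.code κ) H) (execWires (𝔾.code κ) C x (mixTape C τ ω)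
          (simMsg 𝔾 κ C H x (mixTape C τ ω) (fun p j => u (p, j)) fun p j => R (x p j))
          fun p j => R (x p j)) ()) =
      𝔼 r, 𝔼 w : BitVec l ⊕ BitVec l ⊕ (Fin m × Fin n) → ZMod (𝔾.q κ),
        𝔼 k : Fin m ⊕ Fin m → ZMod (𝔾.q κ), accepts ((T r).eval noOracle
          (fun s => 𝔾.code κ (𝔾.expo κ (w (fi s).1 * ∏ v ∈ (fi s).2, k v))) ()) := by
    have h1 := expect_oracleFree (P := (BitVec l → 𝔾.Carrier κ) ×
      (Fin m → Tape (𝔾.q κ)) × (Fin m × Fin n → ZMod (𝔾.q κ))) hD'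
      (fun H p => execWires (𝔾.code κ) C x (mixTape C τ p.2.1)
          (simMsg 𝔾 κ C H x (mixTape C τ p.2.1) (fun i j => p.2.2 (i, j)) fun i j => p.1 (x i j))
          fun i j => p.1 (x i j)) ?_
    · simp only [expect_prod] at h1
      rw [h1]
      refine expect_congr rfl fun r _ => ?_
      rw [expect_expo, Fintype.expect_equiv (Equiv.sumArrowEquivProdArrow _ _ _) _
        (fun z : (BitVec l → ZMod (𝔾.q κ)) × (BitVec l ⊕ (Fin m × Fin n) → ZMod (𝔾.q κ)) =>
        𝔼 k : Fin m ⊕ Fin m → ZMod (𝔾.q κ), accepts ((T r).eval noOracle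
          (fun s => 𝔾.code κ (𝔾.expo κ (Sum.elim z.1 z.2 (fi s).1 * ∏ v ∈ (fi s).2, k v))) ()))
        fun w => by simp [Equiv.sumArrowEquivProdArrow], expect_prod]
      refine expect_congr rfl fun wH _ => ?_
      -- Multiplication by the unit `∏ i ∈ C, (τ i).2` permutes the exponents, which brings uniform
      -- identifiers into the form required by `ideal_assemble`.
      rw [expect_expo_mul_unit hK, Fintype.expect_equiv (Equiv.sumArrowEquivProdArrow _ _ _) _
        (fun z : (BitVec l → ZMod (𝔾.q κ)) × (Fin m × Fin n → ZMod (𝔾.q κ)) =>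
        𝔼 k : Fin m ⊕ Fin m → ZMod (𝔾.q κ), accepts ((T r).eval noOracle
          (fun s => 𝔾.code κ (𝔾.expo κ (Sum.elim wH (Sum.elim z.1 z.2) (fi s).1 *
            ∏ v ∈ (fi s).2, k v))) ()))
        fun w => by simp [Equiv.sumArrowEquivProdArrow], expect_prod]
      refine expect_congr rfl fun wR _ => ?_
      rw [expect_comm]
      refine expect_congr rfl fun u _ => ?_
      rw [expect_tape]
      refine expect_congr rfl fun k _ => ?_
      rw [hTeval]
      have h2 := ideal_assemble x hτ (Sum.elim wH (Sum.elim wR u)) k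
      simp only [Sum.elim_inl, Sum.elim_inr] at h2
      rw [h2]
      congr 4
      funext i
      simp [fi, slotName, idealLabel, xs, hCne]
    · intro H H' p h
      refine execWires_congr _ _ _ (fun i _ => rfl) (fun i r _ j => ?_) fun i j => rfl
      simp only [simMsg, hxs h]
  rw [hreal, hideal]
  refine abs_expect_sub_le fun r => ?_
  have hle : ddhAdv 𝔾 κ (reductionCost (𝔾.len κ) μ (Fintype.card (Slot m n)) (T r).size) ≤
      ddhAdv 𝔾 κ (reductionCost (𝔾.len κ) μ (slotCount m n)
        (distinguisherCost (𝔾.len κ) μ m n l D.size)) := by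
    rw [card_slot]
    exact ddhAdv_mono (Nat.add_le_add_left (hT r) _)
  have h1 := monomials_pseudorandom hμ (T r) (fun s => (fr s).1) fun s => (fr s).2
  have h2 := monomials_pseudorandom hμ (T r) (fun s => (fi s).1) fun s => (fi s).2
  -- The two labelings identify the same pairs of slots, so the intermediate distributions are
  -- equal.
  have h3 := expect_labels (α := ZMod (𝔾.q κ)) fr fi
    (fun s t => (realLabel_injective hx).eq_iff.trans (idealLabel_slotName_eq_iff x s t).symm)
    fun y => accepts ((T r).eval noOracle (fun s => 𝔾.code κ (𝔾.expo κ (y s))) ())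
  simp only [Prod.mk.eta] at h1 h2
  rw [h3] at h1
  rw [abs_sub_comm] at h2
  refine (abs_sub_le _ _ _).trans ((add_le_add h1 h2).trans ?_)
  rw [coreBound, two_mul, Fintype.card_sum, Fintype.card_fin]
  rw [card_slot] at hle ⊢
  gcongr

end Core

/-! ### Security for random keys -/

theorem expect_mem_Icc {α : Type*} [Fintype α] [Nonempty α] {f : α → ℝ}
    (h : ∀ a, f a ∈ Set.Icc (0 : ℝ) 1) : 𝔼 a, f a ∈ Set.Icc (0 : ℝ) 1 :=
  ⟨expect_nonneg fun a _ => (h a).1, expect_le univ_nonempty fun a _ => (h a).2⟩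

theorem accepts_mem_Icc (y : ℕ) : accepts y ∈ Set.Icc (0 : ℝ) 1 :=
  ⟨accepts_nonneg y, accepts_le_one y⟩

theorem expect_apply_coord {ι α : Type*} [Fintype ι] [DecidableEq ι] [Fintype α] [Nonempty α]
    (i : ι) (f : α → ℝ) : 𝔼 ω : ι → α, f (ω i) = 𝔼 a, f a := by
  rw [← expect_update i]
  simp only [Function.update_self, Fintype.expect_const]

section Games

variable {𝔾 : GroupFamily} {κ μ m n l : ℕ}

/-- A bound for the probability that one of `m` exponents is not invertible. -/
noncomputable def badBound (𝔾 : GroupFamily) (κ μ m : ℕ) : ℝ :=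
  m * (𝔾.len κ * (2 * ddhAdv 𝔾 κ (testCost (𝔾.len κ) μ)))

open Classical in
theorem expect_sum_not_isUnit_le (hμ : CodedMul (𝔾.code κ) (𝔾.len κ) μ)
    (f : Tape (𝔾.q κ) → ZMod (𝔾.q κ))
    (hf : ∀ g : ZMod (𝔾.q κ) → ℝ, 𝔼 t, g (f t) = 𝔼 a, g a) :
    𝔼 ω : Fin m → Tape (𝔾.q κ), ∑ i, (if IsUnit (f (ω i)) then 0 else 1 : ℝ) ≤
      badBound 𝔾 κ μ m := by
  rw [expect_sum_comm]
  have h : ∀ i ∈ (univ : Finset (Fin m)), 𝔼 ω : Fin m → Tape (𝔾.q κ),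
      (if IsUnit (f (ω i)) then 0 else 1 : ℝ) ≤
        𝔾.len κ * (2 * ddhAdv 𝔾 κ (testCost (𝔾.len κ) μ)) := by
    intro i _
    rw [expect_apply_coord i fun t => (if IsUnit (f t) then 0 else 1 : ℝ),
      hf fun a => (if IsUnit a then 0 else 1 : ℝ)]
    exact expect_not_isUnit_le hμ
  refine (sum_le_card_nsmul _ _ _ h).trans_eq ?_
  rw [badBound, card_univ, Fintype.card_fin, nsmul_eq_mul]

-- When every mask is invertible the unmasked lists are exact. Otherwise the gap, at most `1`, is
-- bounded by the number of non-invertible masks.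
open Classical in
theorem abs_real_sub_le (hμ : CodedMul (𝔾.code κ) (𝔾.len κ) μ) (C : Finset (Fin m))
    (x : Fin m → Fin n → BitVec l)
    (D : Circuit ((C × ViewWire m n) ⊕ (Fin m × OutputWire m n)) Unit) :
    |𝔼 H : BitVec l → 𝔾.Carrier κ, 𝔼 ω : Fin m → Tape (𝔾.q κ),
        accepts (D.eval (hashOracle (𝔾.code κ) H) (execWires (𝔾.code κ) C x ω
          (ringMsg H x ω) (ownIds H x ω)) ()) -
      𝔼 H : BitVec l → 𝔾.Carrier κ, 𝔼 ω : Fin m → Tape (𝔾.q κ),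
        accepts (D.eval (hashOracle (𝔾.code κ) H) (execWires (𝔾.code κ) C x ω
          (ringMsg H x ω) fun p j => H (x p j) ^ (∏ i, (ω i).2).val) ())| ≤
      badBound 𝔾 κ μ m := by
  refine abs_expect_sub_le fun H => ?_
  refine (abs_expect_sub_le_expect (c := fun ω : Fin m → Tape (𝔾.q κ) =>
    ∑ i, (if IsUnit (ω i).1 then 0 else 1 : ℝ)) fun ω => ?_).trans
    (expect_sum_not_isUnit_le hμ (fun t => t.1) fun g => ?_)
  · by_cases h : ∀ i, IsUnit (ω i).1
    · have h1 : ownIds H x ω = fun p j => H (x p j) ^ (∏ i, (ω i).2).val :=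
        funext fun p => funext fun j =>
          ownIds_eq (show Fintype.card (𝔾.Carrier κ) = 𝔾.q κ from rfl) H x ω p j (h p)
      rw [h1, sub_self, abs_zero]
      exact sum_nonneg fun i _ => by split_ifs <;> simp
    · push Not at h
      obtain ⟨i, hi⟩ := h
      refine (abs_accepts_sub_le_one _ _).trans ?_
      refine le_trans ?_ (single_le_sum (f := fun i => (if IsUnit (ω i).1 then 0 else 1 : ℝ))
        (fun i _ => by split_ifs <;> simp) (mem_univ i))
      simp [hi]
  · rw [expect_prod]
    simp only [Fintype.expect_const]

open Classical in
theorem abs_real_sub_ideal_le (hμ : CodedMul (𝔾.code κ) (𝔾.len κ) μ) {C : Finset (Fin m)}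
    (hC : #C < m) {x : Fin m → Fin n → BitVec l} (hx : ∀ i, Function.Injective (x i))
    (D : Circuit ((C × ViewWire m n) ⊕ (Fin m × OutputWire m n)) Unit) :
    |𝔼 H : BitVec l → 𝔾.Carrier κ, 𝔼 ω : Fin m → Tape (𝔾.q κ),
        accepts (D.eval (hashOracle (𝔾.code κ) H) (execWires (𝔾.code κ) C x ω
          (ringMsg H x ω) (ownIds H x ω)) ()) -
      𝔼 H : BitVec l → 𝔾.Carrier κ, 𝔼 R : BitVec l → 𝔾.Carrier κ,
        𝔼 ω : Fin m → Tape (𝔾.q κ), 𝔼 u : Fin m × Fin n → ZMod (𝔾.q κ),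
        accepts (D.eval (hashOracle (𝔾.code κ) H) (execWires (𝔾.code κ) C x ω
          (simMsg 𝔾 κ C H x ω (fun p j => u (p, j)) fun p j => R (x p j))
          fun p j => R (x p j)) ())| ≤
      2 * badBound 𝔾 κ μ m + coreBound 𝔾 κ μ m n l D.size := by
  have h1 := abs_real_sub_le hμ C x D
  let real : (BitVec l → 𝔾.Carrier κ) → (Fin m → Tape (𝔾.q κ)) → ℝ := fun H ω =>
    accepts (D.eval (hashOracle (𝔾.code κ) H) (execWires (𝔾.code κ) C x ω
      (ringMsg H x ω) fun p j => H (x p j) ^ (∏ i, (ω i).2).val) ())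
  let ideal : (BitVec l → 𝔾.Carrier κ) → (BitVec l → 𝔾.Carrier κ) → (Fin m → Tape (𝔾.q κ)) →
      ℝ := fun H R ω => 𝔼 u : Fin m × Fin n → ZMod (𝔾.q κ),
    accepts (D.eval (hashOracle (𝔾.code κ) H) (execWires (𝔾.code κ) C x ω
      (simMsg 𝔾 κ C H x ω (fun p j => u (p, j)) fun p j => R (x p j)) fun p j => R (x p j)) ())
  -- Drawing the tapes of the corrupted parties separately allows conditioning on them.
  have hmix : ∀ F : (Fin m → Tape (𝔾.q κ)) → ℝ, 𝔼 ω, F ω = 𝔼 τ, 𝔼 ω, F (mixTape C τ ω) :=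
    fun F => (expect_ite (fun i => i ∈ C) F).symm
  have h2 : 𝔼 H, 𝔼 ω, real H ω = 𝔼 τ, 𝔼 H, 𝔼 ω, real H (mixTape C τ ω) :=
    (expect_congr rfl fun H _ => hmix (real H)).trans (expect_comm _ _ _)
  have h3 : 𝔼 H, 𝔼 R, 𝔼 ω, ideal H R ω = 𝔼 τ, 𝔼 H, 𝔼 R, 𝔼 ω, ideal H R (mixTape C τ ω) :=
    (expect_congr rfl fun H _ => (expect_congr rfl fun R _ => hmix (ideal H R)).trans
      (expect_comm _ _ _)).trans (expect_comm _ _ _)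
  have hcore : 0 ≤ coreBound 𝔾 κ μ m n l D.size := by
    have := ddhAdv_nonneg 𝔾 κ (reductionCost (𝔾.len κ) μ (slotCount m n)
      (distinguisherCost (𝔾.len κ) μ m n l D.size))
    rw [coreBound]
    positivity
  have h4 : |𝔼 H, 𝔼 ω, real H ω - 𝔼 H, 𝔼 R, 𝔼 ω, ideal H R ω| ≤
      badBound 𝔾 κ μ m + coreBound 𝔾 κ μ m n l D.size := by
    rw [h2, h3]
    refine (abs_expect_sub_le_expect (c := fun τ : Fin m → Tape (𝔾.q κ) =>
      ∑ i, (if IsUnit (τ i).2 then 0 else 1 : ℝ) + coreBound 𝔾 κ μ m n l D.size)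
      fun τ => ?_).trans ?_
    · by_cases h : ∀ i ∈ C, IsUnit (τ i).2
      · refine (real_sub_ideal_le hμ hC hx h D).trans (le_add_of_nonneg_left ?_)
        exact sum_nonneg fun i _ => by split_ifs <;> simp
      · push Not at h
        obtain ⟨i, -, hi⟩ := h
        -- If a corrupted key is not invertible, the trivial bound `1` is charged to the count of
        -- such keys.
        have h5 : (1 : ℝ) ≤ ∑ i, (if IsUnit (τ i).2 then 0 else 1 : ℝ) := by
          refine le_trans ?_ (single_le_sum (f := fun i => (if IsUnit (τ i).2 then 0 else 1 : ℝ))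
            (fun i _ => by split_ifs <;> simp) (mem_univ i))
          simp [hi]
        have h6 : 𝔼 H, 𝔼 ω, real H (mixTape C τ ω) ∈ Set.Icc (0 : ℝ) 1 :=
          expect_mem_Icc fun H => expect_mem_Icc fun ω => accepts_mem_Icc _
        have h7 : 𝔼 H, 𝔼 R, 𝔼 ω, ideal H R (mixTape C τ ω) ∈ Set.Icc (0 : ℝ) 1 :=
          expect_mem_Icc fun H => expect_mem_Icc fun R => expect_mem_Icc fun ω =>
            expect_mem_Icc fun u => accepts_mem_Icc _
        rw [abs_le]
        constructor <;> linarith [h6.1, h6.2, h7.1, h7.2]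
    · rw [expect_add_distrib, Fintype.expect_const]
      gcongr
      refine expect_sum_not_isUnit_le hμ (fun t => t.2) fun g => ?_
      rw [expect_prod]
      simp only [Fintype.expect_const]
  calc _ ≤ _ := abs_sub_le _ (𝔼 H, 𝔼 ω, real H ω) _
    _ ≤ badBound 𝔾 κ μ m + (badBound 𝔾 κ μ m + coreBound 𝔾 κ μ m n l D.size) := add_le_add h1 h4
    _ = _ := by ring

end Games

/-! ### Asymptotics -/

theorem PolyBounded.const (c : ℕ) : PolyBounded fun _ => c := ⟨Polynomial.C c, fun κ => by simp⟩

theorem PolyBounded.add {f g : ℕ → ℕ} (hf : PolyBounded f) (hg : PolyBounded g) :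
    PolyBounded fun κ => f κ + g κ := by
  obtain ⟨p, hp⟩ := hf
  obtain ⟨r, hr⟩ := hg
  exact ⟨p + r, fun κ => by simpa using Nat.add_le_add (hp κ) (hr κ)⟩

theorem PolyBounded.mul {f g : ℕ → ℕ} (hf : PolyBounded f) (hg : PolyBounded g) :
    PolyBounded fun κ => f κ * g κ := by
  obtain ⟨p, hp⟩ := hf
  obtain ⟨r, hr⟩ := hg
  exact ⟨p * r, fun κ => by simpa using Nat.mul_le_mul (hp κ) (hr κ)⟩

theorem Negligible.natCast_mul {f : ℕ → ℝ} (hf : Negligible f) {g : ℕ → ℕ} (hg : PolyBounded g) :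
    Negligible fun κ => g κ * f κ := by
  obtain ⟨p, hp⟩ := hg
  refine (hf.polynomial_mul (p.map (Nat.castRingHom ℝ))).trans_abs_le fun κ => ?_
  have h : (g κ : ℝ) ≤ (p.map (Nat.castRingHom ℝ)).eval (κ : ℝ) := by
    have : (p.map (Nat.castRingHom ℝ)).eval (κ : ℝ) = (p.eval κ : ℕ) :=
      Polynomial.eval_natCast_map (Nat.castRingHom ℝ) p κ
    rw [this]
    exact_mod_cast hp κ
  simp only [abs_mul, Nat.abs_cast]
  exact mul_le_mul_of_nonneg_right (h.trans (le_abs_self _)) (abs_nonneg _)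

section Asymptotics

variable {b μ m n l s : ℕ → ℕ}

theorem polyBounded_powCost {L : ℕ → ℕ} (hb : PolyBounded b) (hμ : PolyBounded μ)
    (hL : PolyBounded L) : PolyBounded fun κ => powCost (b κ) (μ κ) (L κ) := by
  unfold powCost
  repeat first | assumption | apply PolyBounded.const | apply PolyBounded.add | apply PolyBounded.mul

theorem polyBounded_testCost (hb : PolyBounded b) (hμ : PolyBounded μ) :
    PolyBounded fun κ => testCost (b κ) (μ κ) := by
  unfold testCost
  have := polyBounded_powCost hb hμ hb
  repeat first | assumption | apply PolyBounded.const | apply PolyBounded.add | apply PolyBounded.mul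

theorem polyBounded_slotCount (hm : PolyBounded m) (hn : PolyBounded n) :
    PolyBounded fun κ => slotCount (m κ) (n κ) := by
  unfold slotCount
  repeat first | assumption | apply PolyBounded.const | apply PolyBounded.add | apply PolyBounded.mul

theorem polyBounded_simCost (hb : PolyBounded b) (hμ : PolyBounded μ) (hm : PolyBounded m)
    (hn : PolyBounded n) : PolyBounded fun κ => simCost (b κ) (μ κ) (m κ) (n κ) := by
  unfold simCost simWireCost
  have h1 := polyBounded_powCost hb hμ hb
  have h2 := polyBounded_powCost hb (((PolyBounded.const 4).mul hb).add (PolyBounded.const 5)) hb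
  repeat first | assumption | apply PolyBounded.const | apply PolyBounded.add | apply PolyBounded.mul

theorem polyBounded_assembleCost (hb : PolyBounded b) (hμ : PolyBounded μ) (hl : PolyBounded l)
    (hm : PolyBounded m) (hn : PolyBounded n) :
    PolyBounded fun κ => assembleCost (b κ) (μ κ) (l κ) (m κ) (n κ) := by
  unfold assembleCost encodeCost
  have h1 := polyBounded_powCost hb hμ hb
  repeat first | assumption | apply PolyBounded.const | apply PolyBounded.add | apply PolyBounded.mul

theorem polyBounded_reductionCost (hb : PolyBounded b) (hμ : PolyBounded μ) (hl : PolyBounded l)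
    (hm : PolyBounded m) (hn : PolyBounded n) (hs : PolyBounded s) :
    PolyBounded fun κ => reductionCost (b κ) (μ κ) (slotCount (m κ) (n κ))
      (distinguisherCost (b κ) (μ κ) (m κ) (n κ) (l κ) (s κ)) := by
  unfold reductionCost distinguisherCost lazyCost lookupCost
  have h1 := polyBounded_powCost hb hμ hb
  have h2 := polyBounded_slotCount hm hn
  have h3 := polyBounded_assembleCost hb hμ hl hm hn
  repeat first | assumption | apply PolyBounded.const | apply PolyBounded.add | apply PolyBounded.mul

theorem negligible_bound {𝔾 : GroupFamily} (hDDH : DDH 𝔾) (hμ : PolyBounded μ) (hl : PolyBounded l)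
    (hm : PolyBounded m) (hn : PolyBounded n) (hs : PolyBounded s) :
    Negligible fun κ => 2 * badBound 𝔾 κ (μ κ) (m κ) +
      coreBound 𝔾 κ (μ κ) (m κ) (n κ) (l κ) (s κ) := by
  have htest : Negligible fun κ => 2 * ddhAdv 𝔾 κ (testCost (𝔾.len κ) (μ κ)) :=
    Asymptotics.SuperpolynomialDecay.const_mul
      (negligible_ddhAdv hDDH (polyBounded_testCost 𝔾.len_poly hμ)) 2
  have hbad : Negligible fun κ => 2 * badBound 𝔾 κ (μ κ) (m κ) :=
    Asymptotics.SuperpolynomialDecay.const_mul ((htest.natCast_mul 𝔾.len_poly).natCast_mul hm) 2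
  have hcore : Negligible fun κ => coreBound 𝔾 κ (μ κ) (m κ) (n κ) (l κ) (s κ) :=
    Asymptotics.SuperpolynomialDecay.const_mul (((negligible_ddhAdv hDDH
      (polyBounded_reductionCost 𝔾.len_poly hμ hl hm hn hs)).natCast_mul
        (polyBounded_slotCount hm hn)).natCast_mul (hm.add hm)) 2
  exact Asymptotics.SuperpolynomialDecay.add hbad hcore

end Asymptotics

theorem realExec_accept {𝔾 : GroupFamily} {m n l : ℕ → ℕ} (C : ∀ κ, Finset (Fin (m κ)))
    (x : ∀ κ, Fin (m κ) → Fin (n κ) → BitVec (l κ)) (κ : ℕ) (D : Circuit (ExecWire m n C κ) Unit) :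
    (realExec 𝔾 m n l C x).accept κ D =
      𝔼 H : BitVec (l κ) → 𝔾.Carrier κ, 𝔼 ω : Fin (m κ) → Tape (𝔾.q κ),
        accepts (D.eval (hashOracle (𝔾.code κ) H) (execWires (𝔾.code κ) (C κ) (x κ) ω
          (ringMsg H (x κ) ω) (ownIds H (x κ) ω)) ()) := by
  have h : (realExec 𝔾 m n l C x).accept κ D =
      𝔼 p : (BitVec (l κ) → 𝔾.Carrier κ) × (Fin (m κ) → Tape (𝔾.q κ)),
        accepts (D.eval (hashOracle (𝔾.code κ) p.1) (Sum.elim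
          (fun w => (realView p.1 (x κ) p.2 w.1).encode (𝔾.code κ) w.2)
          (fun w => (realOutput p.1 (x κ) p.2 w.1).encode (𝔾.code κ) w.2)) ()) :=
    Ensemble.accept_eq_expect _ _ _
  rw [h, expect_prod]
  simp only [encode_realView, encode_realOutput]
  rfl

/-- The simulator made of the circuits `c`. -/
def simulatorOf {m n : ℕ} {C : Finset (Fin m)} (c : Circuit ((C × Fin n) ⊕ (C × OutputWire m n) ⊕
    (Fin (Fintype.card (SimCoin m n)) ⊕ Fin (Fintype.card (SimCoin m n)))) (C × ViewWire m n)) :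
    Simulator m n C where
  coins := Fintype.card (SimCoin m n)
  circuit := c

theorem idealExec_accept {𝔾 : GroupFamily} {m n l : ℕ → ℕ}
    (c : ∀ κ (C : Finset (Fin (m κ))), Circuit ((C × Fin (n κ)) ⊕ (C × OutputWire (m κ) (n κ)) ⊕
      (Fin (Fintype.card (SimCoin (m κ) (n κ))) ⊕ Fin (Fintype.card (SimCoin (m κ) (n κ)))))
      (C × ViewWire (m κ) (n κ)))
    (hc : ∀ κ C (H : BitVec (l κ) → 𝔾.Carrier κ) (x : Fin (m κ) → Fin (n κ) → BitVec (l κ))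
        (ids : Fin (m κ) → Fin (n κ) → 𝔾.Carrier κ)
        (bits : Fin (Fintype.card (SimCoin (m κ) (n κ))) → ℕ)
        (z : Fin (Fintype.card (SimCoin (m κ) (n κ))) → ZMod (𝔾.q κ)),
        (c κ C).eval (hashOracle (𝔾.code κ) H) (Sum.elim (fun w => (x w.1 w.2).toNat)
          (Sum.elim (fun w => outputWires (𝔾.code κ) ids w.1 w.2)
            (Sum.elim bits fun s => (z s).val))) =
        fun w => viewWires (𝔾.code κ) x (coinTape fun s => z (Fintype.equivFin _ s))
          (simMsg 𝔾 κ C H x (coinTape fun s => z (Fintype.equivFin _ s))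
            (fun p j => z (Fintype.equivFin _ (.inr (p, j)))) ids) ids w.1 w.2)
    (C : ∀ κ, Finset (Fin (m κ)))
    (x : ∀ κ, Fin (m κ) → Fin (n κ) → BitVec (l κ)) (κ : ℕ) (D : Circuit (ExecWire m n C κ) Unit) :
    (idealExec 𝔾 m n l (fun κ C => simulatorOf (c κ C)) C x).accept κ D =
      𝔼 H : BitVec (l κ) → 𝔾.Carrier κ, 𝔼 R : BitVec (l κ) → 𝔾.Carrier κ,
        𝔼 ω : Fin (m κ) → Tape (𝔾.q κ), 𝔼 u : Fin (m κ) × Fin (n κ) → ZMod (𝔾.q κ),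
        accepts (D.eval (hashOracle (𝔾.code κ) H) (execWires (𝔾.code κ) (C κ) (x κ) ω
          (simMsg 𝔾 κ (C κ) H (x κ) ω (fun p j => u (p, j)) fun p j => R (x κ p j))
          fun p j => R (x κ p j)) ()) := by
  let N := Fintype.card (SimCoin (m κ) (n κ))
  have h : (idealExec 𝔾 m n l (fun κ C => simulatorOf (c κ C)) C x).accept κ D =
      𝔼 p : (BitVec (l κ) → 𝔾.Carrier κ) × (BitVec (l κ) → 𝔾.Carrier κ) × (Fin N → Bool) ×
        (Fin N → ZMod (𝔾.q κ)),
        accepts (D.eval (hashOracle (𝔾.code κ) p.1) (Sum.elim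
          ((c κ (C κ)).eval (hashOracle (𝔾.code κ) p.1)
            (Sum.elim (fun w => (x κ w.1 w.2).toNat)
              (Sum.elim (fun w => (mpid (x κ) p.2.1 w.1).encode (𝔾.code κ) w.2)
                (Sum.elim (fun s => (p.2.2.1 s).toNat) fun s => (p.2.2.2 s).val))))
          fun w => (mpid (x κ) p.2.1 w.1).encode (𝔾.code κ) w.2) ()) :=
    Ensemble.accept_eq_expect _ _ _
  rw [h]
  simp only [expect_prod, encode_mpid, hc, Fintype.expect_const]
  refine expect_congr rfl fun H _ => expect_congr rfl fun R _ => ?_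
  -- The bit coins have been averaged away; the numbered coins in `ℤ/q` are renamed as tapes and
  -- list exponents.
  let F : (SimCoin (m κ) (n κ) → ZMod (𝔾.q κ)) → ℝ := fun z =>
    accepts (D.eval (hashOracle (𝔾.code κ) H) (execWires (𝔾.code κ) (C κ) (x κ) (coinTape z)
      (simMsg 𝔾 κ (C κ) H (x κ) (coinTape z) (fun p j => z (.inr (p, j))) fun p j => R (x κ p j))
      fun p j => R (x κ p j)) ())
  refine (expect_comp_injective (Fintype.equivFin (SimCoin (m κ) (n κ))).injective F).trans ?_
  rw [expect_tape, Fintype.expect_equiv (Equiv.sumArrowEquivProdArrow _ _ _) F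
    (fun p => F (Sum.elim p.1 p.2)) fun z => by simp [Equiv.sumArrowEquivProdArrow], expect_prod]
  rfl

theorem theorem5 (𝔾 : GroupFamily) (m n l : ℕ → ℕ)
    (hm : PolyBounded m) (hn : PolyBounded n) (hl : PolyBounded l) (hDDH : DDH 𝔾) :
    SecurelyImplementsMPID 𝔾 m n l := by
  obtain ⟨μ, hμ, hmul⟩ := 𝔾.exists_codedMul
  choose c hcsize hc using fun κ (C : Finset (Fin (m κ))) =>
    exists_simulator (n := n κ) (hmul κ) C
  refine ⟨fun κ C => simulatorOf (c κ C), ?_, fun C x hC hx D hD => ?_⟩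
  · obtain ⟨p, hp⟩ := polyBounded_simCost 𝔾.len_poly hμ hm hn
    refine ⟨p, fun κ C => le_trans ?_ (hp κ)⟩
    have hcard : Fintype.card (SimCoin (m κ) (n κ)) = m κ + m κ + m κ * n κ := by simp
    simp only [Simulator.size, simulatorOf, simCost, hcard]
    exact Nat.add_le_add_left (hcsize κ C) _
  · refine Asymptotics.SuperpolynomialDecay.trans_eventually_abs_le
      (negligible_bound hDDH hμ hl hm hn hD) ?_
    -- Negligibility concerns only large `κ`, so hypotheses that hold eventually suffice for the
    -- concrete bound.
    filter_upwards [hC, hx] with κ hCκ hxκ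
    simp only [Function.comp_apply, abs_abs]
    rw [realExec_accept, idealExec_accept c fun κ C => hc κ C]
    exact (abs_real_sub_ideal_le (hmul κ) hCκ hxκ (D κ)).trans (le_abs_self _)
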